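/- **Setting.** Let $X$ be a complex manifold and let $(\mathcal E^*,\delta)$ be a finite complex of locally free sheaves of $\mathcal O_X$-modules of finite rank on $X$ ($\mathcal E^r=0$ for $r\notin[p,q]$). Let $\mathcal A^{a,b}_X(\mathcal E^r)=\mathcal A^{a,b}_X\otimes_{\mathcal O_X}\mathcal E^r$ be the sheaf of smooth $(a,b)$-forms with coefficients in $\mathcal E^r$, and give $\mathcal A^{*,*}_X(\mathcal E^*)=\bigoplus_{a,b,r}\mathcal A^{a,b}_X(\mathcal E^r)$ the grading in which $\mathcal A^{a,b}_X(\mathcal E^r)$ has degree $a+b+r$. For a form $\phi$ and a local section $e$ of $\mathcal E^r$ put $\overline\partial(\phi\cdot e)=\overline\partial\phi\cdot e$ and $\delta(\phi\cdot e)=(-1)^{\overline\phi}\phi\cdot\delta(e)$, where $\overline{x}$ denotes the degree of a homogeneous $x$. For $\mathbb C$-linear sheaf endomorphisms of $\mathcal A^{*,*}_X(\mathcal E^*)$, $fg$ is the composition and $[f,g]=fg-(-1)^{\overline f\,\overline g}gf$. Let $A^{a,b}_X(\mathcal Hom^n_{\mathcal O_X}(\mathcal E^*,\mathcal E^*))$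 be the space of global smooth $(a,b)$-forms with coefficients in $\mathcal Hom^n_{\mathcal O_X}(\mathcal E^*,\mathcal E^*)$, viewed as endomorphisms of $\mathcal A^{*,*}_X(\mathcal E^*)$ of degree $a+b+n$ through $(\omega\cdot f)(\eta\cdot e)=(-1)^{\overline f\,\overline\eta}(\omega\wedge\eta)\cdot f(e)$; these are exactly the $\mathcal A^{*,*}_X$-linear endomorphisms $h$, i.e. $h(\phi s)=(-1)^{\overline h\,\overline\phi}\phi\,h(s)$, that map sections of $\mathcal E^r$ to $\mathcal A^{a,b}_X(\mathcal E^{r+n})$, for all $r$. The trace $\mathrm{Tr}\colon A^{*,*}_X(\mathcal Hom^*_{\mathcal O_X}(\mathcal E^*,\mathcal E^*))\to A^{*,*}_X$ is given, if $h(e^l_i)$ has $\mathcal E^l$-component $\sum_j c^l_{ij}\cdot e^l_j$ in local holomorphic frames $(e^l_i)_i$ of $\mathcal E^l$, by $\mathrm{Tr}(h)=\sum_l(-1)^l\sum_i c^l_{ii}$. A *connection of type $(1,0)$* on $\mathcal E^*$ is a $\mathbb C$-linear endomorphism $D$ of degree $1$ of the sheaf $\mathcal A^{*,*}_X(\mathcal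 E^*)$ with $D(\phi\cdot s)=d\phi\cdot s+(-1)^{\overline\phi}\phi\cdot D(s)$ for forms $\phi$ and sections $s$ of $\mathcal E^r$, and with $D(s)\in\mathcal A^{1,0}_X(\mathcal E^r)$ for sections $s$ of $\mathcal E^r$. Put $\nabla=[D-\overline\partial,-]$ and $u=[D,\overline\partial+\delta]=D(\overline\partial+\delta)+(\overline\partial+\delta)D$. Let $(V,[\delta+\overline\partial,-],[-,-])$ be the graded space $V=A^{0,*}_X(\mathcal Hom^*_{\mathcal O_X}(\mathcal E^*,\mathcal E^*))$ with differential $f\mapsto[\delta+\overline\partial,f]$ and the graded commutator as bracket. Let $L=\dfrac{A^{*,*}_X}{A^{\ge2,*}_X}[2]$ be the quotient of the de Rham complex $(A^{*,*}_X,d)$ of global smooth forms by the subcomplex of forms of type $(a,b)$ with $a\ge2$, shifted by $2$ (a $k$-form has degree $k-2$), with zero bracket. An *$L_\infty$ morphism* $g\colon V\rightsquigarrow L$ between DG-Lie algebras $(V,\delta_V,[-,-])$, $(L,d,\{-,-\})$ is a sequence of graded skew-symmetric $n$-linear maps $g_n\colon V^{\times n}\to L$ ($n\ge1$) of degree $1-n$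 such that $g_1\delta_V=dg_1$ and, for all $n\ge2$ and all homogeneous $v_1,\dots,v_n\in V$ (with $|v|$ the degree of $v$), $$\begin{aligned}\tfrac12\sum_{p=1}^{n-1}\sum_{\sigma\in S(p,n-p)}&\chi(\sigma)(-1)^{(1-n+p)(|v_{\sigma(1)}|+\cdots+|v_{\sigma(p)}|-p)}\{g_p(v_{\sigma(1)},\dots,v_{\sigma(p)}),g_{n-p}(v_{\sigma(p+1)},\dots,v_{\sigma(n)})\}+dg_n(v_1,\dots,v_n)\\ &=(-1)^{n-1}\sum_{\sigma\in S(1,n-1)}\chi(\sigma)g_n(\delta_Vv_{\sigma(1)},v_{\sigma(2)},\dots,v_{\sigma(n)})\\ &\quad+(-1)^{n-2}\sum_{\sigma\in S(2,n-2)}\chi(\sigma)g_{n-1}([v_{\sigma(1)},v_{\sigma(2)}],v_{\sigma(3)},\dots,v_{\sigma(n)}).\end{aligned}$$ Here $S(p,n-p)$ is the set of shuffles and $\chi(\sigma)$ is the antisymmetric Koszul sign, $v_{\sigma(1)}\wedge\cdots\wedge v_{\sigma(n)}=\chi(\sigma)\,v_1\wedge\cdots\wedge v_n$. **Statement.** $V$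 and $L$ are DG-Lie algebras over $\mathbb C$, and for every connection $D$ of type $(1,0)$ on $\mathcal E^*$ there is an $L_\infty$ morphism $$g\colon A^{0,*}_X(\mathcal Hom^*_{\mathcal O_X}(\mathcal E^*,\mathcal E^*))\rightsquigarrow\frac{A^{*,*}_X}{A^{\ge2,*}_X}[2]$$ whose components on homogeneous elements are the classes of $$\begin{aligned}g_1(f)&=-\mathrm{Tr}(uf)\in A^{1,*}_X[2],\\ g_2(f,g)&=-\tfrac12\mathrm{Tr}\bigl(\nabla(f)g-(-1)^{\overline f\,\overline g}\nabla(g)f\bigr)\in A^{1,*}_X[2],\\ g_3(f,g,h)&=\tfrac12\mathrm{Tr}(f[g,h])\in A^{0,*}_X[2],\end{aligned}$$ and $g_n=0$ for every $n>3$. -/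

import Mathlib

open CategoryTheory TopologicalSpace Opposite Manifold Filter
open scoped ContDiff TensorProduct Topology
set_option linter.unusedSectionVars false

noncomputable section
namespace Semireg

section Flat
variable (H : Type) [NormedAddCommGroup H] [NormedSpace ℂ H]

/-- Complex-valued real covectors on `H`, i.e. `T^* ⊗ ℂ`. -/
abbrev Covec : Type := H →ₗ[ℝ] ℂ

/-- The complexified exterior algebra of the cotangent space. -/
abbrev Lam : Type := ExteriorAlgebra ℂ (Covec H)

/-- Covectors of type `(1,0)`: the complex linear ones. -/
def cov10 : Submodule ℂ (Covec H) where
  carrier := {l | ∀ v, l (Complex.I • v) = Complex.I * l v}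
  add_mem' := by intro a b ha hb v; simp [ha v, hb v, mul_add]
  zero_mem' := by intro v; simp
  smul_mem' := by intro c a ha v; simp [ha v]; ring

/-- Covectors of type `(0,1)`: the complex antilinear ones. -/
def cov01 : Submodule ℂ (Covec H) where
  carrier := {l | ∀ v, l (Complex.I • v) = -(Complex.I * l v)}
  add_mem' := by intro a b ha hb v; simp only [LinearMap.add_apply, ha v, hb v]; ring
  zero_mem' := by intro v; simp
  smul_mem' := by intro c a ha v; simp only [LinearMap.smul_apply, ha v, smul_eq_mul]; ring

/-- The component of type `(a,b)` of the exterior algebra. -/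
def lamBi (a b : ℕ) : Submodule ℂ (Lam H) :=
  (cov10 H).map (ExteriorAlgebra.ι ℂ) ^ a * (cov01 H).map (ExteriorAlgebra.ι ℂ) ^ b

variable {H}

/-- Precomposition of covectors with a complex linear map. -/
def precomp (L : H →L[ℂ] H) : Covec H →ₗ[ℂ] Covec H where
  toFun l := l.comp ((L : H →ₗ[ℂ] H).restrictScalars ℝ)
  map_add' _ _ := rfl
  map_smul' _ _ := rfl

@[simp] lemma precomp_apply (L : H →L[ℂ] H) (l : Covec H) (v : H) :
    precomp L l v = l (L v) := rfl

/-- The projection `l ↦ (v ↦ (l v - i l (i v)) / 2)` to covectors of type `(1,0)`. -/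
def proj10 : Covec H →ₗ[ℂ] Covec H :=
  (1 / 2 : ℂ) • (LinearMap.id - Complex.I • precomp (Complex.I • ContinuousLinearMap.id ℂ H))

/-- The projection `l ↦ (v ↦ (l v + i l (i v)) / 2)` to covectors of type `(0,1)`. -/
def proj01 : Covec H →ₗ[ℂ] Covec H :=
  (1 / 2 : ℂ) • (LinearMap.id + Complex.I • precomp (Complex.I • ContinuousLinearMap.id ℂ H))

lemma proj10_apply (l : Covec H) (v : H) :
    proj10 l v = (1 / 2) * (l v - Complex.I * l (Complex.I • v)) := by simp [proj10]

lemma proj01_apply (l : Covec H) (v : H) :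
    proj01 l v = (1 / 2) * (l v + Complex.I * l (Complex.I • v)) := by simp [proj01]; ring

lemma I_smul_I_smul (v : H) : Complex.I • Complex.I • v = -v := by
  rw [smul_smul, Complex.I_mul_I, neg_one_smul]

lemma proj10_mem (l : Covec H) : proj10 l ∈ cov10 H := by
  intro v
  rw [proj10_apply, proj10_apply, I_smul_I_smul, map_neg]
  linear_combination (1 / 2) * l (Complex.I • v) * Complex.I_sq

lemma proj01_mem (l : Covec H) : proj01 l ∈ cov01 H := by
  intro v
  rw [proj01_apply, proj01_apply, I_smul_I_smul, map_neg]
  linear_combination (1 / 2) * l (Complex.I • v) * Complex.I_sq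

lemma proj10_add_proj01 (l : Covec H) : proj10 l + proj01 l = l := by
  ext v
  rw [LinearMap.add_apply, proj10_apply, proj01_apply]; ring

lemma proj10_of_mem10 {l : Covec H} (h : l ∈ cov10 H) : proj10 l = l := by
  ext v
  rw [proj10_apply, h v]; linear_combination (-1 / 2) * l v * Complex.I_sq

lemma proj01_of_mem10 {l : Covec H} (h : l ∈ cov10 H) : proj01 l = 0 := by
  have := proj10_add_proj01 l
  rw [proj10_of_mem10 h] at this
  simpa using this

lemma proj01_of_mem01 {l : Covec H} (h : l ∈ cov01 H) : proj01 l = l := by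
  ext v
  rw [proj01_apply, h v]; linear_combination (-1 / 2) * l v * Complex.I_sq

lemma proj10_of_mem01 {l : Covec H} (h : l ∈ cov01 H) : proj10 l = 0 := by
  have := proj10_add_proj01 l
  rw [proj01_of_mem01 h] at this
  simpa using this

lemma proj10_precomp (L : H →L[ℂ] H) (l : Covec H) :
    proj10 (precomp L l) = precomp L (proj10 l) := by
  ext v; simp [proj10_apply]

lemma proj01_precomp (L : H →L[ℂ] H) (l : Covec H) :
    proj01 (precomp L l) = precomp L (proj01 l) := by
  ext v; simp [proj01_apply]

/-- Pull-back of exterior covectors along a complex linear map. -/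
def pull (L : H →L[ℂ] H) : Lam H →ₐ[ℂ] Lam H := ExteriorAlgebra.map (precomp L)

@[simp] lemma pull_ι (L : H →L[ℂ] H) (l : Covec H) :
    pull L (ExteriorAlgebra.ι ℂ l) = ExteriorAlgebra.ι ℂ (precomp L l) :=
  ExteriorAlgebra.map_apply_ι _ _

lemma pull_pull (L K : H →L[ℂ] H) (x : Lam H) : pull L (pull K x) = pull (K.comp L) x := by
  have h : (pull L).comp (pull K) = pull (K.comp L) := by
    refine ExteriorAlgebra.hom_ext ?_
    ext l
    simp
    rfl
  exact DFunLike.congr_fun h x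

lemma pull_id (x : Lam H) : pull (ContinuousLinearMap.id ℂ H) x = x := by
  have h : pull (ContinuousLinearMap.id ℂ H) = AlgHom.id ℂ _ := by
    refine ExteriorAlgebra.hom_ext ?_
    ext l
    simp
    rfl
  exact DFunLike.congr_fun h x

/-- The parity involution of the exterior algebra: `(-1)^k` in degree `k`. -/
def invol : Lam H →ₐ[ℂ] Lam H := ExteriorAlgebra.map (-LinearMap.id)

@[simp] lemma invol_ι (l : Covec H) :
    invol (ExteriorAlgebra.ι ℂ l) = -ExteriorAlgebra.ι ℂ l := by
  simp [invol]

lemma invol_pull (L : H →L[ℂ] H) (x : Lam H) : invol (pull L x) = pull L (invol x) := by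
  have h : (invol).comp (pull L) = (pull L).comp invol := by
    refine ExteriorAlgebra.hom_ext ?_
    ext l
    simp
  exact DFunLike.congr_fun h x

lemma ι_mul_ι_comm (l m : Covec H) : ExteriorAlgebra.ι ℂ l * ExteriorAlgebra.ι ℂ m =
    -(ExteriorAlgebra.ι ℂ m * ExteriorAlgebra.ι ℂ l) :=
  eq_neg_of_add_eq_zero_left (ExteriorAlgebra.ι_add_mul_swap l m)

lemma ι_mul_eq (l : Covec H) (x : Lam H) :
    ExteriorAlgebra.ι ℂ l * x = invol x * ExteriorAlgebra.ι ℂ l := by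
  induction x using ExteriorAlgebra.induction with
  | algebraMap r => rw [AlgHom.commutes]; exact (Algebra.commutes r _).symm
  | ι m => rw [invol_ι, ι_mul_ι_comm, neg_mul]
  | mul a b ha hb => rw [← mul_assoc, ha, mul_assoc, hb, map_mul, mul_assoc]
  | add a b ha hb => rw [mul_add, ha, hb, map_add, add_mul]

lemma map_ι_mul_comm (p q : Submodule ℂ (Covec H)) :
    p.map (ExteriorAlgebra.ι ℂ) * q.map (ExteriorAlgebra.ι ℂ) =
      q.map (ExteriorAlgebra.ι ℂ) * p.map (ExteriorAlgebra.ι ℂ) := by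
  have key : ∀ p q : Submodule ℂ (Covec H),
      p.map (ExteriorAlgebra.ι ℂ) * q.map (ExteriorAlgebra.ι ℂ) ≤
      q.map (ExteriorAlgebra.ι ℂ) * p.map (ExteriorAlgebra.ι ℂ) := by
    intro p q
    rw [Submodule.mul_le]
    rintro _ ⟨l, hl, rfl⟩ _ ⟨m, hm, rfl⟩
    rw [ι_mul_ι_comm]
    exact Submodule.neg_mem _ (Submodule.mul_mem_mul ⟨m, hm, rfl⟩ ⟨l, hl, rfl⟩)
  exact le_antisymm (key p q) (key q p)

lemma lamBi_mul (a b a' b' : ℕ) : lamBi H a b * lamBi H a' b' = lamBi H (a + a') (b + b') := by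
  have hc : Commute ((cov10 H).map (ExteriorAlgebra.ι ℂ)) ((cov01 H).map (ExteriorAlgebra.ι ℂ)) :=
    map_ι_mul_comm _ _
  unfold lamBi
  rw [pow_add, pow_add, mul_assoc, ← mul_assoc (_ ^ b), ((hc.pow_pow a' b).eq).symm]
  simp only [mul_assoc]

lemma mul_mem_lamBi {a b a' b' : ℕ} {x y : Lam H} (hx : x ∈ lamBi H a b)
    (hy : y ∈ lamBi H a' b') : x * y ∈ lamBi H (a + a') (b + b') := by
  rw [← lamBi_mul]; exact Submodule.mul_mem_mul hx hy

lemma algebraMap_mem_lamBi (c : ℂ) : algebraMap ℂ (Lam H) c ∈ lamBi H 0 0 := by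
  simp only [lamBi, pow_zero, mul_one]
  exact Submodule.algebraMap_mem c

lemma ι_mem_lamBi10 {l : Covec H} (h : l ∈ cov10 H) :
    ExteriorAlgebra.ι ℂ l ∈ lamBi H 1 0 := by
  simp only [lamBi, pow_zero, mul_one, pow_one]; exact ⟨l, h, rfl⟩

lemma ι_mem_lamBi01 {l : Covec H} (h : l ∈ cov01 H) :
    ExteriorAlgebra.ι ℂ l ∈ lamBi H 0 1 := by
  simp only [lamBi, pow_zero, one_mul, pow_one]; exact ⟨l, h, rfl⟩

lemma invol_of_mem {a b : ℕ} {x : Lam H} (hx : x ∈ lamBi H a b) :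
    invol x = (-1 : ℂ) ^ (a + b) • x := by
  have h1 : ∀ (p : Submodule ℂ (Covec H)) (n : ℕ) (x : Lam H),
      x ∈ p.map (ExteriorAlgebra.ι ℂ) ^ n → invol x = (-1 : ℂ) ^ n • x := by
    intro p n
    induction n with
    | zero =>
      intro x hx
      rw [pow_zero, Submodule.mem_one] at hx
      obtain ⟨c, rfl⟩ := hx
      simp
    | succ n ih =>
      intro x hx
      rw [pow_succ] at hx
      induction hx using Submodule.mul_induction_on' with
      | mem_mul_mem m hm n' hn' =>
        obtain ⟨l, _, rfl⟩ := hn'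
        rw [map_mul, ih m hm, invol_ι, pow_succ]
        simp
      | add a _ b _ ha hb => rw [map_add, ha, hb, smul_add]
  induction hx using Submodule.mul_induction_on' with
  | mem_mul_mem m hm n hn =>
    rw [map_mul, h1 _ _ _ hm, h1 _ _ _ hn, pow_add, smul_mul_smul_comm]
  | add a _ b _ ha hb => rw [map_add, ha, hb, smul_add]

lemma pull_mem_lamBi (L : H →L[ℂ] H) {a b : ℕ} {x : Lam H} (hx : x ∈ lamBi H a b) :
    pull L x ∈ lamBi H a b := by
  have h1 : ∀ (p : Submodule ℂ (Covec H)), (∀ l ∈ p, precomp L l ∈ p) →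
      (p.map (ExteriorAlgebra.ι ℂ)).map (pull L).toLinearMap ≤ p.map (ExteriorAlgebra.ι ℂ) := by
    rintro p hp _ ⟨_, ⟨l, hl, rfl⟩, rfl⟩
    exact ⟨precomp L l, hp l hl, (pull_ι L l).symm⟩
  have h10 : ∀ l ∈ cov10 H, precomp L l ∈ cov10 H := fun l hl v => by
    rw [precomp_apply, precomp_apply, map_smul, hl]
  have h01 : ∀ l ∈ cov01 H, precomp L l ∈ cov01 H := fun l hl v => by
    rw [precomp_apply, precomp_apply, map_smul, hl]
  have : (lamBi H a b).map (pull L).toLinearMap ≤ lamBi H a b := by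
    unfold lamBi
    rw [Submodule.map_mul, Submodule.map_pow, Submodule.map_pow]
    exact mul_le_mul' (pow_le_pow_left' (h1 _ h10) a) (pow_le_pow_left' (h1 _ h01) b)
  exact this ⟨x, hx, rfl⟩

end Flat

section FlatD
variable {H : Type} [NormedAddCommGroup H] [NormedSpace ℂ H] [FiniteDimensional ℂ H]

variable (H) in
/-- A basis of the exterior algebra. -/
def lamBasis : Module.Basis (Finset (Fin (Module.finrank ℂ (Covec H)))) ℂ (Lam H) :=
  (Module.finBasis ℂ (Covec H)).ExteriorAlgebra

/-- The `s`-th coefficient function of a differential form on the vector space `H`. -/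
def coef (η : H → Lam H) (s : Finset (Fin (Module.finrank ℂ (Covec H)))) : H → ℂ :=
  fun z => (lamBasis H).repr (η z) s

/-- The differential of a function, as a complex-valued covector. -/
def dfun (f : H → ℂ) (y : H) : Covec H := (fderiv ℝ f y : H →ₗ[ℝ] ℂ)

/-- For `η = ∑ f_s b_s` with constant `b_s`, this is `∑ P(d f_s) ∧ b_s`. -/
def lamD (P : Covec H →ₗ[ℂ] Covec H) (η : H → Lam H) (y : H) : Lam H :=
  ∑ s, ExteriorAlgebra.ι ℂ (P (dfun (coef η s) y)) * lamBasis H s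

/-- Real differentiability of a form at a point. -/
def LDiff (η : H → Lam H) (y : H) : Prop := ∀ s, DifferentiableAt ℝ (coef η s) y

/-- Real smoothness of a form at a point. -/
def LSmooth (η : H → Lam H) (y : H) : Prop := ∀ s, ContDiffAt ℝ ∞ (coef η s) y

lemma LSmooth.ldiff {η : H → Lam H} {y : H} (h : LSmooth η y) : LDiff η y :=
  fun s => (h s).differentiableAt (by simp)

lemma eq_sum_coef (η : H → Lam H) (z : H) : η z = ∑ s, coef η s z • lamBasis H s :=
  ((lamBasis H).sum_repr (η z)).symm

lemma dfun_congr {f g : H → ℂ} {y : H} (h : f =ᶠ[𝓝 y] g) : dfun f y = dfun g y := by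
  unfold dfun; rw [h.fderiv_eq]

lemma coef_congr {η ζ : H → Lam H} {y : H} (h : η =ᶠ[𝓝 y] ζ) (s) :
    coef η s =ᶠ[𝓝 y] coef ζ s := by
  filter_upwards [h] with z hz
  simp [coef, hz]

lemma LSmooth.congr {η ζ : H → Lam H} {y : H} (hs : LSmooth η y) (h : η =ᶠ[𝓝 y] ζ) :
    LSmooth ζ y := fun s => (hs s).congr_of_eventuallyEq (coef_congr h s).symm

lemma LDiff.congr {η ζ : H → Lam H} {y : H} (hs : LDiff η y) (h : η =ᶠ[𝓝 y] ζ) :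
    LDiff ζ y := fun s => (hs s).congr_of_eventuallyEq (coef_congr h s).symm

lemma lamD_congr (P : Covec H →ₗ[ℂ] Covec H) {η ζ : H → Lam H} {y : H}
    (h : η =ᶠ[𝓝 y] ζ) : lamD P η y = lamD P ζ y := by
  unfold lamD
  refine Finset.sum_congr rfl fun s _ => ?_
  rw [dfun_congr (coef_congr h s)]

lemma functional_eq (θ : Lam H →ₗ[ℂ] ℂ) (η : H → Lam H) :
    (fun z => θ (η z)) = fun z => ∑ s, coef η s z * θ (lamBasis H s) := by
  funext z
  rw [eq_sum_coef η z, map_sum]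
  simp

lemma LSmooth.functional {η : H → Lam H} {y : H} (h : LSmooth η y) (θ : Lam H →ₗ[ℂ] ℂ) :
    ContDiffAt ℝ ∞ (fun z => θ (η z)) y := by
  rw [functional_eq]
  exact ContDiffAt.sum fun s _ => (h s).mul contDiffAt_const

lemma LDiff.functional {η : H → Lam H} {y : H} (h : LDiff η y) (θ : Lam H →ₗ[ℂ] ℂ) :
    DifferentiableAt ℝ (fun z => θ (η z)) y := by
  rw [functional_eq]
  exact DifferentiableAt.fun_sum fun s _ => (h s).mul (differentiableAt_const _)

lemma dfun_functional {η : H → Lam H} {y : H} (h : LDiff η y) (θ : Lam H →ₗ[ℂ] ℂ) :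
    dfun (fun z => θ (η z)) y = ∑ s, θ (lamBasis H s) • dfun (coef η s) y := by
  rw [functional_eq]
  unfold dfun
  have hd : ∀ s, DifferentiableAt ℝ (fun z => coef η s z * θ (lamBasis H s)) y :=
    fun s => (h s).mul_const _
  rw [fderiv_fun_sum (fun s _ => hd s)]
  ext v
  rw [ContinuousLinearMap.coe_coe, sum_apply, LinearMap.sum_apply]
  refine Finset.sum_congr rfl fun s _ => ?_
  rw [fderiv_mul_const (h s)]
  simp

lemma LSmooth.linear {η : H → Lam H} {y : H} (h : LSmooth η y) (T : Lam H →ₗ[ℂ] Lam H) :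
    LSmooth (fun z => T (η z)) y :=
  fun s => h.functional ((lamBasis H).coord s ∘ₗ T)

lemma LDiff.linear {η : H → Lam H} {y : H} (h : LDiff η y) (T : Lam H →ₗ[ℂ] Lam H) :
    LDiff (fun z => T (η z)) y :=
  fun s => h.functional ((lamBasis H).coord s ∘ₗ T)

lemma coef_add (η ζ : H → Lam H) (s) :
    coef (fun z => η z + ζ z) s = fun z => coef η s z + coef ζ s z := by
  funext z; simp [coef]

lemma LSmooth.add {η ζ : H → Lam H} {y : H} (h : LSmooth η y) (h' : LSmooth ζ y) :
    LSmooth (fun z => η z + ζ z) y := fun s => by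
  rw [coef_add]; exact (h s).add (h' s)

lemma LDiff.add {η ζ : H → Lam H} {y : H} (h : LDiff η y) (h' : LDiff ζ y) :
    LDiff (fun z => η z + ζ z) y := fun s => by
  rw [coef_add]; exact (h s).add (h' s)

lemma LSmooth.const (c : Lam H) (y : H) : LSmooth (fun _ => c) y := fun _ => contDiffAt_const

lemma LDiff.const (c : Lam H) (y : H) : LDiff (fun _ => c) y := fun _ => differentiableAt_const _

lemma coef_mul (η ζ : H → Lam H) (u) : coef (fun z => η z * ζ z) u = fun z => ∑ s, ∑ t,
    coef η s z * coef ζ t z * (lamBasis H).repr (lamBasis H s * lamBasis H t) u := by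
  funext z
  change (lamBasis H).repr (η z * ζ z) u = _
  conv_lhs => rw [eq_sum_coef η z, eq_sum_coef ζ z, Finset.sum_mul_sum]
  simp only [map_sum, Finsupp.coe_finsetSum, Finset.sum_apply, smul_mul_smul_comm, map_smul,
    Finsupp.smul_apply, smul_eq_mul]

lemma LSmooth.mul {η ζ : H → Lam H} {y : H} (h : LSmooth η y) (h' : LSmooth ζ y) :
    LSmooth (fun z => η z * ζ z) y := fun u => by
  rw [coef_mul]
  exact ContDiffAt.sum fun s _ => ContDiffAt.sum fun t _ =>
    ((h s).mul (h' t)).mul contDiffAt_const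

lemma LDiff.mul {η ζ : H → Lam H} {y : H} (h : LDiff η y) (h' : LDiff ζ y) :
    LDiff (fun z => η z * ζ z) y := fun u => by
  rw [coef_mul]
  exact DifferentiableAt.fun_sum fun s _ => DifferentiableAt.fun_sum fun t _ =>
    ((h s).mul (h' t)).mul (differentiableAt_const _)

lemma coef_smul_const (f : H → ℂ) (c : Lam H) (s) :
    coef (fun z => f z • c) s = fun z => (lamBasis H).repr c s * f z := by
  funext z; simp [coef, mul_comm]

lemma LDiff.smul_const {f : H → ℂ} {y : H} (h : DifferentiableAt ℝ f y) (c : Lam H) :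
    LDiff (fun z => f z • c) y := fun s => by
  rw [coef_smul_const]; exact h.const_mul _

lemma LSmooth.smul_const {f : H → ℂ} {y : H} (h : ContDiffAt ℝ ∞ f y) (c : Lam H) :
    LSmooth (fun z => f z • c) y := fun s => by
  rw [coef_smul_const]; exact contDiffAt_const.mul h

lemma dfun_const_mul {f : H → ℂ} {y : H} (h : DifferentiableAt ℝ f y) (c : ℂ) :
    dfun (fun z => c * f z) y = c • dfun f y := by
  unfold dfun; rw [fderiv_const_mul h]; rfl

lemma dfun_add {f g : H → ℂ} {y : H} (h : DifferentiableAt ℝ f y) (h' : DifferentiableAt ℝ g y) :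
    dfun (fun z => f z + g z) y = dfun f y + dfun g y := by
  unfold dfun; rw [fderiv_fun_add h h']; rfl

lemma dfun_mul {f g : H → ℂ} {y : H} (h : DifferentiableAt ℝ f y) (h' : DifferentiableAt ℝ g y) :
    dfun (fun z => f z * g z) y = f y • dfun g y + g y • dfun f y := by
  unfold dfun; rw [fderiv_fun_mul h h']; rfl

variable (P : Covec H →ₗ[ℂ] Covec H)

lemma lamD_add {η ζ : H → Lam H} {y : H} (h : LDiff η y) (h' : LDiff ζ y) :
    lamD P (fun z => η z + ζ z) y = lamD P η y + lamD P ζ y := by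
  unfold lamD
  rw [← Finset.sum_add_distrib]
  refine Finset.sum_congr rfl fun s _ => ?_
  rw [coef_add, dfun_add (h s) (h' s), map_add, map_add, add_mul]

lemma lamD_const_smul {η : H → Lam H} {y : H} (h : LDiff η y) (c : ℂ) :
    lamD P (fun z => c • η z) y = c • lamD P η y := by
  unfold lamD
  rw [Finset.smul_sum]
  refine Finset.sum_congr rfl fun s _ => ?_
  have : coef (fun z => c • η z) s = fun z => c * coef η s z := by funext z; simp [coef]
  rw [this, dfun_const_mul (h s), map_smul, map_smul, smul_mul_assoc]

lemma lamD_const (c : Lam H) (y : H) : lamD P (fun _ => c) y = 0 := by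
  unfold lamD
  refine Finset.sum_eq_zero fun s _ => ?_
  have : dfun (coef (fun _ : H => c) s) y = 0 := by
    unfold dfun coef; rw [fderiv_fun_const]; rfl
  rw [this]; simp

lemma lamD_smul_const {f : H → ℂ} {y : H} (h : DifferentiableAt ℝ f y) (c : Lam H) :
    lamD P (fun z => f z • c) y = ExteriorAlgebra.ι ℂ (P (dfun f y)) * c := by
  unfold lamD
  conv_rhs => rw [← (lamBasis H).sum_repr c, Finset.mul_sum]
  refine Finset.sum_congr rfl fun s _ => ?_
  rw [coef_smul_const, dfun_const_mul h, map_smul, map_smul, smul_mul_assoc, mul_smul_comm]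

lemma LDiff.sum {ι' : Type*} (F : Finset ι') {η : ι' → H → Lam H} {y : H}
    (h : ∀ i ∈ F, LDiff (η i) y) : LDiff (fun z => ∑ i ∈ F, η i z) y := by
  classical
  induction F using Finset.induction_on with
  | empty => simpa using LDiff.const 0 y
  | insert a F ha ih =>
    simp only [Finset.sum_insert ha]
    exact (h a (by simp)).add (ih fun i hi => h i (by simp [hi]))

lemma lamD_sum {ι' : Type*} (F : Finset ι') {η : ι' → H → Lam H} {y : H}
    (h : ∀ i ∈ F, LDiff (η i) y) :
    lamD P (fun z => ∑ i ∈ F, η i z) y = ∑ i ∈ F, lamD P (η i) y := by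
  classical
  induction F using Finset.induction_on with
  | empty => simpa using lamD_const P 0 y
  | insert a F ha ih =>
    simp only [Finset.sum_insert ha]
    rw [lamD_add P (h a (by simp)) (LDiff.sum F fun i hi => h i (by simp [hi])),
      ih fun i hi => h i (by simp [hi])]

/-- Graded Leibniz rule. -/
lemma lamD_mul {η ζ : H → Lam H} {y : H} (h : LDiff η y) (h' : LDiff ζ y) :
    lamD P (fun z => η z * ζ z) y = lamD P η y * ζ y + invol (η y) * lamD P ζ y := by
  have e : (fun z => η z * ζ z) = fun z => ∑ s, ∑ t,
      (coef η s z * coef ζ t z) • (lamBasis H s * lamBasis H t) := by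
    funext z
    conv_lhs => rw [eq_sum_coef η z, eq_sum_coef ζ z, Finset.sum_mul_sum]
    simp only [smul_mul_smul_comm]
  have hd : ∀ s t, DifferentiableAt ℝ (fun z => coef η s z * coef ζ t z) y :=
    fun s t => (h s).mul (h' t)
  rw [e, lamD_sum P _ fun s _ => LDiff.sum _ fun t _ => LDiff.smul_const (hd s t) _]
  have : ∀ s, lamD P (fun z => ∑ t, (coef η s z * coef ζ t z) • (lamBasis H s * lamBasis H t)) y =
      ∑ t, (ExteriorAlgebra.ι ℂ (P (dfun (coef η s) y)) * lamBasis H s *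
        (coef ζ t y • lamBasis H t) + invol (coef η s y • lamBasis H s) *
        (ExteriorAlgebra.ι ℂ (P (dfun (coef ζ t) y)) * lamBasis H t)) := by
    intro s
    rw [lamD_sum P _ fun t _ => LDiff.smul_const (hd s t) _]
    refine Finset.sum_congr rfl fun t _ => ?_
    rw [lamD_smul_const P (hd s t), dfun_mul (h s) (h' t), map_add, map_add, add_mul, map_smul,
      map_smul, map_smul, map_smul, map_smul, add_comm]
    congr 1
    · rw [smul_mul_assoc, mul_smul_comm, mul_assoc]
    · rw [smul_mul_assoc, smul_mul_assoc, ← mul_assoc, ι_mul_eq, mul_assoc]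
  simp only [this, Finset.sum_add_distrib]
  congr 1
  · rw [eq_sum_coef ζ y, lamD, Finset.sum_mul_sum]
  · conv_rhs => rw [eq_sum_coef η y, lamD, map_sum, Finset.sum_mul_sum]

lemma lamD_mem {S : Submodule ℂ (Lam H)} {N : Submodule ℂ (Covec H)} (hP : ∀ l, P l ∈ N)
    {η : H → Lam H} {y : H} (h : LDiff η y) (hS : ∀ᶠ z in 𝓝 y, η z ∈ S) :
    lamD P η y ∈ N.map (ExteriorAlgebra.ι ℂ) * S := by
  let e := Module.finBasis ℂ (Covec H)
  have h1 : lamD P η y = ∑ j, ExteriorAlgebra.ι ℂ (P (e j)) *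
      ∑ s, e.repr (dfun (coef η s) y) j • lamBasis H s := by
    simp only [Finset.mul_sum]
    rw [Finset.sum_comm]
    unfold lamD
    refine Finset.sum_congr rfl fun s _ => ?_
    conv_lhs => rw [← e.sum_repr (dfun (coef η s) y)]
    simp only [map_sum, map_smul, Finset.sum_mul, smul_mul_assoc, mul_smul_comm]
  rw [h1]
  refine Submodule.sum_mem _ fun j _ => Submodule.mul_mem_mul ⟨_, hP _, rfl⟩ ?_
  by_contra hc
  obtain ⟨θ, hθ, hle⟩ := Submodule.exists_le_ker_of_notMem hc
  refine hθ ?_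
  have h2 : dfun (fun z => θ (η z)) y = 0 := by
    have : (fun z => θ (η z)) =ᶠ[𝓝 y] fun _ => 0 := by
      filter_upwards [hS] with z hz using hle hz
    rw [dfun_congr this]
    unfold dfun; rw [fderiv_fun_const]; rfl
  rw [dfun_functional h] at h2
  have h3 := congrArg (fun l => e.repr l j) h2
  simp only [map_sum, map_smul, Finsupp.coe_finsetSum, Finset.sum_apply, Finsupp.smul_apply,
    map_zero, Finsupp.coe_zero, Pi.zero_apply, smul_eq_mul] at h3
  rw [map_sum, ← h3]
  refine Finset.sum_congr rfl fun s _ => ?_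
  rw [map_smul, smul_eq_mul, mul_comm]

lemma lamD_smooth {η : H → Lam H} {y : H} (h : LSmooth η y) : LSmooth (lamD P η) y := by
  intro t
  have : coef (lamD P η) t = fun z => ∑ s, (lamBasis H).repr
      (ExteriorAlgebra.ι ℂ (P (dfun (coef η s) z)) * lamBasis H s) t := by
    funext z; simp [coef, lamD]
  rw [this]
  refine ContDiffAt.sum fun s _ => ?_
  let Λ : (H →L[ℝ] ℂ) →ₗ[ℝ] ℂ :=
    { toFun := fun l => (lamBasis H).repr
        (ExteriorAlgebra.ι ℂ (P (l : H →ₗ[ℝ] ℂ)) * lamBasis H s) t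
      map_add' := by intro a b; simp [add_mul]
      map_smul' := by
        intro c a
        have : ((c • a : H →L[ℝ] ℂ) : H →ₗ[ℝ] ℂ) = (c : ℂ) • (a : H →ₗ[ℝ] ℂ) := by
          ext v; simp
        rw [this, map_smul, map_smul, smul_mul_assoc, map_smul]
        simp }
  have hΛ : ContDiff ℝ ∞ Λ := (LinearMap.toContinuousLinearMap Λ).contDiff
  exact hΛ.contDiffAt.comp y ((h s).fderiv_right (m := ∞) (by simp))

end FlatD

section FlatPull
variable {H : Type} [NormedAddCommGroup H] [NormedSpace ℂ H] [FiniteDimensional ℂ H]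

/-- A symmetric tensor has vanishing image in the exterior algebra. -/
lemma sum_ι_mul_ι_eq_zero {ι' : Type*} [Fintype ι'] (e : Module.Basis ι' ℂ (Covec H))
    (m : ι' → Covec H) (hm : ∀ a b, ∑ j, m j a * e j b = ∑ j, m j b * e j a) :
    ∑ j, ExteriorAlgebra.ι ℂ (m j) * ExteriorAlgebra.ι ℂ (e j) = 0 := by
  have hrep : ∀ j, m j = ∑ k, e.repr (m j) k • e k := fun j => (e.sum_repr (m j)).symm
  have happ : ∀ j a, m j a = ∑ k, e.repr (m j) k * e k a := by
    intro j a
    have h := congrArg (fun k : Covec H => k a) (hrep j)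
    simp only [LinearMap.sum_apply, LinearMap.smul_apply, smul_eq_mul] at h
    exact h
  have hsymm : ∀ j k, e.repr (m j) k = e.repr (m k) j := by
    have h1 : ∀ b k, ∑ j, (e.repr (m j) k - e.repr (m k) j) * e j b = 0 := by
      intro b
      have h2 : ∑ k, (∑ j, (e.repr (m j) k - e.repr (m k) j) * e j b) • e k = 0 := by
        ext a
        have h3 := hm a b
        simp only [happ, Finset.sum_mul] at h3
        simp only [LinearMap.sum_apply, LinearMap.smul_apply, smul_eq_mul, LinearMap.zero_apply,
          Finset.sum_mul, sub_mul, Finset.sum_sub_distrib]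
        rw [sub_eq_zero, Finset.sum_comm]
        refine Eq.trans (Eq.trans ?_ h3) ?_
        · refine Finset.sum_congr rfl fun j _ => Finset.sum_congr rfl fun k _ => ?_
          ring
        · refine Finset.sum_congr rfl fun j _ => Finset.sum_congr rfl fun k _ => ?_
          ring
      intro k
      exact Fintype.linearIndependent_iff.mp e.linearIndependent _ h2 k
    intro j k
    have h2 : ∑ j, (e.repr (m j) k - e.repr (m k) j) • e j = 0 := by
      ext b
      simpa using h1 b k
    exact sub_eq_zero.mp (Fintype.linearIndependent_iff.mp e.linearIndependent _ h2 j)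
  have h4 : ∑ j, ExteriorAlgebra.ι ℂ (m j) * ExteriorAlgebra.ι ℂ (e j) =
      ∑ j, ∑ k, e.repr (m j) k • (ExteriorAlgebra.ι ℂ (e k) * ExteriorAlgebra.ι ℂ (e j)) := by
    refine Finset.sum_congr rfl fun j _ => ?_
    conv_lhs => rw [hrep j]
    simp only [map_sum, map_smul, Finset.sum_mul, smul_mul_assoc]
  have h5 : ∑ j, ∑ k, e.repr (m j) k • (ExteriorAlgebra.ι ℂ (e k) * ExteriorAlgebra.ι ℂ (e j)) =
      -∑ j, ∑ k, e.repr (m j) k • (ExteriorAlgebra.ι ℂ (e k) * ExteriorAlgebra.ι ℂ (e j)) := by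
    conv_lhs => rw [Finset.sum_comm]
    rw [← Finset.sum_neg_distrib]
    refine Finset.sum_congr rfl fun j _ => ?_
    rw [← Finset.sum_neg_distrib]
    refine Finset.sum_congr rfl fun k _ => ?_
    rw [hsymm k j, ι_mul_ι_comm, smul_neg]
  rw [h4]
  generalize (∑ j, ∑ k, e.repr (m j) k •
    (ExteriorAlgebra.ι ℂ (e k) * ExteriorAlgebra.ι ℂ (e j))) = x at h5
  have h6 : (2 : ℂ) • x = 0 := by
    rw [two_smul]; nth_rewrite 1 [h5]; exact neg_add_cancel x
  exact (smul_eq_zero.mp h6).resolve_left two_ne_zero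

/-- The forms `φ^* c`, for a constant form `c` and a holomorphic map `φ` with derivative `T`,
depend smoothly on the point and are closed for both `∂` and `∂̄`. -/
lemma lamD_pull_const {P : Covec H →ₗ[ℂ] Covec H} (hP : P = proj10 ∨ P = proj01)
    {T : H → H →L[ℂ] H} {y : H} (hT : DifferentiableAt ℂ T y)
    (hsymm : ∀ a b, fderiv ℂ T y a b = fderiv ℂ T y b a) (c : Lam H) :
    LDiff (fun z => pull (T z) c) y ∧ lamD P (fun z => pull (T z) c) y = 0 := by
  let e := Module.finBasis ℂ (Covec H)
  -- the linear case
  have key : ∀ l : Covec H, (l ∈ cov10 H ∨ l ∈ cov01 H) →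
      LDiff (fun z => ExteriorAlgebra.ι ℂ (precomp (T z) l)) y ∧
        lamD P (fun z => ExteriorAlgebra.ι ℂ (precomp (T z) l)) y = 0 := by
    intro l hl
    let Λ : Fin (Module.finrank ℂ (Covec H)) → (H →L[ℂ] H) →ₗ[ℝ] ℂ := fun j =>
      { toFun := fun L => e.repr (precomp L l) j
        map_add' := by
          intro A B
          have : precomp (A + B) l = precomp A l + precomp B l := by ext v; simp
          rw [this]; simp
        map_smul' := by
          intro r A
          have : precomp (r • A) l = (r : ℂ) • precomp A l := by ext v; simp
          change e.repr (precomp (r • A) l) j = _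
          rw [this, map_smul, Finsupp.smul_apply]; rfl }
    have hΛ : ∀ j L, Λ j L = e.repr (precomp L l) j := fun _ _ => rfl
    have hTr : DifferentiableAt ℝ T y := hT.restrictScalars ℝ
    have hTf : fderiv ℝ T y = (fderiv ℂ T y).restrictScalars ℝ := hT.fderiv_restrictScalars ℝ
    have hj : ∀ j, HasFDerivAt (fun z => e.repr (precomp (T z) l) j)
        ((LinearMap.toContinuousLinearMap (Λ j)).comp (fderiv ℝ T y)) y := fun j =>
      ((LinearMap.toContinuousLinearMap (Λ j)).hasFDerivAt).comp y hTr.hasFDerivAt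
    have hdj : ∀ j a, dfun (fun z => e.repr (precomp (T z) l) j) y a =
        e.repr (precomp (fderiv ℂ T y a) l) j := by
      intro j a
      unfold dfun
      rw [(hj j).fderiv, hTf]
      rfl
    have heq : (fun z => ExteriorAlgebra.ι ℂ (precomp (T z) l)) = fun z =>
        ∑ j, e.repr (precomp (T z) l) j • ExteriorAlgebra.ι ℂ (e j) := by
      funext z
      conv_lhs => rw [← e.sum_repr (precomp (T z) l)]
      rw [map_sum]
      simp only [map_smul]
    have hd : ∀ j, LDiff (fun z => e.repr (precomp (T z) l) j • ExteriorAlgebra.ι ℂ (e j)) y :=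
      fun j => LDiff.smul_const (hj j).differentiableAt _
    rw [heq]
    refine ⟨LDiff.sum _ fun j _ => hd j, ?_⟩
    rw [lamD_sum P _ fun j _ => hd j]
    simp only [lamD_smul_const P (hj _).differentiableAt]
    set m := fun j => dfun (fun z => e.repr (precomp (T z) l) j) y with hmdef
    have hsum : ∀ a b, ∑ j, m j a * e j b = l (fderiv ℂ T y a b) := by
      intro a b
      simp only [hmdef, hdj]
      have := congrArg (fun k : Covec H => k b) (e.sum_repr (precomp (fderiv ℂ T y a) l))
      simp only [LinearMap.sum_apply, LinearMap.smul_apply, smul_eq_mul] at this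
      exact this
    have hmain : ∑ j, ExteriorAlgebra.ι ℂ (m j) * ExteriorAlgebra.ι ℂ (e j) = 0 :=
      sum_ι_mul_ι_eq_zero e m fun a b => by rw [hsum, hsum, hsymm]
    have hm10 : l ∈ cov10 H → ∀ j, m j ∈ cov10 H := by
      intro h j a
      simp only [hmdef, hdj]
      have : precomp (fderiv ℂ T y (Complex.I • a)) l =
          Complex.I • precomp (fderiv ℂ T y a) l := by
        ext v
        rw [map_smul]
        exact h _
      rw [this]; simp
    have hm01 : l ∈ cov01 H → ∀ j, m j ∈ cov01 H := by
      intro h j a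
      simp only [hmdef, hdj]
      have : precomp (fderiv ℂ T y (Complex.I • a)) l =
          -(Complex.I • precomp (fderiv ℂ T y a) l) := by
        ext v
        rw [map_smul]
        exact h _
      rw [this]; simp
    change ∑ j, ExteriorAlgebra.ι ℂ (P (m j)) * ExteriorAlgebra.ι ℂ (e j) = 0
    rcases hl with hl | hl <;> rcases hP with rfl | rfl
    · simpa only [proj10_of_mem10 (hm10 hl _)] using hmain
    · simp [proj01_of_mem10 (hm10 hl _)]
    · simp [proj10_of_mem01 (hm01 hl _)]
    · simpa only [proj01_of_mem01 (hm01 hl _)] using hmain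
  induction c using ExteriorAlgebra.induction with
  | algebraMap r =>
    simp only [AlgHom.commutes]
    exact ⟨LDiff.const _ _, lamD_const _ _ _⟩
  | ι l =>
    have h1 := key _ (Or.inl (proj10_mem l))
    have h2 := key _ (Or.inr (proj01_mem l))
    have heq : (fun z => pull (T z) (ExteriorAlgebra.ι ℂ l)) = fun z =>
        ExteriorAlgebra.ι ℂ (precomp (T z) (proj10 l)) +
        ExteriorAlgebra.ι ℂ (precomp (T z) (proj01 l)) := by
      funext z
      rw [← map_add, ← map_add, proj10_add_proj01, pull_ι]
    rw [heq]
    exact ⟨h1.1.add h2.1, by rw [lamD_add P h1.1 h2.1, h1.2, h2.2, add_zero]⟩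
  | mul a b ha hb =>
    simp only [map_mul]
    exact ⟨ha.1.mul hb.1, by rw [lamD_mul P ha.1 hb.1, ha.2, hb.2]; simp⟩
  | add a b ha hb =>
    simp only [map_add]
    exact ⟨ha.1.add hb.1, by rw [lamD_add P ha.1 hb.1, ha.2, hb.2, add_zero]⟩

/-- The operators `∂` and `∂̄` commute with pull-back along holomorphic maps. -/
lemma lamD_pull {P : Covec H →ₗ[ℂ] Covec H} (hP : P = proj10 ∨ P = proj01)
    {φ : H → H} {T : H → H →L[ℂ] H} {y : H} (hφ : HasFDerivAt φ (T y) y)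
    (hT : DifferentiableAt ℂ T y) (hsymm : ∀ a b, fderiv ℂ T y a b = fderiv ℂ T y b a)
    {ζ : H → Lam H} (hζ : LDiff ζ (φ y)) :
    lamD P (fun z => pull (T z) (ζ (φ z))) y = pull (T y) (lamD P ζ (φ y)) := by
  have heq : (fun z => pull (T z) (ζ (φ z))) = fun z =>
      ∑ s, algebraMap ℂ (Lam H) (coef ζ s (φ z)) * pull (T z) (lamBasis H s) := by
    funext z
    conv_lhs => rw [eq_sum_coef ζ (φ z), map_sum]
    refine Finset.sum_congr rfl fun s _ => ?_
    rw [map_smul, Algebra.smul_def]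
  have hφr : HasFDerivAt φ ((T y).restrictScalars ℝ) y := hφ.restrictScalars ℝ
  have hc : ∀ s, HasFDerivAt (fun z => coef ζ s (φ z))
      ((fderiv ℝ (coef ζ s) (φ y)).comp ((T y).restrictScalars ℝ)) y :=
    fun s => (hζ s).hasFDerivAt.comp y hφr
  have hc' : ∀ s, dfun (fun z => coef ζ s (φ z)) y = precomp (T y) (dfun (coef ζ s) (φ y)) := by
    intro s; unfold dfun; rw [(hc s).fderiv]; rfl
  have hk := fun s => lamD_pull_const hP hT hsymm (lamBasis H s)
  have ha : ∀ s, LDiff (fun z => algebraMap ℂ (Lam H) (coef ζ s (φ z))) y := by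
    intro s
    have := LDiff.smul_const (hc s).differentiableAt (1 : Lam H)
    simpa only [Algebra.algebraMap_eq_smul_one] using this
  have hcomm : ∀ l, P (precomp (T y) l) = precomp (T y) (P l) := by
    rcases hP with rfl | rfl
    · exact proj10_precomp _
    · exact proj01_precomp _
  rw [heq, lamD_sum P _ fun s _ => (ha s).mul (hk s).1]
  unfold lamD
  rw [map_sum]
  refine Finset.sum_congr rfl fun s _ => ?_
  change lamD P _ y = _
  rw [lamD_mul P (ha s) (hk s).1, (hk s).2, mul_zero, add_zero, map_mul, pull_ι, ← hcomm, ← hc']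
  congr 1
  simp only [Algebra.algebraMap_eq_smul_one]
  rw [lamD_smul_const P (hc s).differentiableAt, mul_one]

end FlatPull

section Mfd
variable {H : Type} [NormedAddCommGroup H] [NormedSpace ℂ H] [FiniteDimensional ℂ H]
  {X : Type} [TopologicalSpace X] [ChartedSpace H X] [IsManifold 𝓘(ℂ, H) ω X]

variable (H) in
/-- The differential at `z` of the change of coordinates from the chart at `x` to the chart
at `y`. -/
abbrev coc (x y z : X) : H →L[ℂ] H := tangentCoordChange 𝓘(ℂ, H) x y z

variable (H) in
/-- The point with coordinates `y` in the chart at `x`. -/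
abbrev pt (x : X) (y : H) : X := (chartAt H x).symm y

lemma coc_comp_coc {x y w z : X} (hx : z ∈ (chartAt H x).source) (hy : z ∈ (chartAt H y).source)
    (hw : z ∈ (chartAt H w).source) :
    (coc H y w z).comp (coc H x y z) = coc H x w z := by
  ext v
  refine tangentCoordChange_comp (I := 𝓘(ℂ, H)) ?_
  simp only [extChartAt_source]
  exact ⟨⟨hx, hy⟩, hw⟩

lemma coc_self {x z : X} (hx : z ∈ (chartAt H x).source) :
    coc H x x z = ContinuousLinearMap.id ℂ H := by
  ext v
  refine tangentCoordChange_self (I := 𝓘(ℂ, H)) ?_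
  simpa only [extChartAt_source] using hx

/-- Coordinate expression, in the chart at `x₀`, of a form `η` on `U` whose value at each point
`x` is expressed in the chart at `x`. -/
def rep {U : Opens X} (η : U → Lam H) (x₀ : X) (y : H) : Lam H :=
  open Classical in
  if h : pt H x₀ y ∈ U then pull (coc H x₀ (pt H x₀ y) (pt H x₀ y)) (η ⟨pt H x₀ y, h⟩) else 0

lemma eventually_pt {U : Opens X} {x₀ x : X} (hx : x ∈ U) (hs : x ∈ (chartAt H x₀).source) :
    ∀ᶠ z in 𝓝 (chartAt H x₀ x), z ∈ (chartAt H x₀).target ∧ pt H x₀ z ∈ U := by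
  have h1 := (chartAt H x₀).open_target.mem_nhds ((chartAt H x₀).map_source hs)
  have h2 : ContinuousAt (chartAt H x₀).symm (chartAt H x₀ x) :=
    (chartAt H x₀).continuousAt_symm ((chartAt H x₀).map_source hs)
  have h3 : ∀ᶠ z in 𝓝 (chartAt H x₀ x), pt H x₀ z ∈ U := by
    refine h2.eventually ?_
    rw [(chartAt H x₀).left_inv hs]
    exact U.isOpen.mem_nhds hx
  filter_upwards [h1, h3] with z hz hz' using ⟨hz, hz'⟩

lemma rep_center {U : Opens X} (η : U → Lam H) (x : U) :
    rep η x.1 (chartAt H x.1 x.1) = η x := by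
  have hp : pt H x.1 (chartAt H x.1 x.1) = x.1 :=
    (chartAt H x.1).left_inv (mem_chart_source H x.1)
  unfold rep
  rw [dif_pos (by rw [hp]; exact x.2)]
  simp only [hp]
  rw [coc_self (mem_chart_source H x.1), pull_id]

/-- A differential form is smooth if its coordinate expressions are. -/
def IsSmoothForm {U : Opens X} (η : U → Lam H) : Prop :=
  ∀ x : U, LSmooth (rep η x.1) (chartAt H x.1 x.1)

lemma rep_mul {U : Opens X} (η ζ : U → Lam H) (x₀ : X) :
    rep (η * ζ) x₀ = fun y => rep η x₀ y * rep ζ x₀ y := by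
  funext y
  unfold rep
  split_ifs with h
  · rw [Pi.mul_apply, map_mul]
  · rw [mul_zero]

lemma rep_add {U : Opens X} (η ζ : U → Lam H) (x₀ : X) :
    rep (η + ζ) x₀ = fun y => rep η x₀ y + rep ζ x₀ y := by
  funext y
  unfold rep
  split_ifs with h
  · rw [Pi.add_apply, map_add]
  · rw [add_zero]

lemma rep_smul {U : Opens X} (c : ℂ) (η : U → Lam H) (x₀ : X) :
    rep (c • η) x₀ = fun y => c • rep η x₀ y := by
  funext y
  unfold rep
  split_ifs with h
  · rw [Pi.smul_apply, map_smul]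
  · rw [smul_zero]

lemma rep_scalar {U : Opens X} (f : U → ℂ) (x : U) :
    rep (fun z => algebraMap ℂ (Lam H) (f z)) x.1 =ᶠ[𝓝 (chartAt H x.1 x.1)] fun y =>
      (open Classical in if h : pt H x.1 y ∈ U then f ⟨pt H x.1 y, h⟩ else 0) • (1 : Lam H) := by
  filter_upwards [eventually_pt x.2 (mem_chart_source H x.1)] with y hy
  unfold rep
  rw [dif_pos hy.2, dif_pos hy.2, AlgHom.commutes, Algebra.algebraMap_eq_smul_one]

lemma rep_algebraMap {U : Opens X} (c : ℂ) (x : U) :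
    rep (fun _ : U => algebraMap ℂ (Lam H) c) x.1 =ᶠ[𝓝 (chartAt H x.1 x.1)] fun _ =>
      algebraMap ℂ (Lam H) c := by
  filter_upwards [eventually_pt x.2 (mem_chart_source H x.1)] with y hy
  unfold rep
  rw [dif_pos hy.2, AlgHom.commutes]

variable (H) in
/-- The algebra `A^{*,*}(U)` of smooth complex-valued differential forms on `U`. -/
def Forms (U : Opens X) : Subalgebra ℂ (U → Lam H) where
  carrier := {η | IsSmoothForm η}
  mul_mem' := by
    intro a b ha hb x
    rw [rep_mul]; exact (ha x).mul (hb x)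
  add_mem' := by
    intro a b ha hb x
    rw [rep_add]; exact (ha x).add (hb x)
  algebraMap_mem' := by
    intro c x
    exact (LSmooth.const _ _).congr (rep_algebraMap c x).symm

/-- Change of charts for coordinate expressions. -/
lemma rep_change {U : Opens X} (η : U → Lam H) {x₀ x w : X} (h0 : w ∈ (chartAt H x₀).source)
    (hx : w ∈ (chartAt H x).source) (hw : w ∈ U) :
    rep η x₀ (chartAt H x₀ w) = pull (coc H x₀ x w) (rep η x (chartAt H x w)) := by
  have e0 : pt H x₀ (chartAt H x₀ w) = w := (chartAt H x₀).left_inv h0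
  have e1 : pt H x (chartAt H x w) = w := (chartAt H x).left_inv hx
  unfold rep
  rw [dif_pos (by rw [e0]; exact hw), dif_pos (by rw [e1]; exact hw)]
  simp only [e0, e1]
  rw [pull_pull, coc_comp_coc h0 hx (mem_chart_source H w)]

/-- The local expression of a transition map and its derivative. -/
lemma transition {x₀ x w : X} (h0 : w ∈ (chartAt H x₀).source)
    (hx : w ∈ (chartAt H x).source) :
    ContDiffAt ℂ ω ((chartAt H x) ∘ (chartAt H x₀).symm) (chartAt H x₀ w) := by
  have h := contDiffWithinAt_ext_coord_change (I := 𝓘(ℂ, H)) (n := ω) x x₀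
    (y := chartAt H x₀ w) (by
      simp only [mfld_simps, h0, hx])
  simpa only [mfld_simps, contDiffWithinAt_univ] using h

lemma transition_hasFDerivAt {x₀ x w : X} (h0 : w ∈ (chartAt H x₀).source)
    (hx : w ∈ (chartAt H x).source) :
    HasFDerivAt ((chartAt H x) ∘ (chartAt H x₀).symm) (coc H x₀ x w) (chartAt H x₀ w) := by
  have h := hasFDerivWithinAt_tangentCoordChange (I := 𝓘(ℂ, H)) (x := x₀) (y := x) (z := w) (by
      simp only [extChartAt_source]; exact ⟨h0, hx⟩)
  simpa only [mfld_simps, hasFDerivWithinAt_univ] using h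

/-- The differential operator `∂` or `∂̄`, computed in the chart at the given point. -/
def dP (P : Covec H →ₗ[ℂ] Covec H) {U : Opens X} (η : U → Lam H) : U → Lam H :=
  fun x => lamD P (rep η x.1) (chartAt H x.1 x.1)

lemma rep_dP {P : Covec H →ₗ[ℂ] Covec H} (hP : P = proj10 ∨ P = proj01) {U : Opens X}
    {η : U → Lam H} (hη : IsSmoothForm η) {x₀ x : X} (hx : x ∈ U)
    (h0 : x ∈ (chartAt H x₀).source) :
    rep (dP P η) x₀ (chartAt H x₀ x) = lamD P (rep η x₀) (chartAt H x₀ x) := by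
  have e0 : pt H x₀ (chartAt H x₀ x) = x := (chartAt H x₀).left_inv h0
  have hxs := mem_chart_source H x
  have h1 : rep (dP P η) x₀ (chartAt H x₀ x) =
      pull (coc H x₀ x x) (lamD P (rep η x) (chartAt H x x)) := by
    rw [rep_change _ h0 hxs hx, rep_center _ (⟨x, hx⟩ : U)]
    rfl
  let φ : H → H := (chartAt H x) ∘ (chartAt H x₀).symm
  let T : H → H →L[ℂ] H := fun z => coc H x₀ x (pt H x₀ z)
  have hev : ∀ᶠ z in 𝓝 (chartAt H x₀ x), (z ∈ (chartAt H x₀).target ∧ pt H x₀ z ∈ U) ∧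
      pt H x₀ z ∈ (chartAt H x).source := by
    refine (eventually_pt hx h0).and ?_
    have := eventually_pt (U := ⟨(chartAt H x).source, (chartAt H x).open_source⟩) hxs h0
    filter_upwards [this] with z hz using hz.2
  have h2 : rep η x₀ =ᶠ[𝓝 (chartAt H x₀ x)] fun z => pull (T z) (rep η x (φ z)) := by
    filter_upwards [hev] with z hz
    have := rep_change η (x₀ := x₀) (x := x) (w := pt H x₀ z)
      ((chartAt H x₀).map_target hz.1.1) hz.2 hz.1.2
    rwa [(chartAt H x₀).right_inv hz.1.1] at this
  have hTφ : T =ᶠ[𝓝 (chartAt H x₀ x)] fderiv ℂ φ := by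
    filter_upwards [hev] with z hz
    have := transition_hasFDerivAt (x₀ := x₀) (x := x) (w := pt H x₀ z)
      ((chartAt H x₀).map_target hz.1.1) hz.2
    rw [(chartAt H x₀).right_inv hz.1.1] at this
    exact this.fderiv.symm
  have hφ : ContDiffAt ℂ ω φ (chartAt H x₀ x) := transition h0 hxs
  have hφy : φ (chartAt H x₀ x) = chartAt H x x := by
    change chartAt H x ((chartAt H x₀).symm _) = _
    rw [(chartAt H x₀).left_inv h0]
  have hTd : DifferentiableAt ℂ T (chartAt H x₀ x) := by
    refine DifferentiableAt.congr_of_eventuallyEq ?_ hTφ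
    exact (hφ.fderiv_right (m := 1) (by simp)).differentiableAt (by simp)
  have hTs : ∀ a b, fderiv ℂ T (chartAt H x₀ x) a b = fderiv ℂ T (chartAt H x₀ x) b a := by
    rw [hTφ.fderiv_eq]
    exact hφ.isSymmSndFDerivAt_of_omega
  have hφd : HasFDerivAt φ (T (chartAt H x₀ x)) (chartAt H x₀ x) := by
    change HasFDerivAt φ (coc H x₀ x (pt H x₀ (chartAt H x₀ x))) _
    rw [e0]; exact transition_hasFDerivAt h0 hxs
  rw [h1, lamD_congr P h2, lamD_pull hP hφd hTd hTs (by rw [hφy]; exact (hη ⟨x, hx⟩).ldiff), hφy]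
  change _ = pull (coc H x₀ x (pt H x₀ (chartAt H x₀ x))) _
  rw [e0]

lemma dP_smooth {P : Covec H →ₗ[ℂ] Covec H} (hP : P = proj10 ∨ P = proj01) {U : Opens X}
    {η : U → Lam H} (hη : IsSmoothForm η) : IsSmoothForm (dP P η) := by
  intro x
  refine (lamD_smooth P (hη x)).congr ?_
  filter_upwards [eventually_pt x.2 (mem_chart_source H x.1)] with z hz
  have := rep_dP hP hη hz.2 ((chartAt H x.1).map_target hz.1)
  rwa [(chartAt H x.1).right_inv hz.1, eq_comm] at this

/-- The operator `∂` or `∂̄` on smooth forms. -/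
def formD (P : Covec H →ₗ[ℂ] Covec H) (hP : P = proj10 ∨ P = proj01) (U : Opens X) :
    Forms H U →ₗ[ℂ] Forms H U where
  toFun η := ⟨dP P η.1, dP_smooth hP η.2⟩
  map_add' := by
    intro a b
    ext1; funext x
    change lamD P (rep (a.1 + b.1) x.1) _ = _
    rw [rep_add, lamD_add P (a.2 x).ldiff (b.2 x).ldiff]
    rfl
  map_smul' := by
    intro c a
    ext1; funext x
    change lamD P (rep (c • a.1) x.1) _ = _
    rw [rep_smul, lamD_const_smul P (a.2 x).ldiff]
    rfl

/-- The operator `∂`. -/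
def del (U : Opens X) : Forms H U →ₗ[ℂ] Forms H U := formD proj10 (Or.inl rfl) U

/-- The operator `∂̄`. -/
def delbar (U : Opens X) : Forms H U →ₗ[ℂ] Forms H U := formD proj01 (Or.inr rfl) U

/-- The de Rham differential `d = ∂ + ∂̄`. -/
def deRham (U : Opens X) : Forms H U →ₗ[ℂ] Forms H U := del U + delbar U

lemma formD_mul {P : Covec H →ₗ[ℂ] Covec H} (hP : P = proj10 ∨ P = proj01) {U : Opens X}
    (a b : Forms H U) (x : U) : (formD P hP U (a * b)).1 x =
      (formD P hP U a).1 x * b.1 x + invol (a.1 x) * (formD P hP U b).1 x := by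
  change lamD P (rep (a.1 * b.1) x.1) _ = _
  rw [rep_mul, lamD_mul P (a.2 x).ldiff (b.2 x).ldiff, rep_center, rep_center]
  rfl

/-- The parity involution `(-1)^k` on forms of degree `k`. -/
def formInvol (U : Opens X) : Forms H U →ₐ[ℂ] Forms H U where
  toFun η := ⟨fun x => invol (η.1 x), by
    intro x
    refine ((η.2 x).linear invol.toLinearMap).congr (Eventually.of_forall fun y => ?_)
    change invol (rep _ _ _) = _
    unfold rep
    split_ifs with h
    · rw [invol_pull]
    · rw [map_zero]⟩
  map_one' := by ext1; funext x; exact map_one _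
  map_mul' := by intro a b; ext1; funext x; exact map_mul _ _ _
  map_zero' := by ext1; funext x; exact map_zero _
  map_add' := by intro a b; ext1; funext x; exact map_add _ _ _
  commutes' := by intro c; ext1; funext x; exact AlgHom.commutes _ _

variable (H) in
/-- The submodule `A^{a,b}(U)` of forms of type `(a,b)`. -/
def formsType (U : Opens X) (a b : ℕ) : Submodule ℂ (Forms H U) where
  carrier := {η | ∀ x, η.1 x ∈ lamBi H a b}
  add_mem' := fun ha hb x => Submodule.add_mem _ (ha x) (hb x)
  zero_mem' := fun _ => Submodule.zero_mem _
  smul_mem' := fun c _ ha x => Submodule.smul_mem _ c (ha x)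

lemma mul_mem_formsType {U : Opens X} {a b a' b' : ℕ} {η ζ : Forms H U}
    (h : η ∈ formsType H U a b) (h' : ζ ∈ formsType H U a' b') :
    η * ζ ∈ formsType H U (a + a') (b + b') := fun x => mul_mem_lamBi (h x) (h' x)

lemma eventually_rep_mem {U : Opens X} {a b : ℕ} {η : Forms H U} (h : η ∈ formsType H U a b)
    (x₀ : X) : ∀ y, rep η.1 x₀ y ∈ lamBi H a b := by
  intro y
  unfold rep
  split_ifs with h'
  · exact pull_mem_lamBi _ (h _)
  · exact Submodule.zero_mem _

lemma del_mem {U : Opens X} {a b : ℕ} {η : Forms H U} (h : η ∈ formsType H U a b) :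
    del U η ∈ formsType H U (a + 1) b := by
  intro x
  have := lamD_mem proj10 (N := cov10 H) proj10_mem (η.2 x).ldiff
    (Eventually.of_forall (eventually_rep_mem h x.1))
  unfold lamBi at this ⊢
  rwa [← mul_assoc, ← pow_succ'] at this

lemma delbar_mem {U : Opens X} {a b : ℕ} {η : Forms H U} (h : η ∈ formsType H U a b) :
    delbar U η ∈ formsType H U a (b + 1) := by
  intro x
  have := lamD_mem proj01 (N := cov01 H) proj01_mem (η.2 x).ldiff
    (Eventually.of_forall (eventually_rep_mem h x.1))
  have hc : Commute ((cov10 H).map (ExteriorAlgebra.ι ℂ)) ((cov01 H).map (ExteriorAlgebra.ι ℂ)) :=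
    map_ι_mul_comm _ _
  unfold lamBi at this ⊢
  rwa [← mul_assoc, ((hc.pow_left a).eq).symm, mul_assoc, ← pow_succ'] at this

lemma rep_restrict {U V : Opens X} (h : V ≤ U) (η : U → Lam H) (x : V) :
    rep (fun z : V => η ⟨z.1, h z.2⟩) x.1 =ᶠ[𝓝 (chartAt H x.1 x.1)] rep η x.1 := by
  filter_upwards [eventually_pt x.2 (mem_chart_source H x.1)] with z hz
  unfold rep
  rw [dif_pos hz.2, dif_pos (h hz.2)]

/-- Restriction of forms. -/
def formRes {U V : Opens X} (h : V ≤ U) : Forms H U →ₐ[ℂ] Forms H V where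
  toFun η := ⟨fun z => η.1 ⟨z.1, h z.2⟩, fun x =>
    (η.2 ⟨x.1, h x.2⟩).congr (rep_restrict h η.1 x).symm⟩
  map_one' := rfl
  map_mul' _ _ := rfl
  map_zero' := rfl
  map_add' _ _ := rfl
  commutes' _ := rfl

lemma formRes_formD {P : Covec H →ₗ[ℂ] Covec H} (hP : P = proj10 ∨ P = proj01)
    {U V : Opens X} (h : V ≤ U) (η : Forms H U) :
    formRes h (formD P hP U η) = formD P hP V (formRes h η) := by
  ext1; funext x
  exact lamD_congr P (rep_restrict h η.1 x).symm

end Mfd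

section Holo
variable {H : Type} [NormedAddCommGroup H] [NormedSpace ℂ H] [FiniteDimensional ℂ H]
  {X : Type} [TopologicalSpace X] [ChartedSpace H X] [IsManifold 𝓘(ℂ, H) ω X]

variable (H) in
/-- Holomorphic functions on `U`. -/
abbrev Hol (U : Opens X) : Type := C^∞⟮𝓘(ℂ, H), U; 𝓘(ℂ), ℂ⟯

instance (U : Opens X) : CommRing (Hol H U) := inferInstance
instance (U : Opens X) : CommSemiring (Hol H U) := inferInstance
instance (U : Opens X) : Semiring (Hol H U) := inferInstance
instance (U : Opens X) : Ring (Forms H U) := inferInstance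
instance (U : Opens X) : Semiring (Forms H U) := inferInstance
instance (U : Opens X) : AddCommGroup (Forms H U) := inferInstance
instance (U : Opens X) : AddCommMonoid (Forms H U) := inferInstance
instance (U : Opens X) : Algebra ℂ (Forms H U) := inferInstance
instance (U : Opens X) : Module ℂ (Forms H U) := inferInstance

lemma Hol.contDiffAt {U : Opens X} (f : Hol H U) (x : U) :
    ContDiffAt ℂ ∞ (fun y => open Classical in
      if h : pt H x.1 y ∈ U then f ⟨pt H x.1 y, h⟩ else 0) (chartAt H x.1 x.1) := by
  classical
  let F : X → ℂ := fun z => if h : z ∈ U then f ⟨z, h⟩ else 0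
  have h1 : ContMDiffAt 𝓘(ℂ, H) 𝓘(ℂ) ∞ (fun z : U => F z) x := by
    have : (fun z : U => F z) = f := by
      funext z
      exact dif_pos z.2
    rw [this]
    exact f.contMDiff x
  have h2 : ContMDiffAt 𝓘(ℂ, H) 𝓘(ℂ) ∞ F x.1 := contMDiffAt_subtype_iff.mp h1
  have h3 := (contMDiffAt_iff.mp h2).2
  simp only [mfld_simps, contDiffWithinAt_univ] at h3
  convert! h3

/-- A holomorphic function as a form of type `(0,0)`. -/
def holForm (U : Opens X) : Hol H U →+* Forms H U where
  toFun f := ⟨fun x => algebraMap ℂ (Lam H) (f x), fun x =>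
    (LSmooth.smul_const ((f.contDiffAt x).restrict_scalars ℝ) 1).congr (rep_scalar f x).symm⟩
  map_one' := by ext1; funext x; exact map_one _
  map_mul' := by intro a b; ext1; funext x; exact map_mul _ _ _
  map_zero' := by ext1; funext x; exact map_zero _
  map_add' := by intro a b; ext1; funext x; exact map_add _ _ _

instance (U : Opens X) : Algebra (Hol H U) (Forms H U) where
  smul f η := holForm U f * η
  algebraMap := holForm U
  commutes' := by intro f η; ext1; funext x; exact Algebra.commutes (f x) (η.1 x)
  smul_def' := fun _ _ => rfl

lemma hol_smul_apply {U : Opens X} (f : Hol H U) (η : Forms H U) (x : U) :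
    (f • η).1 x = f x • η.1 x := (Algebra.smul_def (f x) (η.1 x)).symm

instance (U : Opens X) : Module (Hol H U) (Forms H U) := inferInstance

instance (U : Opens X) : IsScalarTower ℂ (Hol H U) (Forms H U) where
  smul_assoc := by
    intro c f η
    ext1; funext x
    rw [hol_smul_apply]
    change (c • f x) • η.1 x = c • (f • η).1 x
    rw [hol_smul_apply, smul_assoc]

instance (U : Opens X) : SMulCommClass (Hol H U) ℂ (Forms H U) := inferInstance
instance (U : Opens X) : SMulCommClass (Hol H U) (Forms H U) (Forms H U) := inferInstance

lemma delbar_holForm {U : Opens X} (f : Hol H U) : delbar U (holForm U f) = 0 := by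
  ext1; funext x
  change lamD proj01 (rep (fun z => algebraMap ℂ (Lam H) (f z)) x.1) _ = 0
  have hf := (f.contDiffAt x).differentiableAt (by simp)
  rw [lamD_congr proj01 (rep_scalar f x), lamD_smul_const _ (hf.restrictScalars ℝ),
    proj01_of_mem10, map_zero, zero_mul]
  intro v
  unfold dfun
  rw [hf.fderiv_restrictScalars ℝ]
  exact map_smul (fderiv ℂ _ _) Complex.I v

/-- `∂̄` is linear over holomorphic functions. -/
lemma delbar_hol_smul {U : Opens X} (f : Hol H U) (η : Forms H U) :
    delbar U (f • η) = f • delbar U η := by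
  ext1; funext x
  rw [hol_smul_apply]
  change (delbar U (holForm U f * η)).1 x = _
  have := formD_mul (Or.inr rfl) (holForm U f) η x
  change (delbar U (holForm U f * η)).1 x = (delbar U (holForm U f)).1 x * _ + _ at this
  rw [this, delbar_holForm]
  change 0 * _ + invol (algebraMap ℂ _ (f x)) * _ = _
  rw [AlgHom.commutes, zero_mul, zero_add, ← Algebra.smul_def]
  rfl

/-- `∂̄` as a linear map over the ring of holomorphic functions. -/
def delbarHol (U : Opens X) : Forms H U →ₗ[Hol H U] Forms H U :=
  { delbar U with map_smul' := delbar_hol_smul }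

/-- The parity involution as a linear map over the ring of holomorphic functions. -/
def involHol (U : Opens X) : Forms H U →ₗ[Hol H U] Forms H U :=
  { formInvol U with
    map_smul' := by
      intro f η
      ext1; funext x
      change invol ((f • η).1 x) = (f • formInvol U η).1 x
      rw [hol_smul_apply, hol_smul_apply, map_smul]
      rfl }

/-- Left multiplication by a form as a linear map over the ring of holomorphic functions. -/
def mulHol {U : Opens X} (φ : Forms H U) : Forms H U →ₗ[Hol H U] Forms H U :=
  LinearMap.mulLeft (Hol H U) φ

variable (H X) in
/-- The sheaf of holomorphic functions of the complex manifold `X`. -/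
abbrev holSheaf : Sheaf (Opens.grothendieckTopology (TopCat.of X)) RingCat :=
  smoothSheafRing 𝓘(ℂ, H) 𝓘(ℂ) X ℂ

variable (H X) in
/-- Sheaves of modules over the sheaf of holomorphic functions. -/
abbrev HolMod : Type 1 := SheafOfModules.{0} (holSheaf H X)

/-- Sections over `U` of a sheaf of modules. -/
abbrev HolMod.Sec (M : HolMod H X) (U : Opens X) : Type := M.val.obj (op U)

instance (M : HolMod H X) (U : Opens X) : AddCommGroup (M.Sec U) := inferInstance
instance (M : HolMod H X) (U : Opens X) : AddCommMonoid (M.Sec U) := inferInstance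

instance (M : HolMod H X) (U : Opens X) : Module (Hol H U) (M.Sec U) :=
  (M.val.obj (op U)).isModule

/-- Restriction of holomorphic functions. -/
def holRes {U V : Opens X} (h : V ≤ U) : Hol H U →+* Hol H V :=
  ContMDiffMap.restrictRingHom 𝓘(ℂ, H) 𝓘(ℂ) ℂ h

/-- Restriction of sections of a sheaf of modules. -/
def HolMod.res (M : HolMod H X) {U V : Opens X} (h : V ≤ U) : M.Sec U →+ M.Sec V :=
  (M.val.map (homOfLE h).op).hom.toAddMonoidHom

lemma HolMod.res_smul (M : HolMod H X) {U V : Opens X} (h : V ≤ U) (f : Hol H U) (e : M.Sec U) :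
    M.res h (f • e) = holRes h f • M.res h e :=
  PresheafOfModules.map_smul M.val (homOfLE h).op f e

lemma HolMod.res_self (M : HolMod H X) {U : Opens X} (h : U ≤ U) (e : M.Sec U) :
    M.res h e = e := by
  change M.val.map (𝟙 (op U)) e = e
  rw [M.val.map_id]
  rfl

lemma HolMod.res_res (M : HolMod H X) {U V W : Opens X} (h : V ≤ U) (h' : W ≤ V) (e : M.Sec U) :
    M.res h' (M.res h e) = M.res (h'.trans h) e :=
  (PresheafOfModules.map_comp_apply M.val (homOfLE h).op (homOfLE h').op e).symm

/-- A morphism of sheaves of modules on sections. -/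
def HolMod.app {M N : HolMod H X} (α : M ⟶ N) (U : Opens X) : M.Sec U →ₗ[Hol H U] N.Sec U :=
  (α.val.app (op U)).hom

lemma HolMod.app_res {M N : HolMod H X} (α : M ⟶ N) {U V : Opens X} (h : V ≤ U) (e : M.Sec U) :
    app α V (M.res h e) = N.res h (app α U e) :=
  PresheafOfModules.naturality_apply α.val (homOfLE h).op e

end Holo

section Shf
variable {H : Type} [NormedAddCommGroup H] [NormedSpace ℂ H] [FiniteDimensional ℂ H]
  {X : Type} [TopologicalSpace X] [ChartedSpace H X] [IsManifold 𝓘(ℂ, H) ω X]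

/-- The tensor product `A^{*,*}(U) ⊗ M(U)` over the holomorphic functions on `U`. -/
abbrev TP (M : HolMod H X) (U : Opens X) : Type := Forms H U ⊗[Hol H U] M.Sec U

instance (M : HolMod H X) (U : Opens X) : AddCommGroup (TP M U) := inferInstance
instance (M : HolMod H X) (U : Opens X) : AddCommMonoid (TP M U) := inferInstance
instance (M : HolMod H X) (U : Opens X) : Module ℂ (TP M U) := inferInstance
instance (M : HolMod H X) (U : Opens X) : Module (Hol H U) (TP M U) := inferInstance

/-- The operator `α ⊗ β` as a complex linear map. -/
def tMap {M N : HolMod H X} {U : Opens X} (α : Forms H U →ₗ[Hol H U] Forms H U)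
    (β : M.Sec U →ₗ[Hol H U] N.Sec U) : TP M U →ₗ[ℂ] TP N U :=
  (TensorProduct.map α β).restrictScalars ℂ

@[simp] lemma tMap_tmul {M N : HolMod H X} {U : Opens X} (α : Forms H U →ₗ[Hol H U] Forms H U)
    (β : M.Sec U →ₗ[Hol H U] N.Sec U) (φ : Forms H U) (e : M.Sec U) :
    tMap α β (φ ⊗ₜ e) = α φ ⊗ₜ β e := rfl

lemma formRes_smul {U V : Opens X} (h : V ≤ U) (f : Hol H U) (φ : Forms H U) :
    formRes h (f • φ) = holRes h f • formRes h φ := rfl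

/-- The map `e ↦ φ|V ⊗ e|V`. -/
def tResAux (M : HolMod H X) {U V : Opens X} (h : V ≤ U) (φ : Forms H U) : M.Sec U →+ TP M V :=
  AddMonoidHom.mk' (fun e => formRes h φ ⊗ₜ[Hol H V] M.res h e) fun a b =>
    (congrArg (fun z => formRes h φ ⊗ₜ[Hol H V] z) (map_add (M.res h) a b)).trans
      (TensorProduct.tmul_add _ _ _)

/-- Restriction for tensor products. -/
def tRes (M : HolMod H X) {U V : Opens X} (h : V ≤ U) : TP M U →ₗ[ℂ] TP M V :=
  let F : TP M U →+ TP M V := TensorProduct.liftAddHom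
    { toFun := tResAux M h
      map_zero' := AddMonoidHom.ext fun e =>
        (congrArg (fun z => z ⊗ₜ[Hol H V] M.res h e) (map_zero (formRes h))).trans
          (TensorProduct.zero_tmul _ _)
      map_add' := fun a b => AddMonoidHom.ext fun e =>
        (congrArg (fun z => z ⊗ₜ[Hol H V] M.res h e) (map_add (formRes h) a b)).trans
          (TensorProduct.add_tmul (formRes h a) (formRes h b) (M.res h e)) }
    (by
      intro f φ e
      change formRes h (f • φ) ⊗ₜ[Hol H V] M.res h e = formRes h φ ⊗ₜ[Hol H V] M.res h (f • e)
      rw [M.res_smul, formRes_smul, TensorProduct.smul_tmul])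
  { F with
    map_smul' := by
      intro c t
      change F (c • t) = c • F t
      induction t using TensorProduct.induction_on with
      | zero => simp
      | tmul φ e => rfl
      | add a b ha hb => rw [smul_add, map_add, map_add, ha, hb, smul_add] }

@[simp] lemma tRes_tmul (M : HolMod H X) {U V : Opens X} (h : V ≤ U) (φ : Forms H U)
    (e : M.Sec U) : tRes M h (φ ⊗ₜ e) = formRes h φ ⊗ₜ M.res h e := rfl

lemma tRes_self (M : HolMod H X) {U : Opens X} (h : U ≤ U) (t : TP M U) : tRes M h t = t := by
  induction t using TensorProduct.induction_on with
  | zero => exact map_zero _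
  | tmul φ e => rw [tRes_tmul, M.res_self]; rfl
  | add a b ha hb => rw [map_add, ha, hb]

lemma tRes_tRes (M : HolMod H X) {U V W : Opens X} (h : V ≤ U) (h' : W ≤ V) (t : TP M U) :
    tRes M h' (tRes M h t) = tRes M (h'.trans h) t := by
  induction t using TensorProduct.induction_on with
  | zero => simp only [map_zero]
  | tmul φ e => rw [tRes_tmul, tRes_tmul, tRes_tmul, M.res_res]; rfl
  | add a b ha hb => simp only [map_add, ha, hb]

lemma tRes_tMap {M N : HolMod H X} {U V : Opens X} (h : V ≤ U)
    {α : Forms H U →ₗ[Hol H U] Forms H U} {α' : Forms H V →ₗ[Hol H V] Forms H V}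
    {β : M.Sec U →ₗ[Hol H U] N.Sec U} {β' : M.Sec V →ₗ[Hol H V] N.Sec V}
    (hα : ∀ φ, formRes h (α φ) = α' (formRes h φ)) (hβ : ∀ e, N.res h (β e) = β' (M.res h e))
    (t : TP M U) : tRes N h (tMap α β t) = tMap α' β' (tRes M h t) := by
  induction t using TensorProduct.induction_on with
  | zero => simp only [map_zero]
  | tmul φ e => rw [tMap_tmul, tRes_tmul, tRes_tmul, tMap_tmul, hα, hβ]
  | add a b ha hb => simp only [map_add, ha, hb]

/-- The presheaf `U ↦ A^{*,*}(U) ⊗ M(U)` of complex vector spaces. -/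
def tPre (M : HolMod H X) : TopCat.Presheaf (ModuleCat.{0} ℂ) (TopCat.of X) where
  obj U := ModuleCat.of ℂ (TP M (unop U))
  map f := ModuleCat.ofHom (tRes M (leOfHom f.unop))
  map_id U := by
    ext t
    exact tRes_self M _ t
  map_comp f g := by
    ext t
    exact (tRes_tRes M _ _ t).symm

/-- The stalk of the presheaf `A^{*,*} ⊗ M`. -/
abbrev TStalk (M : HolMod H X) (x : X) : Type := (tPre M).stalk (x : TopCat.of X)

instance (M : HolMod H X) (x : X) : AddCommGroup (TStalk M x) := inferInstance
instance (M : HolMod H X) (x : X) : AddCommMonoid (TStalk M x) := inferInstance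
instance (M : HolMod H X) (x : X) : Module ℂ (TStalk M x) := inferInstance

/-- The germ of a section of the presheaf `A^{*,*} ⊗ M`. -/
def tGerm (M : HolMod H X) {V : Opens X} {x : X} (hx : x ∈ V) : TP M V →ₗ[ℂ] TStalk M x :=
  ((tPre M).germ V (x : TopCat.of X) hx).hom

lemma tGerm_res (M : HolMod H X) {U V : Opens X} (h : V ≤ U) {x : X} (hx : x ∈ V) (t : TP M U) :
    tGerm M hx (tRes M h t) = tGerm M (h hx) t :=
  TopCat.Presheaf.germ_res_apply (tPre M) (homOfLE h) x hx t

/-- A compatible family of operators `A^{*,*}(V) ⊗ M(V) → A^{*,*}(V) ⊗ N(V)`, for `V ⊆ U`. -/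
structure LocalOp (M N : HolMod H X) (U : Opens X) where
  /-- The operators. -/
  op : ∀ V : Opens X, V ≤ U → TP M V →ₗ[ℂ] TP N V
  comm : ∀ (V W : Opens X) (hV : V ≤ U) (hW : W ≤ V) (t : TP M V),
    tRes N hW (op V hV t) = op W (hW.trans hV) (tRes M hW t)

/-- The operators followed by germs at `x`, on the neighbourhood `V` of `x`. -/
def LocalOp.toGerm {M N : HolMod H X} {U : Opens X} (F : LocalOp M N U) {x : X} (hx : x ∈ U)
    {V : Opens X} (hV : x ∈ V) : TP M V →ₗ[ℂ] TStalk N x :=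
  tGerm N (V := V ⊓ U) ⟨hV, hx⟩ ∘ₗ F.op (V ⊓ U) inf_le_right ∘ₗ tRes M inf_le_left

lemma LocalOp.toGerm_res {M N : HolMod H X} {U : Opens X} (F : LocalOp M N U) {x : X}
    (hx : x ∈ U) {V W : Opens X} (h : W ≤ V) (hW : x ∈ W) (t : TP M V) :
    F.toGerm hx hW (tRes M h t) = F.toGerm hx (h hW) t := by
  have hl : W ⊓ U ≤ V ⊓ U := inf_le_inf_right U h
  change tGerm N _ (F.op _ _ (tRes M _ (tRes M h t))) = tGerm N _ (F.op _ _ _)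
  rw [tRes_tRes, ← tGerm_res N hl ⟨hW, hx⟩, F.comm, tRes_tRes]

/-- The map on stalks induced by compatible operators. -/
def LocalOp.stalkHom {M N : HolMod H X} {U : Opens X} (F : LocalOp M N U) {x : X} (hx : x ∈ U) :
    (tPre M).stalk (x : TopCat.of X) ⟶ (tPre N).stalk (x : TopCat.of X) :=
  by
  refine Limits.colimit.desc _ ⟨_, ⟨fun V => ModuleCat.ofHom (F.toGerm hx (unop V).2), ?_⟩⟩
  intro V W f
  ext t
  exact F.toGerm_res hx (leOfHom f.unop) (unop W).2 t

/-- The linear map on stalks induced by compatible operators. -/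
def LocalOp.stalk {M N : HolMod H X} {U : Opens X} (F : LocalOp M N U) {x : X} (hx : x ∈ U) :
    TStalk M x →ₗ[ℂ] TStalk N x :=
  (F.stalkHom hx).hom

lemma LocalOp.stalk_germ {M N : HolMod H X} {U : Opens X} (F : LocalOp M N U) {V : Opens X}
    (hV : V ≤ U) {x : X} (hx : x ∈ V) (t : TP M V) :
    F.stalk (hV hx) (tGerm M hx t) = tGerm N hx (F.op V hV t) := by
  have h0 : (tPre M).germ V (x : TopCat.of X) hx ≫ F.stalkHom (hV hx) =
      ModuleCat.ofHom (F.toGerm (hV hx) (V := V) hx) := by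
    unfold TopCat.Presheaf.germ LocalOp.stalkHom
    exact Limits.colimit.ι_desc _ _
  have h1 : F.stalk (hV hx) (tGerm M hx t) =
      tGerm N (V := V ⊓ U) ⟨hx, hV hx⟩ (F.op (V ⊓ U) inf_le_right (tRes M inf_le_left t)) :=
    congrArg (fun g => ModuleCat.Hom.hom g t) h0
  rw [h1, ← F.comm V (V ⊓ U) hV inf_le_left]
  exact tGerm_res N inf_le_left _ _

/-- Families of germs over `U` which are locally given by sections in the submodules `S V`. -/
def locSub (M : HolMod H X) (S : ∀ V : Opens X, Submodule ℂ (TP M V))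
    (hS : ∀ (V W : Opens X) (h : W ≤ V), ∀ t ∈ S V, tRes M h t ∈ S W) (U : Opens X) :
    Submodule ℂ (∀ x : U, TStalk M x.1) where
  carrier := {s | ∀ x : U, ∃ (V : Opens X) (hV : V ≤ U), x.1 ∈ V ∧ ∃ t ∈ S V,
    ∀ (y : X) (hy : y ∈ V), s ⟨y, hV hy⟩ = tGerm M hy t}
  add_mem' := by
    intro a b ha hb x
    obtain ⟨V, hV, hx, t, ht, h⟩ := ha x
    obtain ⟨V', hV', hx', t', ht', h'⟩ := hb x
    refine ⟨V ⊓ V', inf_le_left.trans hV, ⟨hx, hx'⟩, tRes M inf_le_left t + tRes M inf_le_right t',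
      Submodule.add_mem _ (hS _ _ _ _ ht) (hS _ _ _ _ ht'), fun y hy => ?_⟩
    rw [map_add, tGerm_res, tGerm_res, ← h, ← h']
    rfl
  zero_mem' := fun x => ⟨U, le_rfl, x.2, 0, Submodule.zero_mem _, fun y hy => (map_zero _).symm⟩
  smul_mem' := by
    intro c a ha x
    obtain ⟨V, hV, hx, t, ht, h⟩ := ha x
    refine ⟨V, hV, hx, c • t, Submodule.smul_mem _ _ ht, fun y hy => ?_⟩
    rw [map_smul, ← h]
    rfl

/-- Sections over `U` of the sheaf `A^{*,*}_X(M)` associated with `V ↦ A^{*,*}(V) ⊗ M(V)`. -/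
def ASec (M : HolMod H X) (U : Opens X) : Submodule ℂ (∀ x : U, TStalk M x.1) :=
  locSub M (fun _ => ⊤) (fun _ _ _ _ _ => trivial) U

instance (M : HolMod H X) (U : Opens X) : AddCommGroup (ASec M U) := inferInstance
instance (M : HolMod H X) (U : Opens X) : AddCommMonoid (ASec M U) := inferInstance
instance (M : HolMod H X) (U : Opens X) : Module ℂ (ASec M U) := inferInstance

/-- The span in `A^{*,*}(V) ⊗ M(V)` of the tensors `φ ⊗ e` with `φ` of type `(a,b)`. -/
def tType (M : HolMod H X) (a b : ℕ) (V : Opens X) : Submodule ℂ (TP M V) :=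
  Submodule.span ℂ {t | ∃ φ ∈ formsType H V a b, ∃ e : M.Sec V, t = φ ⊗ₜ e}

lemma tRes_mem_tType (M : HolMod H X) (a b : ℕ) (V W : Opens X) (h : W ≤ V) :
    ∀ t ∈ tType M a b V, tRes M h t ∈ tType M a b W := by
  intro t ht
  induction ht using Submodule.span_induction with
  | mem t ht =>
    obtain ⟨φ, hφ, e, rfl⟩ := ht
    exact Submodule.subset_span ⟨formRes h φ, fun x => hφ _, M.res h e, rfl⟩
  | zero => rw [map_zero]; exact Submodule.zero_mem _
  | add a b _ _ ha hb => rw [map_add]; exact Submodule.add_mem _ ha hb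
  | smul c a _ ha => rw [map_smul]; exact Submodule.smul_mem _ _ ha

/-- Sections over `U` of the subsheaf `A^{a,b}_X(M)`. -/
def AType (M : HolMod H X) (U : Opens X) (a b : ℕ) : Submodule ℂ (ASec M U) :=
  (locSub M (tType M a b) (tRes_mem_tType M a b) U).comap (ASec M U).subtype

/-- The operator on sections of `A^{*,*}_X(M)` induced by compatible operators. -/
def LocalOp.sec {M N : HolMod H X} {U : Opens X} (F : LocalOp M N U) :
    ASec M U →ₗ[ℂ] ASec N U where
  toFun s := ⟨fun x => F.stalk x.2 (s.1 x), fun x => by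
    obtain ⟨V, hV, hx, t, -, h⟩ := s.2 x
    refine ⟨V, hV, hx, F.op V hV t, trivial, fun y hy => ?_⟩
    exact (congrArg (F.stalk (hV hy)) (h y hy)).trans (F.stalk_germ hV hy t)⟩
  map_add' := by intro a b; ext1; funext x; exact map_add _ _ _
  map_smul' := by intro c a; ext1; funext x; exact map_smul _ _ _

/-- Restriction of sections of `A^{*,*}_X(M)`. -/
def aRes (M : HolMod H X) {U V : Opens X} (h : V ≤ U) : ASec M U →ₗ[ℂ] ASec M V where
  toFun s := ⟨fun x => s.1 ⟨x.1, h x.2⟩, fun x => by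
    obtain ⟨W, hW, hx, t, -, hs⟩ := s.2 ⟨x.1, h x.2⟩
    refine ⟨W ⊓ V, inf_le_right, ⟨hx, x.2⟩, tRes M inf_le_left t, trivial, fun y hy => ?_⟩
    rw [tGerm_res, ← hs]⟩
  map_add' _ _ := rfl
  map_smul' _ _ := rfl

/-- Left multiplication by a form. -/
def mulOp (M : HolMod H X) {U : Opens X} (φ : Forms H U) : LocalOp M M U where
  op V hV := tMap (mulHol (formRes hV φ)) LinearMap.id
  comm _ _ _ hW t := tRes_tMap hW (fun _ => map_mul (formRes hW) _ _) (fun _ => rfl) t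

/-- The operator `φ ⊗ e ↦ ∂̄φ ⊗ e`. -/
def delbarOp (M : HolMod H X) (U : Opens X) : LocalOp M M U where
  op _ _ := tMap (delbarHol _) LinearMap.id
  comm _ _ _ hW t := tRes_tMap hW (fun ψ => formRes_formD (Or.inr rfl) hW ψ) (fun _ => rfl) t

/-- The operator `φ ⊗ e ↦ (-1)^{deg φ} φ ⊗ α(e)` induced by a morphism `α`. -/
def morOp {M N : HolMod H X} (α : M ⟶ N) (U : Opens X) : LocalOp M N U where
  op V _ := tMap (involHol V) (HolMod.app α V)
  comm _ _ _ hW t := tRes_tMap hW (fun _ => rfl) (fun e => (HolMod.app_res α hW e).symm) t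

end Shf

section Tot
variable {H : Type} [NormedAddCommGroup H] [NormedSpace ℂ H] [FiniteDimensional ℂ H]
  {X : Type} [TopologicalSpace X] [ChartedSpace H X] [IsManifold 𝓘(ℂ, H) ω X]

/-- The sign `(-1)^k`. -/
def sgn (k : ℤ) : ℂ := (-1) ^ k

lemma sgn_add (k l : ℤ) : sgn (k + l) = sgn k * sgn l := zpow_add₀ (by norm_num) k l

lemma sgn_mul_self (k : ℤ) : sgn k * sgn k = 1 := by
  rw [← sgn_add, ← two_mul]
  exact Even.neg_one_zpow (even_two_mul k)

lemma sgn_one : sgn 1 = -1 := by simp [sgn]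

lemma exists_germ {M : HolMod H X} {U : Opens X} (s : ASec M U) (x : U) :
    ∃ (V : Opens X) (_ : V ≤ U) (hx : x.1 ∈ V) (t : TP M V), s.1 x = tGerm M hx t := by
  obtain ⟨V, hV, hx, t, -, h⟩ := s.2 x
  exact ⟨V, hV, hx, t, h x.1 hx⟩

lemma LocalOp.sec_apply {M N : HolMod H X} {U : Opens X} (F : LocalOp M N U) (s : ASec M U)
    (x : U) : (F.sec s).1 x = F.stalk x.2 (s.1 x) := rfl

/-- The section of `A^{*,*}_X(M)` defined by an element of `A^{*,*}(U) ⊗ M(U)`. -/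
def aOf (M : HolMod H X) (U : Opens X) : TP M U →ₗ[ℂ] ASec M U where
  toFun t := ⟨fun x => tGerm M x.2 t, fun x => ⟨U, le_rfl, x.2, t, trivial, fun _ _ => rfl⟩⟩
  map_add' := by intro a b; ext1; funext x; exact map_add _ _ _
  map_smul' := by intro c a; ext1; funext x; exact map_smul _ _ _

lemma LocalOp.sec_aOf {M N : HolMod H X} {U : Opens X} (F : LocalOp M N U) (t : TP M U) :
    F.sec (aOf M U t) = aOf N U (F.op U le_rfl t) := by
  ext1; funext x
  exact F.stalk_germ le_rfl x.2 t

lemma LocalOp.aRes_sec {M N : HolMod H X} {U V : Opens X} (F : LocalOp M N U)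
    (F' : LocalOp M N V) (h : V ≤ U)
    (hF : ∀ (W : Opens X) (hW : W ≤ V) (t : TP M W), F.op W (hW.trans h) t = F'.op W hW t)
    (s : ASec M U) : aRes N h (F.sec s) = F'.sec (aRes M h s) := by
  ext1; funext x
  obtain ⟨W, hW, hx, t, ht⟩ := exists_germ (aRes M h s) x
  have ht' : s.1 ⟨x.1, h x.2⟩ = tGerm M hx t := ht
  calc F.stalk (h x.2) (s.1 ⟨x.1, h x.2⟩) = tGerm N hx (F.op W (hW.trans h) t) := by
        rw [ht']; exact F.stalk_germ (hW.trans h) hx t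
    _ = tGerm N hx (F'.op W hW t) := by rw [hF]
    _ = F'.stalk x.2 ((aRes M h s).1 x) := by
        rw [ht]; exact (F'.stalk_germ hW hx t).symm

lemma aRes_mem {M : HolMod H X} {U V : Opens X} (h : V ≤ U) {a b : ℕ} {s : ASec M U}
    (hs : s ∈ AType M U a b) : aRes M h s ∈ AType M V a b := by
  intro x
  obtain ⟨W, hW, hx, t, ht, hst⟩ := hs ⟨x.1, h x.2⟩
  refine ⟨W ⊓ V, inf_le_right, ⟨hx, x.2⟩, tRes M inf_le_left t,
    tRes_mem_tType M a b _ _ _ _ ht, fun y hy => ?_⟩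
  exact (hst y hy.1).trans (tGerm_res M inf_le_left hy t).symm

lemma mem_AType_of_local {M : HolMod H X} {U : Opens X} {a b : ℕ} {s : ASec M U}
    (hs : ∀ x : U, ∃ (V : Opens X) (h : V ≤ U), x.1 ∈ V ∧ aRes M h s ∈ AType M V a b) :
    s ∈ AType M U a b := by
  intro x
  obtain ⟨V, h, hx, hV⟩ := hs x
  obtain ⟨W, hW, hx', t, ht, hst⟩ := hV ⟨x.1, hx⟩
  exact ⟨W, hW.trans h, hx', t, ht, hst⟩

lemma LocalOp.sec_mem {M N : HolMod H X} {U : Opens X} (F : LocalOp M N U) {a b a' b' : ℕ}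
    (hF : ∀ (V : Opens X) (hV : V ≤ U), ∀ t ∈ tType M a b V, F.op V hV t ∈ tType N a' b' V)
    {s : ASec M U} (hs : s ∈ AType M U a b) : F.sec s ∈ AType N U a' b' := by
  intro x
  obtain ⟨V, hV, hx, t, ht, hst⟩ := hs x
  refine ⟨V, hV, hx, F.op V hV t, hF V hV t ht, fun y hy => ?_⟩
  exact (congrArg (F.stalk (hV hy)) (hst y hy)).trans (F.stalk_germ hV hy t)

lemma tMap_mem {M N : HolMod H X} {U : Opens X} {α : Forms H U →ₗ[Hol H U] Forms H U}
    {β : M.Sec U →ₗ[Hol H U] N.Sec U} {a b a' b' : ℕ}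
    (hα : ∀ φ ∈ formsType H U a b, α φ ∈ formsType H U a' b') {t : TP M U}
    (ht : t ∈ tType M a b U) : tMap α β t ∈ tType N a' b' U := by
  induction ht using Submodule.span_induction with
  | mem t ht =>
    obtain ⟨φ, hφ, e, rfl⟩ := ht
    exact Submodule.subset_span ⟨α φ, hα φ hφ, β e, rfl⟩
  | zero => rw [map_zero]; exact Submodule.zero_mem _
  | add a b _ _ ha hb => rw [map_add]; exact Submodule.add_mem _ ha hb
  | smul c a _ ha => rw [map_smul]; exact Submodule.smul_mem _ _ ha

lemma formInvol_of_mem {U : Opens X} {a b : ℕ} {φ : Forms H U} (h : φ ∈ formsType H U a b) :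
    formInvol U φ = sgn (a + b) • φ := by
  ext1; funext x
  change invol (φ.1 x) = sgn (a + b) • φ.1 x
  rw [invol_of_mem (h x), sgn]
  norm_cast

variable (E : CochainComplex (HolMod H X) ℤ)

/-- Sections over `U` of the graded sheaf `A^{*,*}_X(E^*)`. -/
abbrev ESec (U : Opens X) : Type := ∀ r : ℤ, ASec (E.X r) U

instance (U : Opens X) : AddCommGroup (ESec E U) := inferInstance
instance (U : Opens X) : AddCommMonoid (ESec E U) := inferInstance
instance (U : Opens X) : Module ℂ (ESec E U) := inferInstance

/-- Restriction of sections of `A^{*,*}_X(E^*)`. -/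
def eRes {U V : Opens X} (h : V ≤ U) : ESec E U →ₗ[ℂ] ESec E V :=
  LinearMap.pi fun r => aRes (E.X r) h ∘ₗ LinearMap.proj r

/-- Left multiplication by a form on `A^{*,*}_X(E^*)`. -/
def eMul {U : Opens X} (φ : Forms H U) : ESec E U →ₗ[ℂ] ESec E U :=
  LinearMap.pi fun r => (mulOp (E.X r) φ).sec ∘ₗ LinearMap.proj r

/-- The section `φ ⊗ e` of `A^{*,*}_X(E^*)`, for a section `e` of `E^r`. -/
def eTmul {U : Opens X} {r : ℤ} (φ : Forms H U) (e : (E.X r).Sec U) : ESec E U :=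
  Pi.single r (aOf (E.X r) U (φ ⊗ₜ e))

/-- Sections of `A^{a,b}_X(E^r)`, as a subspace of the sections of `A^{*,*}_X(E^*)`. -/
def eBi (U : Opens X) (a b : ℕ) (r : ℤ) : Submodule ℂ (ESec E U) where
  carrier := {s | s r ∈ AType (E.X r) U a b ∧ ∀ r', r' ≠ r → s r' = 0}
  add_mem' := by
    rintro s t ⟨h1, h2⟩ ⟨h3, h4⟩
    exact ⟨Submodule.add_mem _ h1 h3, fun r' hr => by rw [Pi.add_apply, h2 r' hr, h4 r' hr,
      add_zero]⟩
  zero_mem' := ⟨Submodule.zero_mem _, fun _ _ => rfl⟩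
  smul_mem' := by
    rintro c s ⟨h1, h2⟩
    exact ⟨Submodule.smul_mem _ c h1, fun r' hr => by rw [Pi.smul_apply, h2 r' hr, smul_zero]⟩

/-- Sections of total degree `k`, where `A^{a,b}_X(E^r)` has degree `a + b + r`. -/
def eDeg (U : Opens X) (k : ℤ) : Submodule ℂ (ESec E U) :=
  ⨆ (a : ℕ) (b : ℕ), eBi E U a b (k - a - b)

/-- Complex linear endomorphisms of the sheaf `A^{*,*}_X(E^*)`. -/
@[ext] structure EndE where
  /-- The action on sections over `U`. -/
  app : ∀ U : Opens X, ESec E U →ₗ[ℂ] ESec E U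
  app_res' : ∀ (U V : Opens X) (h : V ≤ U) (s : ESec E U),
    eRes E h (app U s) = app V (eRes E h s)

variable {E}

lemma EndE.app_res (f : EndE E) {U V : Opens X} (h : V ≤ U) (s : ESec E U) :
    eRes E h (f.app U s) = f.app V (eRes E h s) := f.app_res' U V h s

lemma EndE.hext {f g : EndE E} (h : ∀ (U : Opens X) (s : ESec E U), f.app U s = g.app U s) :
    f = g := EndE.ext (funext fun U => LinearMap.ext (h U))

instance : Zero (EndE E) := ⟨⟨fun _ => 0, fun _ _ h _ => map_zero (eRes E h)⟩⟩
instance : One (EndE E) := ⟨⟨fun _ => LinearMap.id, fun _ _ _ _ => rfl⟩⟩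
instance : Add (EndE E) := ⟨fun f g => ⟨fun U => f.app U + g.app U, fun U V h s => by
  rw [LinearMap.add_apply, LinearMap.add_apply, map_add, f.app_res, g.app_res]⟩⟩
instance : Neg (EndE E) := ⟨fun f => ⟨fun U => -f.app U, fun U V h s => by
  rw [LinearMap.neg_apply, LinearMap.neg_apply, map_neg, f.app_res]⟩⟩
instance : Sub (EndE E) := ⟨fun f g => ⟨fun U => f.app U - g.app U, fun U V h s => by
  rw [LinearMap.sub_apply, LinearMap.sub_apply, map_sub, f.app_res, g.app_res]⟩⟩
instance : SMul ℂ (EndE E) := ⟨fun c f => ⟨fun U => c • f.app U, fun U V h s => by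
  rw [LinearMap.smul_apply, LinearMap.smul_apply, map_smul, f.app_res]⟩⟩
instance : Mul (EndE E) := ⟨fun f g => ⟨fun U => f.app U ∘ₗ g.app U, fun U V h s => by
  rw [LinearMap.comp_apply, LinearMap.comp_apply, f.app_res, g.app_res]⟩⟩

lemma EndE.zero_app {U : Opens X} (s : ESec E U) : (0 : EndE E).app U s = 0 := rfl

lemma EndE.one_app {U : Opens X} (s : ESec E U) : (1 : EndE E).app U s = s := rfl

lemma EndE.add_app (f g : EndE E) {U : Opens X} (s : ESec E U) :
    (f + g).app U s = f.app U s + g.app U s := rfl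

lemma EndE.neg_app (f : EndE E) {U : Opens X} (s : ESec E U) :
    (-f).app U s = -f.app U s := rfl

lemma EndE.smul_app (c : ℂ) (f : EndE E) {U : Opens X} (s : ESec E U) :
    (c • f).app U s = c • f.app U s := rfl

lemma EndE.mul_app (f g : EndE E) {U : Opens X} (s : ESec E U) :
    (f * g).app U s = f.app U (g.app U s) := rfl

lemma EndE.sub_app (f g : EndE E) {U : Opens X} (s : ESec E U) :
    (f - g).app U s = f.app U s - g.app U s := rfl

instance : Ring (EndE E) where
  add_assoc f g h := EndE.hext fun _ _ => add_assoc _ _ _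
  zero_add f := EndE.hext fun _ _ => zero_add _
  add_zero f := EndE.hext fun _ _ => add_zero _
  add_comm f g := EndE.hext fun _ _ => add_comm _ _
  neg_add_cancel f := EndE.hext fun _ _ => neg_add_cancel _
  sub_eq_add_neg f g := EndE.hext fun _ _ => sub_eq_add_neg _ _
  mul_assoc f g h := rfl
  one_mul f := rfl
  mul_one f := rfl
  zero_mul f := rfl
  mul_zero f := EndE.hext fun U _ => map_zero (f.app U)
  left_distrib f g h := EndE.hext fun U _ => map_add (f.app U) _ _
  right_distrib f g h := rfl
  nsmul := nsmulRec
  zsmul := zsmulRec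

instance : Module ℂ (EndE E) where
  one_smul f := EndE.hext fun U s => one_smul ℂ (f.app U s)
  mul_smul a b f := EndE.hext fun U s => mul_smul a b (f.app U s)
  smul_zero a := EndE.hext fun U _ => smul_zero (A := ESec E U) a
  smul_add a f g := EndE.hext fun U s => smul_add a (f.app U s) (g.app U s)
  add_smul a b f := EndE.hext fun U s => add_smul a b (f.app U s)
  zero_smul f := EndE.hext fun U s => zero_smul ℂ (f.app U s)

instance : Algebra ℂ (EndE E) := Algebra.ofModule (fun _ _ _ => rfl)
  (fun r f g => EndE.hext fun U s => map_smul (f.app U) r (g.app U s))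

/-- The operator `∂̄` on `A^{*,*}_X(E^*)`. -/
def eDelbar : EndE E :=
  ⟨fun U => LinearMap.pi fun r => (delbarOp (E.X r) U).sec ∘ₗ LinearMap.proj r, by
    intro U V h s
    funext r
    exact LocalOp.aRes_sec _ _ h (fun _ _ _ => rfl) (s r)⟩

/-- The operator `δ` on `A^{*,*}_X(E^*)`. -/
def eDelta : EndE E :=
  ⟨fun U => LinearMap.pi fun r => (morOp (E.d (r - 1) r) U).sec ∘ₗ LinearMap.proj (r - 1), by
    intro U V h s
    funext r
    exact LocalOp.aRes_sec _ _ h (fun _ _ _ => rfl) (s (r - 1))⟩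

variable (E) in
/-- The subspace `A^{a,b}_X(Hom^n(E^*, E^*))`: the endomorphisms of the sheaf `A^{*,*}_X(E^*)`
which are `A^{*,*}_X`-linear with the Koszul sign for degree `a + b + n`, and which map sections
of `E^r` to sections of `A^{a,b}_X(E^{r+n})`. -/
def AHom (a b : ℕ) (n : ℤ) : Submodule ℂ (EndE E) where
  carrier := {f |
    (∀ (U : Opens X) (j k : ℕ), ∀ φ ∈ formsType H U j k, ∀ s : ESec E U,
      f.app U (eMul E φ s) = sgn ((a + b + n) * (j + k)) • eMul E φ (f.app U s)) ∧
    ∀ (U : Opens X) (r : ℤ) (e : (E.X r).Sec U), f.app U (eTmul E 1 e) ∈ eBi E U a b (r + n)}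
  add_mem' := by
    rintro f g ⟨h1, h2⟩ ⟨h3, h4⟩
    refine ⟨fun U j k φ hφ s => ?_, fun U r e => Submodule.add_mem _ (h2 U r e) (h4 U r e)⟩
    change f.app U _ + g.app U _ = _ • eMul E φ (f.app U s + g.app U s)
    rw [h1 U j k φ hφ, h3 U j k φ hφ, map_add, smul_add]
  zero_mem' := by
    refine ⟨fun U j k φ hφ s => ?_, fun U r e => Submodule.zero_mem _⟩
    change (0 : ESec E U) = _ • eMul E φ 0
    rw [map_zero, smul_zero]
  smul_mem' := by
    rintro c f ⟨h1, h2⟩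
    refine ⟨fun U j k φ hφ s => ?_, fun U r e => Submodule.smul_mem _ c (h2 U r e)⟩
    change c • f.app U _ = _ • eMul E φ (c • f.app U s)
    rw [h1 U j k φ hφ, map_smul, smul_comm]

lemma eDelbar_eMul {U : Opens X} (φ : Forms H U) (s : ESec E U) :
    (eDelbar (E := E)).app U (eMul E φ s) =
      eMul E (delbar U φ) s + eMul E (formInvol U φ) ((eDelbar (E := E)).app U s) := by
  funext r
  ext1; funext x
  obtain ⟨V, hV, hx, t, ht⟩ := exists_germ (s r) x
  change (delbarOp (E.X r) U).stalk x.2 ((mulOp (E.X r) φ).stalk x.2 ((s r).1 x)) =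
    (mulOp (E.X r) (delbar U φ)).stalk x.2 ((s r).1 x) +
    (mulOp (E.X r) (formInvol U φ)).stalk x.2 ((delbarOp (E.X r) U).stalk x.2 ((s r).1 x))
  rw [ht, LocalOp.stalk_germ _ hV hx, LocalOp.stalk_germ _ hV hx, LocalOp.stalk_germ _ hV hx,
    LocalOp.stalk_germ _ hV hx, LocalOp.stalk_germ _ hV hx, ← map_add]
  congr 1
  clear ht
  induction t using TensorProduct.induction_on with
  | zero => simp only [map_zero, add_zero]
  | tmul ψ e =>
    change (delbar V (formRes hV φ * ψ)) ⊗ₜ[Hol H V] e =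
      (formRes hV (delbar U φ) * ψ) ⊗ₜ[Hol H V] e +
      (formRes hV (formInvol U φ) * delbar V ψ) ⊗ₜ[Hol H V] e
    rw [← TensorProduct.add_tmul]
    congr 1
    have h1 : formRes hV (delbar U φ) = delbar V (formRes hV φ) :=
      formRes_formD (Or.inr rfl) hV φ
    rw [h1]
    ext1; funext y
    exact formD_mul (Or.inr rfl) (formRes hV φ) ψ y
  | add a b ha hb =>
    simp only [map_add, ha, hb]
    abel

lemma eDelta_eMul {U : Opens X} (φ : Forms H U) (s : ESec E U) :
    (eDelta (E := E)).app U (eMul E φ s) =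
      eMul E (formInvol U φ) ((eDelta (E := E)).app U s) := by
  funext r
  ext1; funext x
  obtain ⟨V, hV, hx, t, ht⟩ := exists_germ (s (r - 1)) x
  change (morOp (E.d (r - 1) r) U).stalk x.2 ((mulOp (E.X (r - 1)) φ).stalk x.2 ((s (r - 1)).1 x)) =
    (mulOp (E.X r) (formInvol U φ)).stalk x.2
      ((morOp (E.d (r - 1) r) U).stalk x.2 ((s (r - 1)).1 x))
  rw [ht, LocalOp.stalk_germ _ hV hx, LocalOp.stalk_germ _ hV hx, LocalOp.stalk_germ _ hV hx,
    LocalOp.stalk_germ _ hV hx]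
  congr 1
  clear ht
  induction t using TensorProduct.induction_on with
  | zero => simp only [map_zero]
  | tmul ψ e =>
    change (formInvol V (formRes hV φ * ψ)) ⊗ₜ[Hol H V] (HolMod.app (E.d (r - 1) r) V e) =
      (formRes hV (formInvol U φ) * formInvol V ψ) ⊗ₜ[Hol H V] (HolMod.app (E.d (r - 1) r) V e)
    rw [map_mul]
    rfl
  | add a b ha hb => simp only [map_add, ha, hb]

end Tot

section Clo
variable {H : Type} [NormedAddCommGroup H] [NormedSpace ℂ H] [FiniteDimensional ℂ H]
  {X : Type} [TopologicalSpace X] [ChartedSpace H X] [IsManifold 𝓘(ℂ, H) ω X]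
  {E : CochainComplex (HolMod H X) ℤ}

lemma eMul_add {U : Opens X} (φ ψ : Forms H U) (s : ESec E U) :
    eMul E (φ + ψ) s = eMul E φ s + eMul E ψ s := by
  funext r
  ext1; funext x
  obtain ⟨V, hV, hx, t, ht⟩ := exists_germ (s r) x
  change (mulOp (E.X r) (φ + ψ)).stalk x.2 ((s r).1 x) =
    (mulOp (E.X r) φ).stalk x.2 ((s r).1 x) + (mulOp (E.X r) ψ).stalk x.2 ((s r).1 x)
  rw [ht, LocalOp.stalk_germ _ hV hx, LocalOp.stalk_germ _ hV hx, LocalOp.stalk_germ _ hV hx,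
    ← map_add]
  congr 1
  clear ht
  induction t using TensorProduct.induction_on with
  | zero => simp only [map_zero, add_zero]
  | tmul η e =>
    change (formRes hV (φ + ψ) * η) ⊗ₜ[Hol H V] e =
      (formRes hV φ * η) ⊗ₜ[Hol H V] e + (formRes hV ψ * η) ⊗ₜ[Hol H V] e
    rw [← TensorProduct.add_tmul, map_add, add_mul]
  | add a b ha hb =>
    simp only [map_add, ha, hb]
    abel

lemma eMul_smul {U : Opens X} (c : ℂ) (φ : Forms H U) (s : ESec E U) :
    eMul E (c • φ) s = c • eMul E φ s := by
  funext r
  ext1; funext x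
  obtain ⟨V, hV, hx, t, ht⟩ := exists_germ (s r) x
  change (mulOp (E.X r) (c • φ)).stalk x.2 ((s r).1 x) =
    c • (mulOp (E.X r) φ).stalk x.2 ((s r).1 x)
  rw [ht, LocalOp.stalk_germ _ hV hx, LocalOp.stalk_germ _ hV hx, ← map_smul]
  congr 1
  clear ht
  induction t using TensorProduct.induction_on with
  | zero => simp only [map_zero, smul_zero]
  | tmul η e =>
    change (formRes hV (c • φ) * η) ⊗ₜ[Hol H V] e = c • ((formRes hV φ * η) ⊗ₜ[Hol H V] e)
    rw [map_smul, smul_mul_assoc]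
    rfl
  | add a b ha hb =>
    simp only [map_add, ha, hb, smul_add]

/-- Sections of `A^{*,*}_X(E^*)` defined by elements of `A^{*,*}(U) ⊗ E^r(U)`. -/
def eOf (E : CochainComplex (HolMod H X) ℤ) (U : Opens X) (r : ℤ) :
    TP (E.X r) U →ₗ[ℂ] ESec E U :=
  LinearMap.single ℂ (fun r => ASec (E.X r) U) r ∘ₗ aOf (E.X r) U

lemma eTmul_eq {U : Opens X} {r : ℤ} (φ : Forms H U) (e : (E.X r).Sec U) :
    eTmul E φ e = eMul E φ (eTmul E 1 e) := by
  funext r'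
  change _ = (mulOp (E.X r') φ).sec ((eTmul E 1 e : ESec E U) r')
  by_cases h : r' = r
  · subst h
    unfold eTmul
    rw [Pi.single_eq_same, Pi.single_eq_same, LocalOp.sec_aOf]
    congr 1
    change φ ⊗ₜ[Hol H U] e = (formRes le_rfl φ * 1) ⊗ₜ[Hol H U] e
    rw [mul_one]; rfl
  · unfold eTmul
    rw [Pi.single_eq_of_ne h, Pi.single_eq_of_ne h, map_zero]

lemma mulOp_mem {M : HolMod H X} {U : Opens X} {φ : Forms H U} {a b a' b' : ℕ}
    (hφ : φ ∈ formsType H U a b) {s : ASec M U} (hs : s ∈ AType M U a' b') :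
    (mulOp M φ).sec s ∈ AType M U (a + a') (b + b') :=
  LocalOp.sec_mem _ (fun _ hV _ ht => tMap_mem (α := mulHol (formRes hV φ)) (β := LinearMap.id)
    (fun _ hψ => mul_mem_formsType (η := formRes hV φ) (fun _ => hφ _) hψ) ht) hs

lemma eMul_mem {U : Opens X} {φ : Forms H U} {a b a' b' : ℕ} {r : ℤ}
    (hφ : φ ∈ formsType H U a b) {s : ESec E U} (hs : s ∈ eBi E U a' b' r) :
    eMul E φ s ∈ eBi E U (a + a') (b + b') r := by
  refine ⟨mulOp_mem hφ hs.1, fun r' hr => ?_⟩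
  change (mulOp (E.X r') φ).sec (s r') = 0
  rw [hs.2 r' hr, map_zero]

lemma eDelbar_mem {U : Opens X} {a b : ℕ} {r : ℤ} {s : ESec E U} (hs : s ∈ eBi E U a b r) :
    (eDelbar (E := E)).app U s ∈ eBi E U a (b + 1) r := by
  refine ⟨LocalOp.sec_mem _ (fun _ _ _ ht => tMap_mem (fun _ hψ => delbar_mem hψ) ht) hs.1,
    fun r' hr => ?_⟩
  change (delbarOp (E.X r') U).sec (s r') = 0
  rw [hs.2 r' hr, map_zero]

lemma eDelta_mem {U : Opens X} {a b : ℕ} {r : ℤ} {s : ESec E U} (hs : s ∈ eBi E U a b r) :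
    (eDelta (E := E)).app U s ∈ eBi E U a b (r + 1) := by
  obtain ⟨r', rfl⟩ : ∃ r', r = r' - 1 := ⟨r + 1, by ring⟩
  rw [sub_add_cancel]
  refine ⟨LocalOp.sec_mem _ (fun _ _ _ ht => tMap_mem (fun ψ hψ => ?_) ht) hs.1,
    fun r'' hr => ?_⟩
  · have := formInvol_of_mem hψ
    change formInvol _ ψ ∈ _
    rw [this]
    exact Submodule.smul_mem _ _ hψ
  · change (morOp (E.d (r'' - 1) r'') U).sec (s (r'' - 1)) = 0
    rw [hs.2 (r'' - 1) (fun h => hr (by linarith)), map_zero]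

lemma eDelbar_eTmul_one {U : Opens X} {r : ℤ} (e : (E.X r).Sec U) :
    (eDelbar (E := E)).app U (eTmul E 1 e) = 0 := by
  funext r'
  change (delbarOp (E.X r') U).sec ((eTmul E 1 e : ESec E U) r') = 0
  unfold eTmul
  by_cases h : r' = r
  · subst h
    rw [Pi.single_eq_same, LocalOp.sec_aOf]
    change aOf _ U (delbar U 1 ⊗ₜ[Hol H U] e) = 0
    have : delbar U (1 : Forms H U) = 0 := by
      have := delbar_holForm (1 : Hol H U)
      rwa [map_one] at this
    rw [this, TensorProduct.zero_tmul, map_zero]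
  · rw [Pi.single_eq_of_ne h, map_zero]

lemma eDelta_eTmul_one {U : Opens X} {r : ℤ} (e : (E.X r).Sec U) :
    (eDelta (E := E)).app U (eTmul E 1 e) = eTmul E 1 (HolMod.app (E.d r (r + 1)) U e) := by
  obtain ⟨r', rfl⟩ : ∃ r', r = r' - 1 := ⟨r + 1, by ring⟩
  rw [sub_add_cancel]
  funext r''
  change (morOp (E.d (r'' - 1) r'') U).sec ((eTmul E 1 e : ESec E U) (r'' - 1)) = _
  unfold eTmul
  by_cases h : r'' = r'
  · subst h
    rw [Pi.single_eq_same, Pi.single_eq_same, LocalOp.sec_aOf]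
    congr 1
    change formInvol U 1 ⊗ₜ[Hol H U] _ = _
    rw [map_one]
  · have h' : r'' - 1 ≠ r' - 1 := fun hh => h (by linarith)
    rw [Pi.single_eq_of_ne h, Pi.single_eq_of_ne h', map_zero]

lemma eBi_of_local {U : Opens X} {a b : ℕ} {r : ℤ} {s : ESec E U}
    (hs : ∀ x : U, ∃ (V : Opens X) (h : V ≤ U), x.1 ∈ V ∧ eRes E h s ∈ eBi E V a b r) :
    s ∈ eBi E U a b r := by
  refine ⟨mem_AType_of_local fun x => ?_, fun r' hr => ?_⟩
  · obtain ⟨V, h, hx, h1, -⟩ := hs x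
    exact ⟨V, h, hx, h1⟩
  · ext1; funext x
    obtain ⟨V, h, hx, -, h2⟩ := hs x
    have := congrArg (fun z : ASec (E.X r') V => z.1 ⟨x.1, hx⟩) (h2 r' hr)
    exact this

/-- An element of `A^{a,b}_X(Hom^n)` maps `A^{a',b'}_X(E^r)` to `A^{a+a',b+b'}_X(E^{r+n})`. -/
lemma AHom.apply_mem {a b a' b' : ℕ} {n r : ℤ} {f : EndE E} (hf : f ∈ AHom E a b n)
    {U : Opens X} {s : ESec E U} (hs : s ∈ eBi E U a' b' r) :
    f.app U s ∈ eBi E U (a' + a) (b' + b) (r + n) := by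
  refine eBi_of_local fun x => ?_
  obtain ⟨V, hV, hx, t, ht, hst⟩ := hs.1 x
  refine ⟨V, hV, hx, ?_⟩
  have hres : eRes E hV s = eOf E V r t := by
    funext r'
    change aRes (E.X r') hV (s r') = Pi.single (M := fun r => ASec (E.X r) V) r _ r'
    by_cases h : r' = r
    · subst h
      rw [Pi.single_eq_same]
      ext1; funext y
      exact hst y.1 y.2
    · rw [Pi.single_eq_of_ne h, hs.2 r' h, map_zero]
  rw [f.app_res, hres]
  clear hst hres
  induction ht using Submodule.span_induction with
  | mem t ht =>
    obtain ⟨φ, hφ, e, rfl⟩ := ht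
    change f.app V (eTmul E φ e) ∈ _
    rw [eTmul_eq, hf.1 V a' b' φ hφ]
    exact Submodule.smul_mem _ _ (eMul_mem hφ (hf.2 V r e))
  | zero => rw [map_zero, map_zero]; exact Submodule.zero_mem _
  | add a b _ _ ha hb => rw [map_add, map_add]; exact Submodule.add_mem _ ha hb
  | smul c a _ ha => rw [map_smul, map_smul]; exact Submodule.smul_mem _ _ ha

lemma AHom.mul_mem {a b a' b' : ℕ} {n n' : ℤ} {f g : EndE E} (hf : f ∈ AHom E a b n)
    (hg : g ∈ AHom E a' b' n') : f * g ∈ AHom E (a' + a) (b' + b) (n' + n) := by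
  refine ⟨fun U j k φ hφ s => ?_, fun U r e => ?_⟩
  · change f.app U (g.app U _) = _ • eMul E φ (f.app U (g.app U s))
    rw [hg.1 U j k φ hφ, map_smul, hf.1 U j k φ hφ, smul_smul, ← sgn_add]
    congr 2
    push_cast
    ring
  · rw [← add_assoc]
    exact AHom.apply_mem hf (hg.2 U r e)

lemma comm_aux {W : Type*} [AddCommGroup W] [Module ℂ W] {d F m m' : W →ₗ[ℂ] W} {c σ t : ℂ}
    (ht : t * t = 1) (hd : ∀ s, d (m s) = m' s + σ • m (d s)) (hF : ∀ s, F (m s) = c • m (F s))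
    (hF' : ∀ s, F (m' s) = (c * t) • m' (F s)) (s : W) :
    d (F (m s)) - t • F (d (m s)) = (c * σ) • m (d (F s) - t • F (d s)) := by
  rw [hF, map_smul, hd, hd, map_add, map_smul, hF, hF', map_sub, map_smul]
  simp only [smul_add, smul_sub, smul_smul]
  have e4 : t * (c * t) = c := by linear_combination c * ht
  have e5 : t * (σ * c) = c * σ * t := by ring
  rw [e4, e5]
  abel

lemma eDelbar_eMul' {U : Opens X} {j k : ℕ} {φ : Forms H U} (hφ : φ ∈ formsType H U j k)
    (s : ESec E U) : (eDelbar (E := E)).app U (eMul E φ s) =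
      eMul E (delbar U φ) s + sgn (j + k) • eMul E φ ((eDelbar (E := E)).app U s) := by
  rw [eDelbar_eMul, formInvol_of_mem hφ, eMul_smul]

lemma eDelta_eMul' {U : Opens X} {j k : ℕ} {φ : Forms H U} (hφ : φ ∈ formsType H U j k)
    (s : ESec E U) : (eDelta (E := E)).app U (eMul E φ s) =
      (0 : ESec E U →ₗ[ℂ] ESec E U) s + sgn (j + k) • eMul E φ ((eDelta (E := E)).app U s) := by
  rw [eDelta_eMul, formInvol_of_mem hφ, eMul_smul, LinearMap.zero_apply, zero_add]

lemma EndE.comm_apply (f g : EndE E) (c : ℂ) {U : Opens X} (s : ESec E U) :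
    (f * g - c • (g * f)).app U s = f.app U (g.app U s) - c • g.app U (f.app U s) := rfl

lemma AHom.delbar_comm_mem {a b : ℕ} {n : ℤ} {f : EndE E} (hf : f ∈ AHom E a b n) :
    eDelbar * f - sgn (a + b + n) • (f * eDelbar) ∈ AHom E a (b + 1) n := by
  refine ⟨fun U j k φ hφ s => ?_, fun U r e => ?_⟩
  · have e1 : sgn (((a : ℤ) + b + n) * (j + (k + 1 : ℕ))) =
        sgn ((a + b + n) * (j + k)) * sgn (a + b + n) := by
      rw [← sgn_add]; congr 1; push_cast; ring
    have e2 : sgn (((a : ℤ) + (b + 1 : ℕ) + n) * (j + k)) =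
        sgn ((a + b + n) * (j + k)) * sgn (j + k) := by
      rw [← sgn_add]; congr 1; push_cast; ring
    have hF' := hf.1 U j (k + 1) _ (delbar_mem hφ)
    rw [e1] at hF'
    have h1 := comm_aux (d := eDelbar.app U) (F := f.app U) (m := eMul E φ)
      (m' := eMul E (delbar U φ)) (sgn_mul_self _) (eDelbar_eMul' hφ) (hf.1 U j k φ hφ) hF' s
    exact h1.trans (congrArg (fun c : ℂ => c • eMul E φ
      ((eDelbar * f - sgn (a + b + n) • (f * eDelbar)).app U s)) e2.symm)
  · have h : f.app U (eDelbar.app U (eTmul E 1 e)) = 0 := by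
      rw [eDelbar_eTmul_one, map_zero]
    rw [EndE.comm_apply, h, smul_zero, sub_zero]
    exact eDelbar_mem (hf.2 U r e)

lemma AHom.delta_comm_mem {a b : ℕ} {n : ℤ} {f : EndE E} (hf : f ∈ AHom E a b n) :
    eDelta * f - sgn (a + b + n) • (f * eDelta) ∈ AHom E a b (n + 1) := by
  refine ⟨fun U j k φ hφ s => ?_, fun U r e => ?_⟩
  · have e2 : sgn (((a : ℤ) + b + (n + 1)) * (j + k)) =
        sgn ((a + b + n) * (j + k)) * sgn (j + k) := by
      rw [← sgn_add]; congr 1; ring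
    have h1 := comm_aux (d := eDelta.app U) (F := f.app U) (m := eMul E φ) (m' := 0)
      (t := sgn (a + b + n)) (sgn_mul_self _) (eDelta_eMul' hφ) (hf.1 U j k φ hφ)
      (fun s => by rw [LinearMap.zero_apply, LinearMap.zero_apply, map_zero, smul_zero]) s
    exact h1.trans (congrArg (fun c : ℂ => c • eMul E φ
      ((eDelta * f - sgn (a + b + n) • (f * eDelta)).app U s)) e2.symm)
  · rw [EndE.comm_apply, eDelta_eTmul_one]
    refine Submodule.sub_mem _ ?_ (Submodule.smul_mem _ _ ?_)
    · rw [← add_assoc]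
      exact eDelta_mem (hf.2 U r e)
    · have := hf.2 U (r + 1) (HolMod.app (E.d r (r + 1)) U e)
      rwa [add_assoc, add_comm 1 n] at this

variable (E) in
/-- The degree `i` part of `A^{0,*}_X(Hom^*(E^*, E^*))`. -/
def AHom0 (i : ℤ) : Submodule ℂ (EndE E) := ⨆ b : ℕ, AHom E 0 b (i - b)

variable (E) in
/-- The differential `f ↦ [δ + ∂̄, f]` on endomorphisms of degree `i`. -/
def homDiff (i : ℤ) : EndE E →ₗ[ℂ] EndE E :=
  LinearMap.mulLeft ℂ (eDelta + eDelbar : EndE E) -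
    sgn i • LinearMap.mulRight ℂ (eDelta + eDelbar : EndE E)

variable (E) in
/-- The graded commutator `fg - (-1)^{ij} gf` of endomorphisms of degrees `i` and `j`. -/
def homBr (i j : ℤ) : EndE E →ₗ[ℂ] EndE E →ₗ[ℂ] EndE E :=
  LinearMap.mul ℂ (EndE E) - sgn (i * j) • (LinearMap.mul ℂ (EndE E)).flip

lemma homDiff_eq (i : ℤ) (f : EndE E) : homDiff E i f =
    (eDelta * f - sgn i • (f * eDelta)) + (eDelbar * f - sgn i • (f * eDelbar)) := by
  have h : homDiff E i f =
    (eDelta + eDelbar) * f - sgn i • (f * (eDelta + eDelbar)) := rfl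
  rw [h, add_mul, mul_add, smul_add]
  abel

lemma homDiff_mem_aux {i n : ℤ} {b : ℕ} (hi : ((0 : ℕ) : ℤ) + b + n = i)
    (h1 : n + 1 = i + 1 - b) (h2 : n = i + 1 - (b + 1 : ℕ)) {f : EndE E}
    (hf : f ∈ AHom E 0 b n) : homDiff E i f ∈ AHom0 E (i + 1) := by
  have k1 := AHom.delta_comm_mem hf
  have k2 := AHom.delbar_comm_mem hf
  subst hi
  rw [homDiff_eq]
  refine Submodule.add_mem _ (Submodule.mem_iSup_of_mem b ?_)
    (Submodule.mem_iSup_of_mem (b + 1) ?_)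
  · rwa [← h1]
  · rwa [← h2]

lemma homDiff_mem {i : ℤ} {f : EndE E} (hf : f ∈ AHom0 E i) :
    homDiff E i f ∈ AHom0 E (i + 1) := by
  have h : AHom0 E i ≤ (AHom0 E (i + 1)).comap (homDiff E i) :=
    iSup_le fun b f hf => homDiff_mem_aux (by push_cast; ring) (by ring)
      (by push_cast; ring) hf
  exact h hf

lemma AHom0_mul_mem {i j : ℤ} {f g : EndE E} (hf : f ∈ AHom0 E i) (hg : g ∈ AHom0 E j) :
    f * g ∈ AHom0 E (i + j) := by
  have h : AHom0 E i ≤ (⨅ g : AHom0 E j, (AHom0 E (i + j)).comap (LinearMap.mulRight ℂ g.1)) := by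
    refine iSup_le fun b f hf => ?_
    rw [Submodule.mem_iInf]
    rintro ⟨g, hg⟩
    have h' : AHom0 E j ≤ (AHom0 E (i + j)).comap (LinearMap.mulLeft ℂ f) := by
      refine iSup_le fun b' g hg => ?_
      refine Submodule.mem_iSup_of_mem (b' + b) ?_
      have := AHom.mul_mem hf hg
      convert! this using 2
      push_cast; ring
    exact h' hg
  have := h hf
  rw [Submodule.mem_iInf] at this
  exact this ⟨g, hg⟩

lemma homBr_mem {i j : ℤ} {f g : EndE E} (hf : f ∈ AHom0 E i) (hg : g ∈ AHom0 E j) :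
    homBr E i j f g ∈ AHom0 E (i + j) := by
  refine Submodule.sub_mem _ (AHom0_mul_mem hf hg) (Submodule.smul_mem _ _ ?_)
  have := AHom0_mul_mem hg hf
  rwa [add_comm j i] at this

end Clo

section DGL

/-- `d` and `br` make the graded complex vector space with components `deg i` into a
DG-Lie algebra. -/
structure IsDGLie {V : Type} [AddCommMonoid V] [Module ℂ V] (deg : ℤ → Submodule ℂ V)
    (d : V →ₗ[ℂ] V) (br : V →ₗ[ℂ] V →ₗ[ℂ] V) : Prop where
  internal : DirectSum.IsInternal deg
  d_mem : ∀ i, ∀ x ∈ deg i, d x ∈ deg (i + 1)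
  br_mem : ∀ i j, ∀ x ∈ deg i, ∀ y ∈ deg j, br x y ∈ deg (i + j)
  d_d : ∀ x, d (d x) = 0
  skew : ∀ i j, ∀ x ∈ deg i, ∀ y ∈ deg j, br x y + sgn (i * j) • br y x = 0
  jacobi : ∀ i j, ∀ x ∈ deg i, ∀ y ∈ deg j, ∀ z,
    br x (br y z) = br (br x y) z + sgn (i * j) • br y (br x z)
  leibniz : ∀ i, ∀ x ∈ deg i, ∀ y, d (br x y) = br (d x) y + sgn i • br x (d y)

/-- The antisymmetric Koszul sign of a permutation `σ` of homogeneous vectors of degrees `k`. -/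
def koszul {n : ℕ} (k : Fin n → ℤ) (σ : Equiv.Perm (Fin n)) : ℂ :=
  ∏ i : Fin n, ∏ j : Fin n, if i < j ∧ σ j < σ i then -sgn (k (σ i) * k (σ j)) else 1

open Classical in
/-- The shuffles `S(p, n - p)`: permutations which are increasing on the first `p` and on the
last `n - p` indices. -/
def shuffles (n p : ℕ) : Finset (Equiv.Perm (Fin n)) :=
  Finset.univ.filter fun σ => ∀ i j : Fin n, i < j → (j.1 < p ∨ p ≤ i.1) → σ i < σ j

/-- `g`, with components `g n` for `n ≥ 1`, is an `L_∞` morphism from the DG-Lie algebra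
`(V, δ, brV)` to the DG-Lie algebra `(L, d, brL)`. -/
structure IsLInfty {V L : Type} [AddCommMonoid V] [Module ℂ V] [AddCommMonoid L] [Module ℂ L]
    (degV : ℤ → Submodule ℂ V) (δ : V →ₗ[ℂ] V) (brV : V →ₗ[ℂ] V →ₗ[ℂ] V)
    (degL : ℤ → Submodule ℂ L) (d : L →ₗ[ℂ] L) (brL : L →ₗ[ℂ] L →ₗ[ℂ] L)
    (g : ∀ n : ℕ, MultilinearMap ℂ (fun _ : Fin n => V) L) : Prop where
  degree : ∀ (n : ℕ), 1 ≤ n → ∀ (k : Fin n → ℤ) (v : Fin n → V), (∀ i, v i ∈ degV (k i)) →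
    g n v ∈ degL ((∑ i, k i) + 1 - n)
  skew : ∀ (n : ℕ), 1 ≤ n → ∀ (k : Fin n → ℤ) (v : Fin n → V), (∀ i, v i ∈ degV (k i)) →
    ∀ σ : Equiv.Perm (Fin n), g n (fun i => v (σ i)) = koszul k σ • g n v
  morphism : ∀ v : V, g 1 ![δ v] = d (g 1 ![v])
  /-- The relation in arity `n = m + 2`, where the index `p` of the first sum is `q + 1`. -/
  relation : ∀ (m : ℕ) (k : Fin (m + 2) → ℤ) (v : Fin (m + 2) → V), (∀ i, v i ∈ degV (k i)) →
    (1 / 2 : ℂ) • (∑ q : Fin (m + 1), ∑ σ ∈ shuffles (m + 2) (q + 1),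
      (koszul k σ * sgn ((1 - (m + 2) + (q + 1)) *
        ((∑ i : Fin (q + 1), k (σ ⟨i, by omega⟩)) - (q + 1)))) •
        brL (g (q + 1) fun i => v (σ ⟨i, by omega⟩))
          (g (m + 1 - q) fun i => v (σ ⟨q + 1 + i, by omega⟩))) +
      d (g (m + 2) v) =
    sgn (m + 1) • (∑ σ ∈ shuffles (m + 2) 1, koszul k σ •
      g (m + 2) (Fin.cons (δ (v (σ 0))) fun i : Fin (m + 1) => v (σ i.succ))) +
    sgn m • (∑ σ ∈ shuffles (m + 2) 2, koszul k σ •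
      g (m + 1) (Fin.cons (brV (v (σ 0)) (v (σ 1))) fun i : Fin m => v (σ i.succ.succ)))

end DGL

section Src
variable {H : Type} [NormedAddCommGroup H] [NormedSpace ℂ H] [FiniteDimensional ℂ H]
  {X : Type} [TopologicalSpace X] [ChartedSpace H X] [IsManifold 𝓘(ℂ, H) ω X]
  (E : CochainComplex (HolMod H X) ℤ)

/-- The graded vector space `A^{0,*}_X(Hom^*(E^*, E^*))`. -/
abbrev HomDG : Type := DirectSum ℤ fun i => AHom0 E i

/-- The inclusion of the component of degree `i`. -/
abbrev homOf (i : ℤ) : AHom0 E i →ₗ[ℂ] HomDG E := DirectSum.lof ℂ ℤ (fun i => AHom0 E i) i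

/-- The component of degree `i` of `A^{0,*}_X(Hom^*(E^*, E^*))`. -/
def homDeg (i : ℤ) : Submodule ℂ (HomDG E) := LinearMap.range (homOf E i)

/-- The differential `[δ + ∂̄, -]` of `A^{0,*}_X(Hom^*(E^*, E^*))`. -/
def homD : HomDG E →ₗ[ℂ] HomDG E :=
  DirectSum.toModule ℂ ℤ _ fun i =>
    homOf E (i + 1) ∘ₗ (homDiff E i).restrict fun _ hf => homDiff_mem hf

/-- The bracket of homogeneous elements. -/
def homBrAux (i j : ℤ) : AHom0 E i →ₗ[ℂ] AHom0 E j →ₗ[ℂ] AHom0 E (i + j) :=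
  LinearMap.mk₂ ℂ (fun f g => ⟨homBr E i j f.1 g.1, homBr_mem f.2 g.2⟩)
    (fun f f' g => Subtype.ext (LinearMap.map_add₂ (homBr E i j) f.1 f'.1 g.1))
    (fun c f g => Subtype.ext (LinearMap.map_smul₂ (homBr E i j) c f.1 g.1))
    (fun f g g2 => Subtype.ext ((homBr E i j f.1).map_add g.1 g2.1))
    (fun c f g => Subtype.ext ((homBr E i j f.1).map_smul c g.1))

/-- The graded commutator on `A^{0,*}_X(Hom^*(E^*, E^*))`. -/
def homBracket : HomDG E →ₗ[ℂ] HomDG E →ₗ[ℂ] HomDG E :=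
  DirectSum.toModule ℂ ℤ (HomDG E →ₗ[ℂ] HomDG E) fun i => LinearMap.flip
    (DirectSum.toModule ℂ ℤ (AHom0 E i →ₗ[ℂ] HomDG E) fun j => LinearMap.flip
      ((homBrAux E i j).compr₂ (homOf E (i + j))))

end Src

section Tgt
variable (H : Type) [NormedAddCommGroup H] [NormedSpace ℂ H] [FiniteDimensional ℂ H]
  (X : Type) [TopologicalSpace X] [ChartedSpace H X] [IsManifold 𝓘(ℂ, H) ω X]

/-- Global smooth forms on `X`. -/
abbrev GForms : Type := Forms H (⊤ : Opens X)

/-- The space `A^{a,*}_X` of global forms. -/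
def formsRow (a : ℕ) : Submodule ℂ (GForms H X) := ⨆ b : ℕ, formsType H ⊤ a b

/-- The subspace `A^{≥2,*}_X` of global forms. -/
def formsF2 : Submodule ℂ (GForms H X) := ⨆ (a : ℕ) (_ : 2 ≤ a), formsRow H X a

/-- Global forms of total degree `k`. -/
def formsDeg (k : ℤ) : Submodule ℂ (GForms H X) :=
  ⨆ (a : ℕ) (b : ℕ) (_ : (a : ℤ) + b = k), formsType H ⊤ a b

lemma deRham_F2 : formsF2 H X ≤ (formsF2 H X).comap (deRham ⊤) := by
  refine iSup₂_le fun a ha => iSup_le fun b φ hφ => ?_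
  change del ⊤ φ + delbar ⊤ φ ∈ formsF2 H X
  refine Submodule.add_mem _ ?_ ?_
  · exact Submodule.mem_iSup_of_mem (a + 1) (Submodule.mem_iSup_of_mem (by omega)
      (Submodule.mem_iSup_of_mem b (del_mem hφ)))
  · exact Submodule.mem_iSup_of_mem a (Submodule.mem_iSup_of_mem ha
      (Submodule.mem_iSup_of_mem (b + 1) (delbar_mem hφ)))

/-- The quotient `A^{*,*}_X / A^{≥2,*}_X` of the de Rham complex. -/
abbrev DRQuot : Type := GForms H X ⧸ formsF2 H X

/-- The component of degree `i` of the shifted quotient `(A^{*,*}_X / A^{≥2,*}_X)[2]`. -/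
def drDeg (i : ℤ) : Submodule ℂ (DRQuot H X) := (formsDeg H X (i + 2)).map (formsF2 H X).mkQ

/-- The differential of `(A^{*,*}_X / A^{≥2,*}_X)[2]`; the sign `(-1)^2` of the shift is `1`. -/
def drD : DRQuot H X →ₗ[ℂ] DRQuot H X :=
  (formsF2 H X).mapQ (formsF2 H X) (deRham ⊤) (deRham_F2 H X)

end Tgt

section Conn
variable {H : Type} [NormedAddCommGroup H] [NormedSpace ℂ H] [FiniteDimensional ℂ H]
  {X : Type} [TopologicalSpace X] [ChartedSpace H X] [IsManifold 𝓘(ℂ, H) ω X]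

/-- `ε` is a frame of `M` over `V`: its restrictions to every open `W ⊆ V` form a basis. -/
def IsFrame (M : HolMod H X) (V : Opens X) {m : ℕ} (ε : Fin m → M.Sec V) : Prop :=
  ∀ (W : Opens X) (h : W ≤ V), LinearIndependent (Hol H W) (fun i => M.res h (ε i)) ∧
    Submodule.span (Hol H W) (Set.range fun i => M.res h (ε i)) = ⊤

/-- `E` is a complex of locally free sheaves (of finite rank) concentrated in degrees `[p, q]`. -/
structure IsLocallyFree (E : CochainComplex (HolMod H X) ℤ) (p q : ℤ) : Prop where
  isZero : ∀ r, (r < p ∨ q < r) → Limits.IsZero (E.X r)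
  locFree : ∀ (r : ℤ) (x : X), ∃ (V : Opens X) (_ : x ∈ V) (m : ℕ) (ε : Fin m → (E.X r).Sec V),
    IsFrame (E.X r) V ε

variable {E : CochainComplex (HolMod H X) ℤ}

/-- `D` is a connection of type `(1,0)` on `E`. -/
structure IsConnection10 (D : EndE E) : Prop where
  degree : ∀ (U : Opens X) (k : ℤ), ∀ s ∈ eDeg E U k, D.app U s ∈ eDeg E U (k + 1)
  leibniz : ∀ (U : Opens X) (r : ℤ) (φ : Forms H U) (e : (E.X r).Sec U),
    D.app U (eTmul E φ e) =
      eTmul E (deRham U φ) e + eMul E (formInvol U φ) (D.app U (eTmul E 1 e))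
  type10 : ∀ (U : Opens X) (r : ℤ) (e : (E.X r).Sec U), D.app U (eTmul E 1 e) ∈ eBi E U 1 0 r

/-- `∇(f) = [D - ∂̄, f]`, for `f` of degree `i`. -/
def nabla (D : EndE E) (i : ℤ) (f : EndE E) : EndE E :=
  (D - eDelbar) * f - sgn i • (f * (D - eDelbar))

/-- The Atiyah cocycle `u = [D, ∂̄ + δ]`. -/
def atiyah (D : EndE E) : EndE E := D * (eDelbar + eDelta) + (eDelbar + eDelta) * D

/-- The form `τ` is the trace of `h`, for `E` concentrated in degrees `[p, q]`: for all local
frames `ε l` of `E^l`, if `h(ε l i)` has `E^l`-component `∑ j, c l i j · ε l j`, then `τ` is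
`∑ l, (-1)^l ∑ i, c l i i`. -/
def IsTrace (p q : ℤ) (h : EndE E) (τ : GForms H X) : Prop :=
  ∀ (V : Opens X) (m : ℤ → ℕ) (ε : ∀ l, Fin (m l) → (E.X l).Sec V),
    (∀ l, IsFrame (E.X l) V (ε l)) →
    ∃ c : ∀ l, Fin (m l) → Fin (m l) → Forms H V,
      (∀ l i, h.app V (eTmul E 1 (ε l i)) l = ∑ j, eTmul E (c l i j) (ε l j) l) ∧
      formRes le_top τ = ∑ l ∈ Finset.Icc p q, sgn l • ∑ i, c l i i

end Conn

end Semireg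
end

open Semireg

noncomputable section
set_option linter.unusedSimpArgs false
namespace Semireg

section FlatSq
variable {H : Type} [NormedAddCommGroup H] [NormedSpace ℂ H] [FiniteDimensional ℂ H]

/-- Polarised form of `sum_ι_mul_ι_eq_zero`. -/
lemma sum_ι_mul_ι_polar {ι' : Type*} [Fintype ι'] (e : Module.Basis ι' ℂ (Covec H))
    (m : ι' → Covec H) (hm : ∀ a b, ∑ j, m j a * e j b = ∑ j, m j b * e j a)
    (P Q : Covec H →ₗ[ℂ] Covec H) :
    ∑ j, (ExteriorAlgebra.ι ℂ (P (m j)) * ExteriorAlgebra.ι ℂ (Q (e j)) +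
      ExteriorAlgebra.ι ℂ (Q (m j)) * ExteriorAlgebra.ι ℂ (P (e j))) = 0 := by
  have key : ∀ R : Covec H →ₗ[ℂ] Covec H,
      ∑ j, ExteriorAlgebra.ι ℂ (R (m j)) * ExteriorAlgebra.ι ℂ (R (e j)) = 0 := by
    intro R
    have h := congrArg (ExteriorAlgebra.map R) (sum_ι_mul_ι_eq_zero e m hm)
    simpa only [map_sum, map_mul, ExteriorAlgebra.map_apply_ι, map_zero] using h
  have h := key (P + Q)
  simp only [LinearMap.add_apply, map_add, add_mul, mul_add, Finset.sum_add_distrib, key P,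
    key Q] at h
  rw [Finset.sum_add_distrib, ← h]
  abel

/-- The operators `∑ P(d f_s) ∧ b_s` anticommute. -/
lemma lamD_lamD {P Q : Covec H →ₗ[ℂ] Covec H} {η : H → Lam H} {y : H} (h : LSmooth η y) :
    lamD P (lamD Q η) y + lamD Q (lamD P η) y = 0 := by
  let e := Module.finBasis ℂ (Covec H)
  let Λ : Fin (Module.finrank ℂ (Covec H)) → (H →L[ℝ] ℂ) →ₗ[ℝ] ℂ := fun j =>
    { toFun := fun l => e.repr (l : H →ₗ[ℝ] ℂ) j
      map_add' := by intro a b; simp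
      map_smul' := by
        intro c a
        have : ((c • a : H →L[ℝ] ℂ) : H →ₗ[ℝ] ℂ) = (c : ℂ) • (a : H →ₗ[ℝ] ℂ) := by
          ext v; simp
        rw [this, map_smul]
        simp }
  have hd : ∀ s j, HasFDerivAt (fun z => e.repr (dfun (coef η s) z) j)
      ((LinearMap.toContinuousLinearMap (Λ j)).comp
        (fderiv ℝ (fderiv ℝ (coef η s)) y)) y := fun s j =>
    ((LinearMap.toContinuousLinearMap (Λ j)).hasFDerivAt).comp y
      ((((h s).fderiv_right (m := ∞) (by simp)).differentiableAt (by simp)).hasFDerivAt)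
  have hP : ∀ P : Covec H →ₗ[ℂ] Covec H, lamD P η = fun z => ∑ s, ∑ j,
      e.repr (dfun (coef η s) z) j • (ExteriorAlgebra.ι ℂ (P (e j)) * lamBasis H s) := by
    intro P
    funext z
    unfold lamD
    refine Finset.sum_congr rfl fun s _ => ?_
    conv_lhs => rw [← e.sum_repr (dfun (coef η s) z)]
    simp only [map_sum, map_smul, Finset.sum_mul, smul_mul_assoc]
  have hPQ : ∀ P Q : Covec H →ₗ[ℂ] Covec H, lamD P (lamD Q η) y = ∑ s, (∑ j,
      ExteriorAlgebra.ι ℂ (P (dfun (fun z => e.repr (dfun (coef η s) z) j) y)) *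
        ExteriorAlgebra.ι ℂ (Q (e j))) * lamBasis H s := by
    intro P Q
    have hl : ∀ s j, LDiff (fun z => e.repr (dfun (coef η s) z) j •
        (ExteriorAlgebra.ι ℂ (Q (e j)) * lamBasis H s)) y :=
      fun s j => LDiff.smul_const (hd s j).differentiableAt _
    rw [hP Q, lamD_sum P _ fun s _ => LDiff.sum _ fun j _ => hl s j]
    refine Finset.sum_congr rfl fun s _ => ?_
    rw [lamD_sum P _ fun j _ => hl s j, Finset.sum_mul]
    refine Finset.sum_congr rfl fun j _ => ?_
    rw [lamD_smul_const P (hd s j).differentiableAt, mul_assoc]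
  rw [hPQ, hPQ, ← Finset.sum_add_distrib]
  refine Finset.sum_eq_zero fun s _ => ?_
  rw [← add_mul, ← Finset.sum_add_distrib]
  rw [sum_ι_mul_ι_polar e _ _ P Q, zero_mul]
  have hval : ∀ a b, ∑ j, dfun (fun z => e.repr (dfun (coef η s) z) j) y a * e j b =
      fderiv ℝ (fderiv ℝ (coef η s)) y a b := by
    intro a b
    have h1 : ∀ j, dfun (fun z => e.repr (dfun (coef η s) z) j) y a =
        e.repr ((fderiv ℝ (fderiv ℝ (coef η s)) y a : H →L[ℝ] ℂ) : H →ₗ[ℝ] ℂ) j := by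
      intro j
      exact congrArg (fun L : H →L[ℝ] ℂ => L a) (hd s j).fderiv
    simp only [h1]
    have := congrArg (fun k : Covec H => k b)
      (e.sum_repr ((fderiv ℝ (fderiv ℝ (coef η s)) y a : H →L[ℝ] ℂ) : H →ₗ[ℝ] ℂ))
    simp only [LinearMap.sum_apply, LinearMap.smul_apply, smul_eq_mul] at this
    exact this
  intro a b
  rw [hval, hval]
  exact ((h s).isSymmSndFDerivAt (by
    simp only [minSmoothness_of_isRCLikeNormedField]
    exact WithTop.coe_le_coe.mpr (le_top : (2 : ℕ∞) ≤ ⊤))) a b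

end FlatSq

section FormSq
variable {H : Type} [NormedAddCommGroup H] [NormedSpace ℂ H] [FiniteDimensional ℂ H]
  {X : Type} [TopologicalSpace X] [ChartedSpace H X] [IsManifold 𝓘(ℂ, H) ω X]

lemma rep_dP_eventuallyEq {P : Covec H →ₗ[ℂ] Covec H} (hP : P = proj10 ∨ P = proj01) {U : Opens X}
    {η : U → Lam H} (hη : IsSmoothForm η) (x : U) :
    rep (dP P η) x.1 =ᶠ[𝓝 (chartAt H x.1 x.1)] lamD P (rep η x.1) := by
  filter_upwards [eventually_pt x.2 (mem_chart_source H x.1)] with z hz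
  have := rep_dP hP hη hz.2 ((chartAt H x.1).map_target hz.1)
  rwa [(chartAt H x.1).right_inv hz.1] at this

lemma formD_formD {P Q : Covec H →ₗ[ℂ] Covec H} (hP : P = proj10 ∨ P = proj01)
    (hQ : Q = proj10 ∨ Q = proj01) {U : Opens X} (φ : Forms H U) :
    formD P hP U (formD Q hQ U φ) + formD Q hQ U (formD P hP U φ) = 0 := by
  ext1; funext x
  change lamD P (rep (dP Q φ.1) x.1) _ + lamD Q (rep (dP P φ.1) x.1) _ = 0
  rw [lamD_congr P (rep_dP_eventuallyEq hQ φ.2 x), lamD_congr Q (rep_dP_eventuallyEq hP φ.2 x)]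
  exact lamD_lamD (φ.2 x)

lemma formD_sq {P : Covec H →ₗ[ℂ] Covec H} (hP : P = proj10 ∨ P = proj01)
    {U : Opens X} (φ : Forms H U) : formD P hP U (formD P hP U φ) = 0 := by
  have h := formD_formD hP hP φ
  rw [← two_smul ℂ] at h
  exact (smul_eq_zero.mp h).resolve_left two_ne_zero

lemma delbar_delbar {U : Opens X} (φ : Forms H U) : delbar U (delbar U φ) = 0 := formD_sq _ φ

lemma del_delbar {U : Opens X} (φ : Forms H U) :
    del U (delbar U φ) + delbar U (del U φ) = 0 := formD_formD _ _ φ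

lemma deRham_deRham {U : Opens X} (φ : Forms H U) : deRham U (deRham U φ) = 0 := by
  have h1 : del U (del U φ) = 0 := formD_sq _ φ
  have h2 := delbar_delbar φ
  have h3 := del_delbar φ
  change del U (del U φ + delbar U φ) + delbar U (del U φ + delbar U φ) = 0
  rw [map_add, map_add, h1, h2, zero_add, add_zero, h3]

lemma formD_mul' {P : Covec H →ₗ[ℂ] Covec H} (hP : P = proj10 ∨ P = proj01) {U : Opens X}
    (a b : Forms H U) :
    formD P hP U (a * b) = formD P hP U a * b + formInvol U a * formD P hP U b := by
  ext1; funext x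
  exact formD_mul hP a b x

/-- The operator on forms induced by an operator on exterior covectors commuting with
holomorphic changes of coordinates. -/
def formMap (T : Lam H →ₗ[ℂ] Lam H) (hT : ∀ L x, T (pull L x) = pull L (T x)) (U : Opens X) :
    Forms H U →ₗ[ℂ] Forms H U where
  toFun η := ⟨fun x => T (η.1 x), by
    intro x
    refine ((η.2 x).linear T).congr (Eventually.of_forall fun y => ?_)
    change T (rep _ _ _) = _
    unfold rep
    split_ifs with h
    · rw [hT]
    · rw [map_zero]⟩
  map_add' := by intro a b; ext1; funext x; exact map_add _ _ _
  map_smul' := by intro c a; ext1; funext x; exact map_smul T c (a.1 x)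

end FormSq

section TypeDecomp
variable {H : Type} [NormedAddCommGroup H] [NormedSpace ℂ H]

/-- The algebra endomorphism of the exterior algebra scaling `(1,0)`-covectors by `s` and
`(0,1)`-covectors by `t`. -/
def scale (s t : ℂ) : Lam H →ₐ[ℂ] Lam H := ExteriorAlgebra.map (s • proj10 + t • proj01)

lemma scale_pull (s t : ℂ) (L : H →L[ℂ] H) (x : Lam H) :
    scale s t (pull L x) = pull L (scale s t x) := by
  have h : (scale s t).comp (pull L) = (pull L).comp (scale s t) := by
    refine ExteriorAlgebra.hom_ext ?_
    ext1 l
    change scale s t (pull L (ExteriorAlgebra.ι ℂ l)) = pull L (scale s t (ExteriorAlgebra.ι ℂ l))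
    rw [pull_ι, scale, ExteriorAlgebra.map_apply_ι, ExteriorAlgebra.map_apply_ι, pull_ι]
    simp only [LinearMap.add_apply, LinearMap.smul_apply, proj10_precomp, proj01_precomp, map_add,
      map_smul]
  exact DFunLike.congr_fun h x

lemma scale_of_mem (s t : ℂ) {a b : ℕ} {x : Lam H} (hx : x ∈ lamBi H a b) :
    scale s t x = (s ^ a * t ^ b) • x := by
  have h1 : ∀ (p : Submodule ℂ (Covec H)) (r : ℂ)
      (_ : ∀ l ∈ p, (s • proj10 + t • proj01 : Covec H →ₗ[ℂ] Covec H) l = r • l) (n : ℕ) (x : Lam H),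
      x ∈ p.map (ExteriorAlgebra.ι ℂ) ^ n → scale s t x = r ^ n • x := by
    intro p r hp n
    induction n with
    | zero =>
      intro x hx
      rw [pow_zero, Submodule.mem_one] at hx
      obtain ⟨c, rfl⟩ := hx
      simp
    | succ n ih =>
      intro x hx
      rw [pow_succ] at hx
      induction hx using Submodule.mul_induction_on' with
      | mem_mul_mem m hm n' hn' =>
        obtain ⟨l, hl, rfl⟩ := hn'
        rw [map_mul, ih m hm, scale, ExteriorAlgebra.map_apply_ι, hp l hl, map_smul, pow_succ,
          smul_mul_smul_comm]
      | add a _ b _ ha hb => rw [map_add, ha, hb, smul_add]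
  have h10 := h1 (cov10 H) s fun l hl => by simp [proj10_of_mem10 hl, proj01_of_mem10 hl]
  have h01 := h1 (cov01 H) t fun l hl => by simp [proj10_of_mem01 hl, proj01_of_mem01 hl]
  induction hx using Submodule.mul_induction_on' with
  | mem_mul_mem m hm n hn => rw [map_mul, h10 _ _ hm, h01 _ _ hn, smul_mul_smul_comm]
  | add a _ b _ ha hb => rw [map_add, ha, hb, smul_add]

variable (H) in
lemma iSup_lamBi : ⨆ p : ℕ × ℕ, lamBi H p.1 p.2 = ⊤ := by
  rw [eq_top_iff]
  rintro x -
  have hle : ∀ a b, lamBi H a b ≤ ⨆ p : ℕ × ℕ, lamBi H p.1 p.2 :=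
    fun a b => le_iSup (fun p : ℕ × ℕ => lamBi H p.1 p.2) (a, b)
  induction x using ExteriorAlgebra.induction with
  | algebraMap r => exact hle 0 0 (algebraMap_mem_lamBi r)
  | ι l =>
    rw [← proj10_add_proj01 l, map_add]
    exact Submodule.add_mem _ (hle 1 0 (ι_mem_lamBi10 (proj10_mem l)))
      (hle 0 1 (ι_mem_lamBi01 (proj01_mem l)))
  | mul x y hx hy =>
    have h : (⨆ p : ℕ × ℕ, lamBi H p.1 p.2) * (⨆ p : ℕ × ℕ, lamBi H p.1 p.2) ≤
        ⨆ p : ℕ × ℕ, lamBi H p.1 p.2 := by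
      rw [Submodule.iSup_mul]
      refine iSup_le fun p => ?_
      rw [Submodule.mul_iSup]
      refine iSup_le fun p' => ?_
      rw [lamBi_mul]
      exact hle _ _
    exact h (Submodule.mul_mem_mul hx hy)
  | add x y hx hy => exact Submodule.add_mem _ hx hy

lemma two_pow_mul_three_pow_injective :
    Function.Injective fun p : ℕ × ℕ => (2 ^ p.1 * 3 ^ p.2 : ℂ) := by
  rintro ⟨a, b⟩ ⟨c, d⟩ h
  have h' : 2 ^ a * 3 ^ b = 2 ^ c * 3 ^ d := by
    have : ((2 ^ a * 3 ^ b : ℕ) : ℂ) = (2 ^ c * 3 ^ d : ℕ) := by push_cast; exact h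
    exact_mod_cast this
  have h2 := congrArg (fun n => n.factorization 2) h'
  have h3 := congrArg (fun n => n.factorization 3) h'
  have e : ∀ n, ((3 : ℕ) ^ n).factorization 2 = 0 := fun n => by
    rw [Nat.Prime.factorization_pow Nat.prime_three]; simp
  have e' : ∀ n, ((2 : ℕ) ^ n).factorization 3 = 0 := fun n => by
    rw [Nat.Prime.factorization_pow Nat.prime_two]; simp
  simp only [Nat.factorization_mul (pow_ne_zero _ two_ne_zero) (pow_ne_zero _ three_ne_zero),
    Finsupp.add_apply, e, e', Nat.factorization_pow_self Nat.prime_two,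
    Nat.factorization_pow_self Nat.prime_three, add_zero, zero_add] at h2 h3
  rw [h2, h3]

variable (H) in
lemma iSupIndep_lamBi : iSupIndep fun p : ℕ × ℕ => lamBi H p.1 p.2 := by
  refine ((Module.End.eigenspaces_iSupIndep (scale (H := H) 2 3).toLinearMap).comp
    two_pow_mul_three_pow_injective).mono fun p x hx => ?_
  exact Module.End.mem_eigenspace_iff.mpr (scale_of_mem 2 3 hx)

variable (H) in
lemma lamBi_isInternal : DirectSum.IsInternal fun p : ℕ × ℕ => lamBi H p.1 p.2 :=
  (DirectSum.isInternal_submodule_iff_iSupIndep_and_iSup_eq_top _).mpr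
    ⟨iSupIndep_lamBi H, iSup_lamBi H⟩

variable [FiniteDimensional ℂ H]

variable (H) in
/-- The projections to the components of type `(a,b)`. -/
lemma exists_lamProj : ∃ π : ℕ × ℕ → Lam H →ₗ[ℂ] Lam H, (∀ p x, π p x ∈ lamBi H p.1 p.2) ∧
    (∀ p L x, π p (pull L x) = pull L (π p x)) ∧
    ∃ F : Finset (ℕ × ℕ), ∀ x, ∑ p ∈ F, π p x = x := by
  classical
  let D := (lamBi_isInternal H).chooseDecomposition
  have hfin : FiniteDimensional ℂ (Lam H) := .of_basis (lamBasis H)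
  let π : ℕ × ℕ → Lam H →ₗ[ℂ] Lam H := fun p =>
    (lamBi H p.1 p.2).subtype ∘ₗ DirectSum.component ℂ _ _ p ∘ₗ
      (DirectSum.decomposeLinearEquiv fun p : ℕ × ℕ => lamBi H p.1 p.2).toLinearMap
  have hπ : ∀ p x, π p x = (DirectSum.decompose (fun p : ℕ × ℕ => lamBi H p.1 p.2) x p : Lam H) :=
    fun _ _ => rfl
  have hsame : ∀ p x, x ∈ lamBi H p.1 p.2 → π p x = x := fun p x hx => by
    rw [hπ]; exact DirectSum.decompose_of_mem_same _ hx
  have hne : ∀ p q x, x ∈ lamBi H p.1 p.2 → p ≠ q → π q x = 0 := fun p q x hx h => by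
    rw [hπ]; exact DirectSum.decompose_of_mem_ne _ hx h
  have hind : ∀ {T S : Lam H →ₗ[ℂ] Lam H},
      (∀ p : ℕ × ℕ, ∀ x ∈ lamBi H p.1 p.2, T x = S x) → ∀ x, T x = S x := by
    intro T S h x
    have hx : x ∈ ⨆ p : ℕ × ℕ, lamBi H p.1 p.2 := by rw [iSup_lamBi]; trivial
    have hle : ⨆ p : ℕ × ℕ, lamBi H p.1 p.2 ≤ LinearMap.eqLocus T S :=
      iSup_le fun p x hx => h p x hx
    exact hle hx
  refine ⟨π, fun p x => (DirectSum.decompose (fun p : ℕ × ℕ => lamBi H p.1 p.2) x p).2, ?_, ?_⟩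
  · intro p L
    refine hind (T := π p ∘ₗ (pull L).toLinearMap) (S := (pull L).toLinearMap ∘ₗ π p)
      fun q x hx => ?_
    change π p (pull L x) = pull L (π p x)
    by_cases h : q = p
    · subst h
      rw [hsame _ _ (pull_mem_lamBi L hx), hsame _ _ hx]
    · rw [hne _ _ _ (pull_mem_lamBi L hx) h, hne _ _ _ hx h, map_zero]
  · have hF := WellFoundedGT.finite_ne_bot_of_iSupIndep (iSupIndep_lamBi H)
    refine ⟨hF.toFinset, ?_⟩
    have h := hind (T := ∑ p ∈ hF.toFinset, π p) (S := LinearMap.id) ?_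
    · intro x
      simpa only [LinearMap.sum_apply, LinearMap.id_apply] using h x
    · intro q x hx
      rw [LinearMap.sum_apply, LinearMap.id_apply]
      by_cases h0 : lamBi H q.1 q.2 = ⊥
      · have : x = 0 := by rw [h0] at hx; exact hx
        subst this; simp
      · rw [Finset.sum_eq_single q (fun p _ hp => hne _ _ _ hx hp.symm)
          (fun h => absurd ((Set.Finite.mem_toFinset hF).mpr h0) h), hsame _ _ hx]

end TypeDecomp

section Quot
variable {H : Type} [NormedAddCommGroup H] [NormedSpace ℂ H] [FiniteDimensional ℂ H]
  {X : Type} [TopologicalSpace X] [ChartedSpace H X] [IsManifold 𝓘(ℂ, H) ω X]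

variable (H) in
lemma iSup_formsType (U : Opens X) : ⨆ p : ℕ × ℕ, formsType H U p.1 p.2 = ⊤ := by
  rw [eq_top_iff]
  rintro φ -
  obtain ⟨π, h1, h2, F, hF⟩ := exists_lamProj H
  have : φ = ∑ p ∈ F, formMap (π p) (h2 p) U φ := by
    ext1; funext x
    have hs : ∀ G : Finset (ℕ × ℕ), (∑ p ∈ G, formMap (π p) (h2 p) U φ).1 x =
        ∑ p ∈ G, π p (φ.1 x) := by
      classical
      intro G
      induction G using Finset.induction_on with
      | empty => rfl
      | insert a G ha ih => rw [Finset.sum_insert ha, Finset.sum_insert ha, ← ih]; rfl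
    rw [hs, hF]
  rw [this]
  refine Submodule.sum_mem _ fun p _ => Submodule.mem_iSup_of_mem p fun x => h1 p _

variable (H X)

lemma iSup_formsDeg : ⨆ k : ℤ, formsDeg H X k = ⊤ := by
  rw [eq_top_iff, ← iSup_formsType H (⊤ : Opens X)]
  refine iSup_le fun p => le_trans ?_ (le_iSup _ ((p.1 : ℤ) + p.2))
  exact fun φ hφ => Submodule.mem_iSup_of_mem p.1 (Submodule.mem_iSup_of_mem p.2
    (Submodule.mem_iSup_of_mem rfl hφ))

/-- The operator on `A^{*,*}_X` which is `2^k` on forms of degree `k`. -/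
def degScale : GForms H X →ₗ[ℂ] GForms H X := formMap (scale 2 2).toLinearMap (scale_pull 2 2) ⊤

variable {H X}

lemma degScale_of_mem {a b : ℕ} {φ : GForms H X} (h : φ ∈ formsType H ⊤ a b) :
    degScale H X φ = ((2 : ℂ) ^ ((a : ℤ) + b)) • φ := by
  ext1; funext x
  change scale 2 2 (φ.1 x) = ((2 : ℂ) ^ ((a : ℤ) + b)) • φ.1 x
  rw [scale_of_mem 2 2 (h x), zpow_add₀ two_ne_zero]
  norm_cast

lemma degScale_F2 : formsF2 H X ≤ (formsF2 H X).comap (degScale H X) :=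
  iSup₂_le fun a ha => iSup_le fun b φ hφ => by
    rw [Submodule.mem_comap, degScale_of_mem hφ]
    exact Submodule.smul_mem _ _ (Submodule.mem_iSup_of_mem a (Submodule.mem_iSup_of_mem ha
      (Submodule.mem_iSup_of_mem b hφ)))

lemma deRham_mem {k : ℤ} {φ : GForms H X} (h : φ ∈ formsDeg H X k) :
    deRham ⊤ φ ∈ formsDeg H X (k + 1) := by
  have hle : formsDeg H X k ≤ (formsDeg H X (k + 1)).comap (deRham ⊤) := by
    refine iSup_le fun a => iSup_le fun b => iSup_le fun hab ψ hψ => ?_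
    change del ⊤ ψ + delbar ⊤ ψ ∈ formsDeg H X (k + 1)
    refine Submodule.add_mem _ ?_ ?_
    · exact Submodule.mem_iSup_of_mem (a + 1) (Submodule.mem_iSup_of_mem b
        (Submodule.mem_iSup_of_mem (by push_cast; rw [← hab]; ring) (del_mem hψ)))
    · exact Submodule.mem_iSup_of_mem a (Submodule.mem_iSup_of_mem (b + 1)
        (Submodule.mem_iSup_of_mem (by push_cast; rw [← hab]; ring) (delbar_mem hψ)))
  exact hle h

lemma drDeg_isInternal : DirectSum.IsInternal (drDeg H X) := by
  refine (DirectSum.isInternal_submodule_iff_iSupIndep_and_iSup_eq_top _).mpr ⟨?_, ?_⟩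
  · have hinj : Function.Injective fun i : ℤ => (2 : ℂ) ^ (i + 2) := by
      intro i j h
      have h' : (2 : ℝ) ^ (i + 2) = (2 : ℝ) ^ (j + 2) := by
        have h2 : (2 : ℂ) ^ (i + 2) = (2 : ℂ) ^ (j + 2) := h
        have := congrArg norm h2
        simpa only [norm_zpow, Complex.norm_ofNat] using this
      have := zpow_right_injective₀ (by norm_num : (0 : ℝ) < 2) (by norm_num) h'
      linarith
    refine ((Module.End.eigenspaces_iSupIndep
      ((formsF2 H X).mapQ (formsF2 H X) (degScale H X) degScale_F2)).comp hinj).mono ?_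
    rintro i _ ⟨φ, hφ, rfl⟩
    refine Module.End.mem_eigenspace_iff.mpr ?_
    rw [Submodule.mkQ_apply, Submodule.mapQ_apply, ← Submodule.Quotient.mk_smul]
    congr 1
    have hle : formsDeg H X (i + 2) ≤
        LinearMap.eqLocus (degScale H X) (((2 : ℂ) ^ (i + 2)) • LinearMap.id) :=
      iSup_le fun a => iSup_le fun b => iSup_le fun hab ψ hψ => by
        rw [LinearMap.mem_eqLocus, degScale_of_mem hψ, hab]; rfl
    exact hle hφ
  · change ⨆ i : ℤ, (formsDeg H X (i + 2)).map (formsF2 H X).mkQ = ⊤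
    have h : ⨆ i : ℤ, formsDeg H X (i + 2) = ⨆ i : ℤ, formsDeg H X i :=
      (Equiv.addRight (2 : ℤ)).surjective.iSup_comp (formsDeg H X)
    rw [← Submodule.map_iSup, h, iSup_formsDeg, Submodule.map_top, Submodule.range_mkQ]

lemma drD_isDGLie : IsDGLie (drDeg H X) (drD H X) 0 where
  internal := drDeg_isInternal
  d_mem := by
    rintro i _ ⟨φ, hφ, rfl⟩
    refine ⟨deRham ⊤ φ, ?_, rfl⟩
    rw [add_right_comm]
    exact deRham_mem hφ
  br_mem _ _ _ _ _ _ := Submodule.zero_mem _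
  d_d := by
    intro x
    obtain ⟨φ, rfl⟩ := Submodule.mkQ_surjective _ x
    change (formsF2 H X).mkQ (deRham ⊤ (deRham ⊤ φ)) = 0
    rw [deRham_deRham, map_zero]
  skew i j x _ y _ := by simp
  jacobi i j x _ y _ z := by simp
  leibniz i x _ y := by simp

end Quot

section Frames
variable {H : Type} [NormedAddCommGroup H] [NormedSpace ℂ H] [FiniteDimensional ℂ H]
  {X : Type} [TopologicalSpace X] [ChartedSpace H X] [IsManifold 𝓘(ℂ, H) ω X]

lemma isSmoothForm_of_local {U : Opens X} {η : U → Lam H}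
    (h : ∀ x : U, ∃ (W : Opens X) (hW : W ≤ U) (_ : x.1 ∈ W) (φ : Forms H W),
      ∀ y (hy : y ∈ W), η ⟨y, hW hy⟩ = φ.1 ⟨y, hy⟩) : IsSmoothForm η := by
  intro x
  obtain ⟨W, hW, hx, φ, hφ⟩ := h x
  have e : φ.1 = fun z : W => η ⟨z.1, hW z.2⟩ := funext fun z => (hφ z.1 z.2).symm
  have h1 := φ.2 ⟨x.1, hx⟩
  rw [e] at h1
  exact h1.congr (rep_restrict hW η ⟨x.1, hx⟩)

lemma tGerm_eq {M : HolMod H X} {V W : Opens X} {x : X} (hV : x ∈ V) (hW : x ∈ W) {s : TP M V}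
    {t : TP M W} (h : tGerm M hV s = tGerm M hW t) :
    ∃ (O : Opens X) (_ : x ∈ O) (h1 : O ≤ V) (h2 : O ≤ W), tRes M h1 s = tRes M h2 t := by
  obtain ⟨O, hO, i, j, e⟩ := TopCat.Presheaf.germ_eq (tPre M) (x : TopCat.of X) hV hW s t h
  exact ⟨O, hO, leOfHom i, leOfHom j, e⟩

variable {M : HolMod H X} {V : Opens X} {m : ℕ} {ε : Fin m → M.Sec V}

lemma IsFrame.res (hε : IsFrame M V ε) {W : Opens X} (h : W ≤ V) :
    IsFrame M W fun i => M.res h (ε i) := by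
  intro W' h'
  simp only [M.res_res]
  exact hε W' (h'.trans h)

/-- The basis of the module of sections defined by a frame. -/
def IsFrame.basis (hε : IsFrame M V ε) : Module.Basis (Fin m) (Hol H V) (M.Sec V) :=
  Module.Basis.mk (v := ε)
    (by have := (hε V le_rfl).1; simpa only [M.res_self] using this)
    (by have := (hε V le_rfl).2; simp only [M.res_self] at this; exact this.ge)

lemma IsFrame.basis_apply (hε : IsFrame M V ε) (i : Fin m) : hε.basis i = ε i :=
  Module.Basis.mk_apply _ _ _

/-- Coordinates in `A^{*,*}(V) ⊗ M(V)` with respect to a frame. -/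
def IsFrame.tCoord (hε : IsFrame M V ε) : TP M V →ₗ[ℂ] (Fin m → Forms H V) where
  toFun t := TensorProduct.equivFinsuppOfBasisRight hε.basis t
  map_add' a b := congrArg DFunLike.coe
    (LinearEquiv.map_add (TensorProduct.equivFinsuppOfBasisRight hε.basis) a b)
  map_smul' c a := by
    have h := LinearEquiv.map_smul (TensorProduct.equivFinsuppOfBasisRight hε.basis)
      (algebraMap ℂ (Hol H V) c) a
    rw [algebraMap_smul, algebraMap_smul] at h
    exact congrArg DFunLike.coe h

/-- The element `∑ c_j ⊗ ε_j`. -/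
def tSum (ε : Fin m → M.Sec V) (c : Fin m → Forms H V) : TP M V := ∑ j, c j ⊗ₜ ε j

lemma IsFrame.tCoord_tmul (hε : IsFrame M V ε) (φ : Forms H V) (e : M.Sec V) (j : Fin m) :
    hε.tCoord (φ ⊗ₜ e) j = hε.basis.repr e j • φ :=
  TensorProduct.equivFinsuppOfBasisRight_apply_tmul_apply _ _ _ _

lemma IsFrame.tSum_tCoord (hε : IsFrame M V ε) (t : TP M V) : tSum ε (hε.tCoord t) = t := by
  have h := (TensorProduct.equivFinsuppOfBasisRight (M := Forms H V) hε.basis).symm_apply_apply t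
  conv_rhs => rw [← h]
  rw [TensorProduct.equivFinsuppOfBasisRight_symm_apply, Finsupp.sum_fintype _ _
    (fun i => TensorProduct.zero_tmul _ _)]
  simp only [hε.basis_apply]
  rfl

lemma IsFrame.tCoord_tSum (hε : IsFrame M V ε) (c : Fin m → Forms H V) (j : Fin m) :
    hε.tCoord (tSum ε c) j = c j := by
  unfold tSum
  rw [map_sum, Finset.sum_apply, Finset.sum_eq_single j]
  · rw [hε.tCoord_tmul, ← hε.basis_apply j, Module.Basis.repr_self, Finsupp.single_eq_same,
      one_smul]
  · intro i _ hij
    rw [hε.tCoord_tmul, ← hε.basis_apply i, Module.Basis.repr_self, Finsupp.single_eq_of_ne hij.symm,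
      zero_smul]
  · simp

lemma tRes_tSum {W : Opens X} (h : W ≤ V) (c : Fin m → Forms H V) :
    tRes M h (tSum ε c) = tSum (fun i => M.res h (ε i)) fun i => formRes h (c i) := by
  unfold tSum
  rw [map_sum]
  simp only [tRes_tmul]

/-- The section `∑ c_j ε_j`. -/
def frameMap (ε : Fin m → M.Sec V) : (Fin m → Forms H V) →ₗ[ℂ] ASec M V where
  toFun c := aOf M V (tSum ε c)
  map_add' c d := by
    rw [← map_add]
    congr 1
    unfold tSum
    rw [← Finset.sum_add_distrib]
    exact Finset.sum_congr rfl fun j _ => TensorProduct.add_tmul _ _ _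
  map_smul' a c := by
    rw [RingHom.id_apply, ← map_smul]
    congr 1
    unfold tSum
    rw [Finset.smul_sum]
    rfl

lemma IsFrame.frameMap_injective (hε : IsFrame M V ε) : Function.Injective (frameMap ε) := by
  rw [← LinearMap.ker_eq_bot, LinearMap.ker_eq_bot']
  intro c hc
  funext j
  ext1; funext x
  have h1 : tGerm M x.2 (tSum ε c) = tGerm M x.2 (0 : TP M V) := by
    rw [map_zero]
    exact congrArg (fun s : ASec M V => s.1 x) hc
  obtain ⟨O, hO, i, i', e⟩ := tGerm_eq _ _ h1
  rw [map_zero, tRes_tSum] at e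
  have h2 := (hε.res i).tCoord_tSum (fun k => formRes i (c k)) j
  rw [e, map_zero] at h2
  exact (congrArg (fun φ : Forms H O => φ.1 ⟨x.1, hO⟩) h2).symm

lemma IsFrame.frameMap_surjective (hε : IsFrame M V ε) : Function.Surjective (frameMap ε) := by
  intro s
  have hs : ∀ x : V, ∃ (W : Opens X) (hW : W ≤ V) (_ : x.1 ∈ W) (t : Fin m → Forms H W),
      ∀ (y : X) (hy : y ∈ W), s.1 ⟨y, hW hy⟩ =
        tGerm M hy (tSum (fun i => M.res hW (ε i)) t) := by
    intro x
    obtain ⟨W, hW, hx, t, -, h⟩ := s.2 x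
    exact ⟨W, hW, hx, (hε.res hW).tCoord t, by simpa only [(hε.res hW).tSum_tCoord] using h⟩
  choose W hW hx t ht using hs
  have key : ∀ (x y : V) (hy : y.1 ∈ W x) (j : Fin m),
      (t y j).1 ⟨y.1, hx y⟩ = (t x j).1 ⟨y.1, hy⟩ := by
    intro x y hy j
    have h1 := (ht y y.1 (hx y)).symm.trans (ht x y.1 hy)
    obtain ⟨O, hO, i, i', e⟩ := tGerm_eq _ _ h1
    rw [tRes_tSum, tRes_tSum] at e
    simp only [M.res_res] at e
    have h2 := (hε.res (i.trans (hW y))).tCoord_tSum (fun k => formRes i (t y k)) j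
    have h3 := (hε.res (i.trans (hW y))).tCoord_tSum (fun k => formRes i' (t x k)) j
    rw [e, h3] at h2
    exact (congrArg (fun φ : Forms H O => φ.1 ⟨y.1, hO⟩) h2).symm
  let c : Fin m → Forms H V := fun j => ⟨fun x => (t x j).1 ⟨x.1, hx x⟩,
    isSmoothForm_of_local fun x => ⟨W x, hW x, hx x, t x j, fun y hy => key x ⟨y, hW x hy⟩ hy j⟩⟩
  refine ⟨c, ?_⟩
  ext1; funext x
  rw [ht x x.1 (hx x)]
  change tGerm M x.2 (tSum ε c) = _
  rw [← tGerm_res M (hW x) (hx x), tRes_tSum]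
  congr 2
  funext j
  ext1; funext y
  exact key x ⟨y.1, hW x y.2⟩ y.2 j

/-- Coordinates of sections of `A^{*,*}_X(M)` with respect to a frame. -/
def IsFrame.coord (hε : IsFrame M V ε) : ASec M V ≃ₗ[ℂ] (Fin m → Forms H V) :=
  (LinearEquiv.ofBijective (frameMap ε) ⟨hε.frameMap_injective, hε.frameMap_surjective⟩).symm

lemma IsFrame.coord_frameMap (hε : IsFrame M V ε) (c : Fin m → Forms H V) :
    hε.coord (frameMap ε c) = c :=
  (LinearEquiv.ofBijective (frameMap ε)
    ⟨hε.frameMap_injective, hε.frameMap_surjective⟩).symm_apply_apply c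

lemma IsFrame.frameMap_coord (hε : IsFrame M V ε) (s : ASec M V) :
    frameMap ε (hε.coord s) = s :=
  (LinearEquiv.ofBijective (frameMap ε)
    ⟨hε.frameMap_injective, hε.frameMap_surjective⟩).apply_symm_apply s

lemma IsFrame.coord_aOf (hε : IsFrame M V ε) (t : TP M V) (j : Fin m) :
    hε.coord (aOf M V t) j = hε.tCoord t j := by
  have : aOf M V t = frameMap ε (hε.tCoord t) := by
    change _ = aOf M V (tSum ε (hε.tCoord t))
    rw [hε.tSum_tCoord]
  rw [this, hε.coord_frameMap]

lemma mulOp_frameMap (φ : Forms H V) (c : Fin m → Forms H V) :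
    (mulOp M φ).sec (frameMap ε c) = frameMap ε fun j => φ * c j := by
  change (mulOp M φ).sec (aOf M V (tSum ε c)) = aOf M V (tSum ε fun j => φ * c j)
  rw [LocalOp.sec_aOf]
  congr 1
  unfold tSum
  rw [map_sum]
  rfl

lemma IsFrame.coord_mulOp (hε : IsFrame M V ε) (φ : Forms H V) (s : ASec M V) (j : Fin m) :
    hε.coord ((mulOp M φ).sec s) j = φ * hε.coord s j := by
  conv_lhs => rw [← hε.frameMap_coord s, mulOp_frameMap, hε.coord_frameMap]

lemma aRes_aOf {W : Opens X} (h : W ≤ V) (t : TP M V) :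
    aRes M h (aOf M V t) = aOf M W (tRes M h t) := by
  ext1; funext x
  exact (tGerm_res M h x.2 t).symm

lemma aRes_frameMap {W : Opens X} (h : W ≤ V) (c : Fin m → Forms H V) :
    aRes M h (frameMap ε c) = frameMap (fun i => M.res h (ε i)) fun j => formRes h (c j) := by
  change aRes M h (aOf M V (tSum ε c)) = aOf M W _
  rw [aRes_aOf, tRes_tSum]

lemma IsFrame.coord_aRes (hε : IsFrame M V ε) {W : Opens X} (h : W ≤ V) (s : ASec M V)
    (j : Fin m) : (hε.res h).coord (aRes M h s) j = formRes h (hε.coord s j) := by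
  conv_lhs => rw [← hε.frameMap_coord s, aRes_frameMap, (hε.res h).coord_frameMap]

lemma IsFrame.coord_mem (hε : IsFrame M V ε) {a b : ℕ} {s : ASec M V} (hs : s ∈ AType M V a b)
    (j : Fin m) : hε.coord s j ∈ formsType H V a b := by
  intro x
  obtain ⟨W, hW, hx, t, ht, h⟩ := hs x
  have h1 : aRes M hW s = aOf M W t := by
    ext1; funext y
    exact h y.1 y.2
  have h2 := hε.coord_aRes hW s j
  rw [h1, (hε.res hW).coord_aOf] at h2
  have h3 : (hε.res hW).tCoord t j ∈ formsType H W a b := by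
    clear h h1 h2
    induction ht using Submodule.span_induction with
    | mem t ht =>
      obtain ⟨φ, hφ, e, rfl⟩ := ht
      rw [IsFrame.tCoord_tmul]
      intro y
      rw [hol_smul_apply]
      exact Submodule.smul_mem _ _ (hφ y)
    | zero => rw [map_zero]; exact Submodule.zero_mem _
    | add a b _ _ ha hb => rw [map_add]; exact Submodule.add_mem _ ha hb
    | smul c a _ ha => rw [map_smul]; exact Submodule.smul_mem _ _ ha
  have h4 := h3 ⟨x.1, hx⟩
  rw [h2] at h4
  exact h4

lemma IsFrame.coord_frame (hε : IsFrame M V ε) (i j : Fin m) :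
    hε.coord (aOf M V (1 ⊗ₜ ε i)) j = if i = j then 1 else 0 := by
  rw [hε.coord_aOf, hε.tCoord_tmul, ← hε.basis_apply i, Module.Basis.repr_self,
    Finsupp.single_apply]
  split_ifs
  · exact one_smul _ _
  · exact zero_smul _ _

lemma frameMap_eq_sum (c : Fin m → Forms H V) :
    frameMap ε c = ∑ j, (mulOp M (c j)).sec (aOf M V (1 ⊗ₜ ε j)) := by
  change aOf M V (tSum ε c) = _
  unfold tSum
  rw [map_sum]
  refine Finset.sum_congr rfl fun j _ => ?_
  rw [LocalOp.sec_aOf]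
  congr 1
  change _ = (formRes le_rfl (c j) * 1) ⊗ₜ[Hol H V] ε j
  rw [mul_one]; rfl

lemma aOf_one_mem (e : M.Sec V) : aOf M V (1 ⊗ₜ e) ∈ AType M V 0 0 := fun x =>
  ⟨V, le_rfl, x.2, 1 ⊗ₜ e, Submodule.subset_span ⟨1, fun _ => by
    have := algebraMap_mem_lamBi (H := H) 1
    rwa [map_one] at this, e, rfl⟩, fun _ _ => rfl⟩

end Frames

section Comm
variable {H : Type} [NormedAddCommGroup H] [NormedSpace ℂ H]

/-- Graded commutativity of the exterior algebra. -/
lemma lamBi_mul_comm {a b a' b' : ℕ} {x y : Lam H} (hx : x ∈ lamBi H a b)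
    (hy : y ∈ lamBi H a' b') : x * y = (-1 : ℂ) ^ ((a + b) * (a' + b')) • (y * x) := by
  have h1 : ∀ (p : Submodule ℂ (Covec H)) (n : ℕ) (x : Lam H),
      x ∈ p.map (ExteriorAlgebra.ι ℂ) ^ n →
        x * y = (-1 : ℂ) ^ (n * (a' + b')) • (y * x) := by
    intro p n
    induction n with
    | zero =>
      intro x hx
      rw [pow_zero, Submodule.mem_one] at hx
      obtain ⟨c, rfl⟩ := hx
      rw [Nat.zero_mul, pow_zero, one_smul, Algebra.commutes]
    | succ n ih =>
      intro x hx
      rw [pow_succ] at hx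
      induction hx using Submodule.mul_induction_on' with
      | mem_mul_mem m hm n' hn' =>
        obtain ⟨l, _, rfl⟩ := hn'
        rw [mul_assoc, ι_mul_eq, invol_of_mem hy, smul_mul_assoc, mul_smul_comm, ← mul_assoc,
          ih m hm, smul_mul_assoc, smul_smul, mul_assoc, add_mul n 1, one_mul,
          pow_add _ (n * (a' + b')), mul_comm]
      | add a _ b _ ha hb => rw [mul_add y, add_mul a b, ha, hb, smul_add]
  induction hx using Submodule.mul_induction_on' with
  | mem_mul_mem m hm n hn =>
    rw [mul_assoc, h1 _ _ n hn, mul_smul_comm, ← mul_assoc, h1 _ _ m hm, smul_mul_assoc, smul_smul,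
      mul_assoc, add_mul a b, pow_add _ (a * (a' + b')), mul_comm]
  | add a' _ b' _ ha hb => rw [mul_add y, add_mul, ha, hb, smul_add]

end Comm

section Trace
variable {H : Type} [NormedAddCommGroup H] [NormedSpace ℂ H] [FiniteDimensional ℂ H]
  {X : Type} [TopologicalSpace X] [ChartedSpace H X] [IsManifold 𝓘(ℂ, H) ω X]

lemma formsType_mul_comm {U : Opens X} {a b a' b' : ℕ} {φ ψ : Forms H U}
    (hφ : φ ∈ formsType H U a b) (hψ : ψ ∈ formsType H U a' b') :
    φ * ψ = sgn ((a + b) * (a' + b')) • (ψ * φ) := by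
  ext1; funext x
  change φ.1 x * ψ.1 x = sgn ((a + b) * (a' + b')) • (ψ.1 x * φ.1 x)
  rw [lamBi_mul_comm (hφ x) (hψ x), sgn]
  norm_cast

lemma formsType_zero_comm {U : Opens X} {φ : Forms H U} (hφ : φ ∈ formsType H U 0 0)
    (ψ : Forms H U) : φ * ψ = ψ * φ := by
  ext1; funext x
  have h := hφ x
  simp only [lamBi, pow_zero, mul_one, Submodule.mem_one] at h
  obtain ⟨c, hc⟩ := h
  change φ.1 x * ψ.1 x = ψ.1 x * φ.1 x
  rw [← hc, Algebra.commutes]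

section OneModule
variable {M : HolMod H X} {V : Opens X} {m : ℕ} {ε : Fin m → M.Sec V}

/-- The trace of an endomorphism with respect to a frame. -/
def IsFrame.trace (hε : IsFrame M V ε) (α : ASec M V →ₗ[ℂ] ASec M V) : Forms H V :=
  ∑ i, hε.coord (α (aOf M V (1 ⊗ₜ ε i))) i

lemma IsFrame.trace_eq (hε : IsFrame M V ε) {m' : ℕ} {ε' : Fin m' → M.Sec V}
    (hε' : IsFrame M V ε') {α : ASec M V →ₗ[ℂ] ASec M V}
    (hα : ∀ φ ∈ formsType H V 0 0, ∀ s, α ((mulOp M φ).sec s) = (mulOp M φ).sec (α s)) :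
    hε'.trace α = hε.trace α := by
  set P : Fin m' → Fin m → Forms H V := fun i j => hε.coord (aOf M V (1 ⊗ₜ ε' i)) j with hP
  set Q : Fin m → Fin m' → Forms H V := fun i j => hε'.coord (aOf M V (1 ⊗ₜ ε i)) j with hQ
  set A : Fin m → Fin m → Forms H V := fun i j => hε.coord (α (aOf M V (1 ⊗ₜ ε i))) j with hA
  have hP0 : ∀ i j, P i j ∈ formsType H V 0 0 := fun i j => hε.coord_mem (aOf_one_mem _) j
  have hQ0 : ∀ i j, Q i j ∈ formsType H V 0 0 := fun i j => hε'.coord_mem (aOf_one_mem _) j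
  have h1 : ∀ i, aOf M V (1 ⊗ₜ ε' i) = ∑ j, (mulOp M (P i j)).sec (aOf M V (1 ⊗ₜ ε j)) := by
    intro i
    rw [← frameMap_eq_sum, hε.frameMap_coord]
  have h2 : ∀ k, aOf M V (1 ⊗ₜ ε k) = ∑ i, (mulOp M (Q k i)).sec (aOf M V (1 ⊗ₜ ε' i)) := by
    intro i
    rw [← frameMap_eq_sum, hε'.frameMap_coord]
  have h3 : ∀ j, α (aOf M V (1 ⊗ₜ ε j)) = ∑ k, (mulOp M (A j k)).sec (aOf M V (1 ⊗ₜ ε k)) := by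
    intro i
    rw [← frameMap_eq_sum, hε.frameMap_coord]
  have hQP : ∀ k j, ∑ i, Q k i * P i j = if k = j then 1 else 0 := by
    intro k j
    rw [← hε.coord_frame k j]
    conv_rhs => rw [h2 k, map_sum, Finset.sum_apply]
    exact Finset.sum_congr rfl fun i _ => (hε.coord_mulOp _ _ _).symm
  have h4 : ∀ i, hε'.coord (α (aOf M V (1 ⊗ₜ ε' i))) i = ∑ j, ∑ k, A j k * (Q k i * P i j) := by
    intro i
    rw [h1 i, map_sum, map_sum, Finset.sum_apply]
    refine Finset.sum_congr rfl fun j _ => ?_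
    rw [hα _ (hP0 i j), hε'.coord_mulOp, h3 j, map_sum, Finset.sum_apply, Finset.mul_sum]
    refine Finset.sum_congr rfl fun k _ => ?_
    rw [hε'.coord_mulOp, formsType_zero_comm (hP0 i j), mul_assoc]
  unfold IsFrame.trace
  simp only [h4]
  rw [Finset.sum_comm]
  refine Finset.sum_congr rfl fun j _ => ?_
  rw [Finset.sum_comm]
  simp only [← Finset.mul_sum, hQP]
  simp [hA]

end OneModule

variable {E : CochainComplex (HolMod H X) ℤ}

variable (E) in
/-- Frames of all the sheaves `E^l` over an open subset. -/
structure EFrame (V : Opens X) where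
  /-- The ranks. -/
  rk : ℤ → ℕ
  /-- The sections. -/
  sec : ∀ l, Fin (rk l) → (E.X l).Sec V
  isFrame : ∀ l, IsFrame (E.X l) V (sec l)

/-- Restriction of frames. -/
def EFrame.res {V W : Opens X} (F : EFrame E V) (h : W ≤ V) : EFrame E W :=
  ⟨F.rk, fun l i => (E.X l).res h (F.sec l i), fun l => (F.isFrame l).res h⟩

/-- The sections of `A^{*,*}_X(E^*)` defined by a frame. -/
abbrev EFrame.e {V : Opens X} (F : EFrame E V) (l : ℤ) (i : Fin (F.rk l)) : ESec E V :=
  eTmul E 1 (F.sec l i)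

/-- Coordinates of a section of `A^{*,*}_X(E^*)` with respect to a frame. -/
def EFrame.xi {V : Opens X} (F : EFrame E V) (l : ℤ) (i : Fin (F.rk l)) :
    ESec E V →ₗ[ℂ] Forms H V :=
  LinearMap.proj i ∘ₗ (F.isFrame l).coord.toLinearMap ∘ₗ LinearMap.proj l

lemma EFrame.xi_apply {V : Opens X} (F : EFrame E V) (l : ℤ) (i : Fin (F.rk l)) (s : ESec E V) :
    F.xi l i s = (F.isFrame l).coord (s l) i := rfl

lemma EFrame.xi_eMul {V : Opens X} (F : EFrame E V) (l : ℤ) (i : Fin (F.rk l)) (φ : Forms H V)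
    (s : ESec E V) : F.xi l i (eMul E φ s) = φ * F.xi l i s :=
  (F.isFrame l).coord_mulOp φ (s l) i

lemma EFrame.xi_mem {V : Opens X} (F : EFrame E V) (l : ℤ) (i : Fin (F.rk l)) {a b : ℕ} {r : ℤ}
    {s : ESec E V} (hs : s ∈ eBi E V a b r) : F.xi l i s ∈ formsType H V a b := by
  by_cases h : l = r
  · subst h
    exact (F.isFrame l).coord_mem hs.1 i
  · rw [EFrame.xi_apply, hs.2 l h, map_zero]
    exact Submodule.zero_mem _

lemma EFrame.xi_eq_zero {V : Opens X} (F : EFrame E V) {l : ℤ} (i : Fin (F.rk l)) {a b : ℕ}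
    {r : ℤ} {s : ESec E V} (hs : s ∈ eBi E V a b r) (h : l ≠ r) : F.xi l i s = 0 := by
  rw [EFrame.xi_apply, hs.2 l h, map_zero]
  rfl

lemma EFrame.xi_e {V : Opens X} (F : EFrame E V) (l : ℤ) (i j : Fin (F.rk l)) :
    F.xi l j (F.e l i) = if i = j then 1 else 0 := by
  rw [EFrame.xi_apply]
  unfold EFrame.e eTmul
  rw [Pi.single_eq_same, (F.isFrame l).coord_frame]

lemma isZero_sec {M : HolMod H X} (h : Limits.IsZero M) (U : Opens X) (e : M.Sec U) : e = 0 := by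
  have h1 : HolMod.app (𝟙 M) U e = HolMod.app (0 : M ⟶ M) U e := by rw [h.eq_of_src (𝟙 M) 0]
  exact h1

lemma isZero_aSec {M : HolMod H X} (h : Limits.IsZero M) (U : Opens X) (s : ASec M U) : s = 0 := by
  ext1; funext x
  obtain ⟨V, hV, hx, t, ht⟩ := exists_germ s x
  rw [ht]
  have : t = 0 := by
    induction t using TensorProduct.induction_on with
    | zero => rfl
    | tmul φ e => rw [isZero_sec h V e, TensorProduct.tmul_zero]
    | add a b ha hb =>
      clear ht
      have : ∀ t : TP M V, t = 0 := fun t => by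
        induction t using TensorProduct.induction_on with
        | zero => rfl
        | tmul φ e => rw [isZero_sec h V e, TensorProduct.tmul_zero]
        | add a b ha hb => rw [ha, hb, add_zero]
      exact this _
  rw [this, map_zero]
  rfl

variable {p q : ℤ}

lemma EFrame.expand {V : Opens X} (F : EFrame E V) (hE : IsLocallyFree E p q) (s : ESec E V) :
    s = ∑ l ∈ Finset.Icc p q, ∑ i, eMul E (F.xi l i s) (F.e l i) := by
  funext r
  rw [Finset.sum_apply]
  by_cases hr : r ∈ Finset.Icc p q
  · rw [Finset.sum_eq_single r]
    · rw [Finset.sum_apply]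
      conv_lhs => rw [← (F.isFrame r).frameMap_coord (s r), frameMap_eq_sum]
      refine Finset.sum_congr rfl fun i _ => ?_
      change _ = (mulOp (E.X r) _).sec (F.e r i r)
      unfold EFrame.e eTmul
      rw [Pi.single_eq_same]
      rfl
    · intro l _ hl
      rw [Finset.sum_apply]
      refine Finset.sum_eq_zero fun i _ => ?_
      change (mulOp (E.X r) _).sec (F.e l i r) = 0
      unfold EFrame.e eTmul
      rw [Pi.single_eq_of_ne hl.symm, map_zero]
    · exact fun h => absurd hr h
  · have hz := hE.isZero r (by rw [Finset.mem_Icc] at hr; omega)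
    rw [isZero_aSec hz V (s r)]
    exact (isZero_aSec hz V _).symm

lemma exists_eFrame (hE : IsLocallyFree E p q) (x : X) :
    ∃ V : Opens X, x ∈ V ∧ Nonempty (EFrame E V) := by
  have h1 : ∀ F : Finset ℤ, ∃ V : Opens X, x ∈ V ∧
      ∀ l ∈ F, ∃ (m : ℕ) (ε : Fin m → (E.X l).Sec V), IsFrame (E.X l) V ε := by
    intro F
    induction F using Finset.induction_on with
    | empty => exact ⟨⊤, trivial, by simp⟩
    | insert a F ha ih =>
      obtain ⟨V, hV, h⟩ := ih
      obtain ⟨W, hW, m, ε, hε⟩ := hE.locFree a x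
      refine ⟨V ⊓ W, ⟨hV, hW⟩, fun l hl => ?_⟩
      rcases Finset.mem_insert.mp hl with rfl | hl
      · exact ⟨m, _, hε.res inf_le_right⟩
      · obtain ⟨m', ε', hε'⟩ := h l hl
        exact ⟨m', _, hε'.res inf_le_left⟩
  obtain ⟨V, hV, h⟩ := h1 (Finset.Icc p q)
  refine ⟨V, hV, ?_⟩
  have h2 : ∀ l, ∃ (m : ℕ) (ε : Fin m → (E.X l).Sec V), IsFrame (E.X l) V ε := by
    intro l
    by_cases hl : l ∈ Finset.Icc p q
    · exact h l hl
    · have hz := hE.isZero l (by rw [Finset.mem_Icc] at hl; omega)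
      refine ⟨0, Fin.elim0, fun W hW => ⟨linearIndependent_empty_type, ?_⟩⟩
      rw [eq_top_iff]
      intro e _
      rw [isZero_sec hz W e]
      exact Submodule.zero_mem _
  choose m ε hε using h2
  exact ⟨⟨m, ε, hε⟩⟩

variable (E) in
/-- Endomorphisms of `A^{*,*}_X(E^*)` which are linear over smooth functions. -/
def linEnd : Submodule ℂ (EndE E) where
  carrier := {f | ∀ (U : Opens X), ∀ φ ∈ formsType H U 0 0, ∀ s : ESec E U,
    f.app U (eMul E φ s) = eMul E φ (f.app U s)}
  add_mem' := by
    intro f g hf hg U φ hφ s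
    rw [EndE.add_app, EndE.add_app, hf U φ hφ, hg U φ hφ, map_add]
  zero_mem' := by
    intro U φ hφ s
    exact (map_zero (eMul E φ)).symm
  smul_mem' := by
    intro c f hf U φ hφ s
    rw [EndE.smul_app, EndE.smul_app, hf U φ hφ, map_smul]

lemma AHom_le_linEnd (a b : ℕ) (n : ℤ) : AHom E a b n ≤ linEnd E := by
  intro f hf U φ hφ s
  rw [hf.1 U 0 0 φ hφ s]
  simp [sgn]

/-- The trace with respect to a frame. -/
def EFrame.trace {V : Opens X} (F : EFrame E V) (p q : ℤ) : EndE E →ₗ[ℂ] Forms H V where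
  toFun f := ∑ l ∈ Finset.Icc p q, sgn l • ∑ i, F.xi l i (f.app V (F.e l i))
  map_add' f g := by
    rw [← Finset.sum_add_distrib]
    refine Finset.sum_congr rfl fun l _ => ?_
    rw [← smul_add, ← Finset.sum_add_distrib]
    simp only [EndE.add_app, map_add]
  map_smul' c f := by
    rw [RingHom.id_apply, Finset.smul_sum]
    refine Finset.sum_congr rfl fun l _ => ?_
    rw [smul_comm, Finset.smul_sum (r := c)]
    simp only [EndE.smul_app, map_smul]

lemma EFrame.trace_apply {V : Opens X} (F : EFrame E V) (f : EndE E) :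
    F.trace p q f = ∑ l ∈ Finset.Icc p q, sgn l • ∑ i, F.xi l i (f.app V (F.e l i)) := rfl

lemma EFrame.trace_eq {V : Opens X} (F F' : EFrame E V) {f : EndE E} (hf : f ∈ linEnd E) :
    F'.trace p q f = F.trace p q f := by
  rw [EFrame.trace_apply, EFrame.trace_apply]
  refine Finset.sum_congr rfl fun l _ => ?_
  congr 1
  let α : ASec (E.X l) V →ₗ[ℂ] ASec (E.X l) V :=
    LinearMap.proj l ∘ₗ f.app V ∘ₗ LinearMap.single ℂ (fun r => ASec (E.X r) V) l
  refine (F.isFrame l).trace_eq (F'.isFrame l) (α := α) fun φ hφ s => ?_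
  have h := congrFun (hf V φ hφ (Pi.single l s)) l
  have h2 : eMul E φ (Pi.single l s) = Pi.single l ((mulOp (E.X l) φ).sec s) := by
    funext r
    change (mulOp (E.X r) φ).sec ((Pi.single l s : ESec E V) r) = _
    by_cases hr : r = l
    · subst hr
      rw [Pi.single_eq_same, Pi.single_eq_same]
    · rw [Pi.single_eq_of_ne hr, Pi.single_eq_of_ne hr, map_zero]
  rw [h2] at h
  exact h

lemma EFrame.trace_res {V W : Opens X} (F : EFrame E V) (h : W ≤ V) (f : EndE E) :
    (F.res h).trace p q f = formRes h (F.trace p q f) := by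
  rw [EFrame.trace_apply, EFrame.trace_apply, map_sum]
  refine Finset.sum_congr rfl fun l _ => ?_
  rw [map_smul, map_sum]
  congr 1
  refine Finset.sum_congr rfl fun i _ => ?_
  have h1 : (F.res h).e l i = eRes E h (F.e l i) := by
    funext r
    change (eTmul E 1 _ : ESec E W) r = aRes (E.X r) h ((eTmul E 1 _ : ESec E V) r)
    unfold eTmul
    by_cases hr : r = l
    · subst hr
      rw [Pi.single_eq_same, Pi.single_eq_same, aRes_aOf, tRes_tmul, map_one]
      rfl
    · rw [Pi.single_eq_of_ne hr, Pi.single_eq_of_ne hr, map_zero]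
  rw [h1, ← f.app_res]
  exact (F.isFrame l).coord_aRes h _ i

lemma gForms_ext (hE : IsLocallyFree E p q) {σ τ : GForms H X}
    (h : ∀ (V : Opens X) (_ : EFrame E V), formRes (le_top : V ≤ ⊤) σ = formRes le_top τ) :
    σ = τ := by
  ext1; funext x
  obtain ⟨V, hV, ⟨F⟩⟩ := exists_eFrame hE x.1
  exact congrArg (fun φ : Forms H V => φ.1 ⟨x.1, hV⟩) (h V F)

lemma exists_trace (hE : IsLocallyFree E p q) : ∃ T : EndE E →ₗ[ℂ] GForms H X,
    ∀ f ∈ linEnd E, ∀ (V : Opens X) (F : EFrame E V),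
      formRes le_top (T f) = F.trace p q f := by
  choose V hV F using exists_eFrame hE
  let F := fun x => (F x).some
  have key : ∀ f ∈ linEnd E, ∀ (W : Opens X) (G : EFrame E W) (x : X) (hx : x ∈ W),
      (G.trace p q f).1 ⟨x, hx⟩ = ((F x).trace p q f).1 ⟨x, hV x⟩ := by
    intro f hf W G x hx
    have h1 := EFrame.trace_eq (p := p) (q := q) (G.res (inf_le_left : W ⊓ V x ≤ W))
      ((F x).res (inf_le_right : W ⊓ V x ≤ V x)) hf
    rw [EFrame.trace_res, EFrame.trace_res] at h1
    exact (congrArg (fun φ : Forms H (W ⊓ V x) => φ.1 ⟨x, hx, hV x⟩) h1).symm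
  let T : linEnd E →ₗ[ℂ] GForms H X :=
    { toFun := fun f => ⟨fun x => ((F x.1).trace p q f.1).1 ⟨x.1, hV x.1⟩,
        isSmoothForm_of_local fun x => ⟨V x.1, le_top, hV x.1, (F x.1).trace p q f.1,
          fun y hy => (key f.1 f.2 (V x.1) (F x.1) y hy).symm⟩⟩
      map_add' := by
        intro f g
        ext1; funext x
        change ((F x.1).trace p q (f.1 + g.1)).1 _ = _
        rw [map_add]
        rfl
      map_smul' := by
        intro c f
        ext1; funext x
        change ((F x.1).trace p q (c • f.1)).1 _ = _
        rw [map_smul]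
        rfl }
  obtain ⟨T', hT'⟩ := LinearMap.exists_extend T
  refine ⟨T', fun f hf W G => ?_⟩
  have h1 : T' f = T ⟨f, hf⟩ := LinearMap.congr_fun hT' ⟨f, hf⟩
  rw [h1]
  ext1; funext x
  exact (key f hf W G x.1 x.2).symm

/-- `T` computes traces of endomorphisms which are linear over smooth functions. -/
def IsTraceMap (p q : ℤ) (T : EndE E →ₗ[ℂ] GForms H X) : Prop :=
  ∀ f ∈ linEnd E, ∀ (V : Opens X) (F : EFrame E V), formRes le_top (T f) = F.trace p q f

lemma IsTraceMap.isTrace {T : EndE E →ₗ[ℂ] GForms H X} (hT : IsTraceMap p q T) {f : EndE E}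
    (hf : f ∈ linEnd E) : IsTrace p q f (T f) := by
  intro V m ε hε
  let F : EFrame E V := ⟨m, ε, hε⟩
  refine ⟨fun l i j => F.xi l j (f.app V (F.e l i)), fun l i => ?_, hT f hf V F⟩
  conv_lhs => rw [← (F.isFrame l).frameMap_coord (f.app V (eTmul E 1 (ε l i)) l)]
  change aOf _ V (tSum _ _) = _
  unfold tSum
  rw [map_sum]
  refine Finset.sum_congr rfl fun j _ => ?_
  unfold eTmul
  rw [Pi.single_eq_same]
  rfl

end Trace

section Ops
variable {H : Type} [NormedAddCommGroup H] [NormedSpace ℂ H] [FiniteDimensional ℂ H]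
  {X : Type} [TopologicalSpace X] [ChartedSpace H X] [IsManifold 𝓘(ℂ, H) ω X]
  {E : CochainComplex (HolMod H X) ℤ} {p q : ℤ}

lemma sgn_congr {k l : ℤ} (h : Even (k - l)) : sgn k = sgn l := by
  have : k = l + (k - l) := by ring
  rw [this, sgn_add]
  have h2 : sgn (k - l) = 1 := h.neg_one_zpow
  rw [h2, mul_one]

lemma formD_formInvol {P : Covec H →ₗ[ℂ] Covec H} (hP : P = proj10 ∨ P = proj01) {U : Opens X}
    (φ : Forms H U) : formD P hP U (formInvol U φ) = -formInvol U (formD P hP U φ) := by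
  have hle : ⨆ t : ℕ × ℕ, formsType H U t.1 t.2 ≤
      LinearMap.eqLocus (formD P hP U ∘ₗ (formInvol U).toLinearMap)
        (-((formInvol U).toLinearMap ∘ₗ formD P hP U)) := by
    refine iSup_le fun t ψ hψ => ?_
    change formD P hP U (formInvol U ψ) = -formInvol U (formD P hP U ψ)
    have h : formInvol U (formD P hP U ψ) = sgn (t.1 + t.2 + 1) • formD P hP U ψ := by
      rcases hP with rfl | rfl
      · have := formInvol_of_mem (del_mem hψ)
        refine this.trans ?_
        push_cast
        rw [add_right_comm]
        rfl
      · have := formInvol_of_mem (delbar_mem hψ)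
        refine this.trans ?_
        push_cast
        rw [← add_assoc]
        rfl
    rw [h, formInvol_of_mem hψ, map_smul, sgn_add (t.1 + t.2) 1, sgn_one, mul_neg_one, neg_smul,
      neg_neg]
  rw [iSup_formsType] at hle
  exact hle (Submodule.mem_top (x := φ))

lemma eSec_ext {U : Opens X} {s t : ESec E U}
    (h : ∀ x : U, ∃ (W : Opens X) (hW : W ≤ U), x.1 ∈ W ∧ eRes E hW s = eRes E hW t) : s = t := by
  funext r
  ext1; funext x
  obtain ⟨W, hW, hx, e⟩ := h x
  exact congrArg (fun z : ESec E W => (z r).1 ⟨x.1, hx⟩) e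

lemma eRes_eMul {U V : Opens X} (h : V ≤ U) (φ : Forms H U) (s : ESec E U) :
    eRes E h (eMul E φ s) = eMul E (formRes h φ) (eRes E h s) := by
  funext r
  exact LocalOp.aRes_sec _ _ h (fun _ _ _ => rfl) (s r)

lemma eMul_eMul {U : Opens X} (φ ψ : Forms H U) (s : ESec E U) :
    eMul E φ (eMul E ψ s) = eMul E (φ * ψ) s := by
  funext r
  ext1; funext x
  obtain ⟨V, hV, hx, t, ht⟩ := exists_germ (s r) x
  change (mulOp (E.X r) φ).stalk x.2 ((mulOp (E.X r) ψ).stalk x.2 ((s r).1 x)) =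
    (mulOp (E.X r) (φ * ψ)).stalk x.2 ((s r).1 x)
  rw [ht, LocalOp.stalk_germ _ hV hx, LocalOp.stalk_germ _ hV hx, LocalOp.stalk_germ _ hV hx]
  congr 1
  clear ht
  induction t using TensorProduct.induction_on with
  | zero => simp only [map_zero]
  | tmul η e =>
    change (formRes hV φ * (formRes hV ψ * η)) ⊗ₜ[Hol H V] e =
      (formRes hV (φ * ψ) * η) ⊗ₜ[Hol H V] e
    rw [map_mul, mul_assoc]
  | add a b ha hb => simp only [map_add, ha, hb]

lemma eTmul_one_mem {U : Opens X} {r : ℤ} (e : (E.X r).Sec U) : eTmul E 1 e ∈ eBi E U 0 0 r := by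
  refine ⟨?_, fun r' hr => ?_⟩
  · unfold eTmul
    rw [Pi.single_eq_same]
    exact aOf_one_mem e
  · unfold eTmul
    rw [Pi.single_eq_of_ne hr]

/-- An endomorphism maps `A^{a,b}_X(E^r)` to `A^{a',b'}_X(E^{r'})` if it does so on tensors. -/
lemma EndE.apply_mem {f : EndE E} {a b a' b' : ℕ} {r r' : ℤ}
    (hf : ∀ (V : Opens X), ∀ φ ∈ formsType H V a b, ∀ e : (E.X r).Sec V,
      f.app V (eMul E φ (eTmul E 1 e)) ∈ eBi E V a' b' r')
    {U : Opens X} {s : ESec E U} (hs : s ∈ eBi E U a b r) : f.app U s ∈ eBi E U a' b' r' := by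
  refine eBi_of_local fun x => ?_
  obtain ⟨V, hV, hx, t, ht, hst⟩ := hs.1 x
  refine ⟨V, hV, hx, ?_⟩
  have hres : eRes E hV s = eOf E V r t := by
    funext r'
    change aRes (E.X r') hV (s r') = Pi.single (M := fun r => ASec (E.X r) V) r _ r'
    by_cases h : r' = r
    · subst h
      rw [Pi.single_eq_same]
      ext1; funext y
      exact hst y.1 y.2
    · rw [Pi.single_eq_of_ne h, hs.2 r' h, map_zero]
  rw [f.app_res, hres]
  clear hst hres
  induction ht using Submodule.span_induction with
  | mem t ht =>
    obtain ⟨φ, hφ, e, rfl⟩ := ht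
    change f.app V (eTmul E φ e) ∈ _
    rw [eTmul_eq]
    exact hf V φ hφ e
  | zero => rw [map_zero, map_zero]; exact Submodule.zero_mem _
  | add a b _ _ ha hb => rw [map_add, map_add]; exact Submodule.add_mem _ ha hb
  | smul c a _ ha => rw [map_smul, map_smul]; exact Submodule.smul_mem _ _ ha

lemma eDelbar_eDelbar : (eDelbar : EndE E) * eDelbar = 0 := by
  refine EndE.hext fun U s => ?_
  funext r
  ext1; funext x
  obtain ⟨V, hV, hx, t, ht⟩ := exists_germ (s r) x
  change (delbarOp (E.X r) U).stalk x.2 ((delbarOp (E.X r) U).stalk x.2 ((s r).1 x)) = 0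
  rw [ht, LocalOp.stalk_germ _ hV hx, LocalOp.stalk_germ _ hV hx, ← map_zero (tGerm (E.X r) hx)]
  congr 1
  clear ht
  induction t using TensorProduct.induction_on with
  | zero => simp only [map_zero]
  | tmul η e =>
    change delbar V (delbar V η) ⊗ₜ[Hol H V] e = 0
    rw [delbar_delbar, TensorProduct.zero_tmul]
  | add a b ha hb => rw [map_add, map_add, ha, hb, add_zero]

lemma eDelta_eDelta : (eDelta : EndE E) * eDelta = 0 := by
  refine EndE.hext fun U s => ?_
  funext r
  ext1; funext x
  obtain ⟨V, hV, hx, t, ht⟩ := exists_germ (s (r - 1 - 1)) x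
  change (morOp (E.d (r - 1) r) U).stalk x.2
    ((morOp (E.d (r - 1 - 1) (r - 1)) U).stalk x.2 ((s (r - 1 - 1)).1 x)) = 0
  rw [ht, LocalOp.stalk_germ _ hV hx, LocalOp.stalk_germ _ hV hx, ← map_zero (tGerm (E.X r) hx)]
  congr 1
  clear ht
  induction t using TensorProduct.induction_on with
  | zero => simp only [map_zero]
  | tmul η e =>
    have h : HolMod.app (E.d (r - 1) r) V (HolMod.app (E.d (r - 1 - 1) (r - 1)) V e) = 0 := by
      have h1 := E.d_comp_d (r - 1 - 1) (r - 1) r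
      exact congrArg (fun α => HolMod.app α V e) h1
    change formInvol V (formInvol V η) ⊗ₜ[Hol H V]
      HolMod.app (E.d (r - 1) r) V (HolMod.app (E.d (r - 1 - 1) (r - 1)) V e) = 0
    rw [h, TensorProduct.tmul_zero]
  | add a b ha hb => rw [map_add, map_add, ha, hb, add_zero]

lemma eDelbar_eDelta : (eDelbar : EndE E) * eDelta + eDelta * eDelbar = 0 := by
  refine EndE.hext fun U s => ?_
  funext r
  ext1; funext x
  obtain ⟨V, hV, hx, t, ht⟩ := exists_germ (s (r - 1)) x
  change (delbarOp (E.X r) U).stalk x.2 ((morOp (E.d (r - 1) r) U).stalk x.2 ((s (r - 1)).1 x)) +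
    (morOp (E.d (r - 1) r) U).stalk x.2
      ((delbarOp (E.X (r - 1)) U).stalk x.2 ((s (r - 1)).1 x)) = 0
  rw [ht, LocalOp.stalk_germ _ hV hx, LocalOp.stalk_germ _ hV hx, LocalOp.stalk_germ _ hV hx,
    LocalOp.stalk_germ _ hV hx, ← map_add, ← map_zero (tGerm (E.X r) hx)]
  congr 1
  clear ht
  induction t using TensorProduct.induction_on with
  | zero => simp only [map_zero, add_zero]
  | tmul η e =>
    change delbar V (formInvol V η) ⊗ₜ[Hol H V] HolMod.app (E.d (r - 1) r) V e +
      formInvol V (delbar V η) ⊗ₜ[Hol H V] HolMod.app (E.d (r - 1) r) V e = 0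
    have h : delbar V (formInvol V η) = -formInvol V (delbar V η) := formD_formInvol _ η
    rw [← TensorProduct.add_tmul, h, neg_add_cancel, TensorProduct.zero_tmul]
  | add a b ha hb =>
    simp only [map_add]
    rw [add_add_add_comm, ha, hb, add_zero]

lemma eDelta_mem_AHom : (eDelta : EndE E) ∈ AHom E 0 0 1 := by
  refine ⟨fun U j k φ hφ s => ?_, fun U r e => ?_⟩
  · rw [eDelta_eMul' hφ, LinearMap.zero_apply, zero_add]
    congr 2
    push_cast
    ring
  · rw [eDelta_eTmul_one]
    exact eTmul_one_mem _

/-- The properties of the `(1,0)` component of a connection of type `(1,0)`. -/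
structure IsPartialConn (D : EndE E) : Prop where
  app_eMul : ∀ (U : Opens X) (φ : Forms H U) (s : ESec E U),
    D.app U (eMul E φ s) = eMul E (del U φ) s + eMul E (formInvol U φ) (D.app U s)
  app_mem : ∀ (U : Opens X) (r : ℤ) (e : (E.X r).Sec U), D.app U (eTmul E 1 e) ∈ eBi E U 1 0 r

lemma IsConnection10.app_eMul (hE : IsLocallyFree E p q) {D : EndE E} (hD : IsConnection10 D)
    {U : Opens X} (φ : Forms H U) (s : ESec E U) :
    D.app U (eMul E φ s) = eMul E (deRham U φ) s + eMul E (formInvol U φ) (D.app U s) := by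
  refine eSec_ext fun x => ?_
  obtain ⟨V, hV, ⟨F⟩⟩ := exists_eFrame hE x.1
  refine ⟨V ⊓ U, inf_le_right, ⟨hV, x.2⟩, ?_⟩
  have hd : formRes (inf_le_right : V ⊓ U ≤ U) (deRham U φ) = deRham _ (formRes inf_le_right φ) := by
    change formRes _ (del U φ + delbar U φ) = _
    rw [map_add]
    exact congrArg₂ (· + ·) (formRes_formD _ _ φ) (formRes_formD _ _ φ)
  rw [D.app_res, map_add, eRes_eMul, eRes_eMul, eRes_eMul, D.app_res, hd]
  change _ = _ + eMul E (formInvol _ (formRes inf_le_right φ)) _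
  generalize formRes (inf_le_right : V ⊓ U ≤ U) φ = φ
  generalize eRes E (inf_le_right : V ⊓ U ≤ U) s = s
  let G := F.res (inf_le_left : V ⊓ U ≤ V)
  have key : ∀ (ψ : Forms H (V ⊓ U)) (l : ℤ) (i : Fin (G.rk l)),
      D.app _ (eMul E φ (eMul E ψ (G.e l i))) = eMul E (deRham _ φ) (eMul E ψ (G.e l i)) +
        eMul E (formInvol _ φ) (D.app _ (eMul E ψ (G.e l i))) := by
    intro ψ l i
    have hmul : deRham _ (φ * ψ) = deRham _ φ * ψ + formInvol _ φ * deRham _ ψ := by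
      change del _ (φ * ψ) + delbar _ (φ * ψ) = (del _ φ + delbar _ φ) * ψ +
        formInvol _ φ * (del _ ψ + delbar _ ψ)
      have h1 : del _ (φ * ψ) = del _ φ * ψ + formInvol _ φ * del _ ψ := formD_mul' _ φ ψ
      have h2 : delbar _ (φ * ψ) = delbar _ φ * ψ + formInvol _ φ * delbar _ ψ := formD_mul' _ φ ψ
      rw [h1, h2, add_mul, mul_add]
      abel
    have hl : ∀ χ : Forms H (V ⊓ U), D.app _ (eMul E χ (G.e l i)) =
        eMul E (deRham _ χ) (G.e l i) + eMul E (formInvol _ χ) (D.app _ (G.e l i)) := fun χ => by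
      rw [← eTmul_eq χ, hD.leibniz, eTmul_eq (deRham _ χ)]
    rw [eMul_eMul, hl, hl, hmul, eMul_add, map_mul, map_add, eMul_eMul, eMul_eMul, eMul_eMul]
    abel
  rw [G.expand hE s]
  simp only [map_sum, key, Finset.sum_add_distrib]

lemma IsConnection10.isPartialConn (hE : IsLocallyFree E p q) {D : EndE E}
    (hD : IsConnection10 D) : IsPartialConn (D - eDelbar) where
  app_eMul U φ s := by
    rw [EndE.sub_app, EndE.sub_app, hD.app_eMul hE, eDelbar_eMul, map_sub]
    change eMul E (del U φ + delbar U φ) s + _ - _ = _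
    rw [eMul_add]
    abel
  app_mem U r e := by
    rw [EndE.sub_app, eDelbar_eTmul_one, sub_zero]
    exact hD.type10 U r e

lemma formInvol_mem {U : Opens X} {a b : ℕ} {φ : Forms H U} (h : φ ∈ formsType H U a b) :
    formInvol U φ ∈ formsType H U a b := by
  rw [formInvol_of_mem h]
  exact Submodule.smul_mem _ _ h

lemma IsPartialConn.apply_mem {D : EndE E} (hD : IsPartialConn D) {U : Opens X} {a b : ℕ} {r : ℤ}
    {s : ESec E U} (hs : s ∈ eBi E U a b r) : D.app U s ∈ eBi E U (a + 1) b r := by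
  refine EndE.apply_mem (fun V φ hφ e => ?_) hs
  rw [hD.app_eMul]
  have h1 := eMul_mem (del_mem hφ) (eTmul_one_mem (E := E) e)
  have h2 := eMul_mem (formInvol_mem hφ) (hD.app_mem V r e)
  exact Submodule.add_mem _ h1 h2

lemma IsPartialConn.app_eMul' {D : EndE E} (hD : IsPartialConn D) {U : Opens X} {j k : ℕ}
    {φ : Forms H U} (hφ : φ ∈ formsType H U j k) (s : ESec E U) :
    D.app U (eMul E φ s) = eMul E (del U φ) s + sgn (j + k) • eMul E φ (D.app U s) := by
  rw [hD.app_eMul, formInvol_of_mem hφ, eMul_smul]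

lemma IsPartialConn.comm_mem {D : EndE E} (hD : IsPartialConn D) {a b : ℕ} {n : ℤ} {f : EndE E}
    (hf : f ∈ AHom E a b n) : D * f - sgn (a + b + n) • (f * D) ∈ AHom E (a + 1) b n := by
  refine ⟨fun U j k φ hφ s => ?_, fun U r e => ?_⟩
  · have e1 : sgn (((a : ℤ) + b + n) * ((j + 1 : ℕ) + k)) =
        sgn ((a + b + n) * (j + k)) * sgn (a + b + n) := by
      rw [← sgn_add]; congr 1; push_cast; ring
    have e2 : sgn (((a + 1 : ℕ) + (b : ℤ) + n) * (j + k)) =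
        sgn ((a + b + n) * (j + k)) * sgn (j + k) := by
      rw [← sgn_add]; congr 1; push_cast; ring
    have hF' := hf.1 U (j + 1) k _ (del_mem hφ)
    rw [e1] at hF'
    have h1 := comm_aux (d := D.app U) (F := f.app U) (m := eMul E φ)
      (m' := eMul E (del U φ)) (sgn_mul_self _) (hD.app_eMul' hφ) (hf.1 U j k φ hφ) hF' s
    exact h1.trans (congrArg (fun c : ℂ => c • eMul E φ
      ((D * f - sgn (a + b + n) • (f * D)).app U s)) e2.symm)
  · rw [EndE.comm_apply]
    refine Submodule.sub_mem _ (hD.apply_mem (hf.2 U r e)) (Submodule.smul_mem _ _ ?_)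
    have := AHom.apply_mem hf (hD.app_mem U r e)
    rwa [add_comm 1 a, zero_add] at this

lemma IsPartialConn.delbar_mem {D : EndE E} (hD : IsPartialConn D) :
    D * eDelbar + eDelbar * D ∈ AHom E 1 1 0 := by
  refine ⟨fun U j k φ hφ s => ?_, fun U r e => ?_⟩
  · have e2 : sgn ((((1 : ℕ) : ℤ) + (1 : ℕ) + 0) * (j + k)) = 1 := by
      have h0 : sgn 0 = 1 := rfl
      rw [← h0]
      exact sgn_congr ⟨j + k, by push_cast; ring⟩
    have h1 := del_delbar φ
    have h2 := formD_formInvol (Or.inl rfl) φ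
    have h3 := formD_formInvol (Or.inr rfl) φ
    have hii : formInvol U (formInvol U φ) = φ := by
      rw [formInvol_of_mem hφ, map_smul, formInvol_of_mem hφ, smul_smul, sgn_mul_self, one_smul]
    change del U (formInvol U φ) = -formInvol U (del U φ) at h2
    change delbar U (formInvol U φ) = -formInvol U (delbar U φ) at h3
    have hz : eMul E (del U (delbar U φ)) s + eMul E (delbar U (del U φ)) s = 0 := by
      rw [← eMul_add, h1]
      simpa using eMul_smul 0 (0 : Forms H U) s
    have hneg : ∀ (ψ : Forms H U) (t : ESec E U), eMul E (-ψ) t = -eMul E ψ t := fun ψ t => by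
      simpa using eMul_smul (-1) ψ t
    rw [e2, one_smul, EndE.add_app, EndE.add_app, EndE.mul_app, EndE.mul_app, EndE.mul_app,
      EndE.mul_app, eDelbar_eMul, hD.app_eMul, map_add, map_add, hD.app_eMul, hD.app_eMul,
      eDelbar_eMul, eDelbar_eMul, h2, h3, hii, hneg, hneg, map_add]
    rw [← sub_eq_zero, ← hz]
    abel
  · rw [add_zero, EndE.add_app, EndE.mul_app, EndE.mul_app, eDelbar_eTmul_one, map_zero, zero_add]
    exact eDelbar_mem (hD.app_mem U r e)

lemma IsPartialConn.delta_mem {D : EndE E} (hD : IsPartialConn D) :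
    D * eDelta + eDelta * D ∈ AHom E 1 0 1 := by
  have h := hD.comm_mem eDelta_mem_AHom
  have e : sgn (((0 : ℕ) : ℤ) + (0 : ℕ) + 1) = -1 := by
    rw [← sgn_one]; rfl
  rwa [e, neg_one_smul, sub_neg_eq_add] at h

end Ops

section TraceProps
variable {H : Type} [NormedAddCommGroup H] [NormedSpace ℂ H] [FiniteDimensional ℂ H]
  {X : Type} [TopologicalSpace X] [ChartedSpace H X] [IsManifold 𝓘(ℂ, H) ω X]
  {E : CochainComplex (HolMod H X) ℤ} {p q : ℤ}

lemma EFrame.xi_app {V : Opens X} (F : EFrame E V) (hE : IsLocallyFree E p q) {a b a' b' : ℕ}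
    {n r : ℤ} {f : EndE E} (hf : f ∈ AHom E a b n) {s : ESec E V} (hs : s ∈ eBi E V a' b' r)
    (l : ℤ) (i : Fin (F.rk l)) :
    F.xi l i (f.app V s) = ∑ k ∈ Finset.Icc p q, ∑ j, sgn ((a + b + n) * (a' + b')) •
      (F.xi k j s * F.xi l i (f.app V (F.e k j))) := by
  conv_lhs => rw [F.expand hE s]
  simp only [map_sum]
  refine Finset.sum_congr rfl fun k _ => Finset.sum_congr rfl fun j _ => ?_
  rw [hf.1 V a' b' _ (F.xi_mem k j hs), map_smul, F.xi_eMul]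

lemma EFrame.trace_mul_comm {V : Opens X} (F : EFrame E V) (hE : IsLocallyFree E p q)
    {a b a' b' : ℕ} {n n' : ℤ} {f g : EndE E} (hf : f ∈ AHom E a b n) (hg : g ∈ AHom E a' b' n') :
    F.trace p q (f * g) = sgn ((a + b + n) * (a' + b' + n')) • F.trace p q (g * f) := by
  simp only [EFrame.trace_apply, EndE.mul_app, F.xi_app hE hf (hg.2 V _ _),
    F.xi_app hE hg (hf.2 V _ _), Finset.smul_sum]
  conv_rhs =>
    enter [2, l]
    rw [Finset.sum_comm]
    enter [2, k]
    rw [Finset.sum_comm]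
  conv_lhs => enter [2, l]; rw [Finset.sum_comm]
  rw [Finset.sum_comm]
  refine Finset.sum_congr rfl fun r _ => Finset.sum_congr rfl fun l _ => ?_
  refine Finset.sum_congr rfl fun i _ => Finset.sum_congr rfl fun j _ => ?_
  by_cases h1 : r = l + n'
  · by_cases h2 : l = r + n
    · rw [formsType_mul_comm (F.xi_mem r j (hg.2 V l _)) (F.xi_mem l i (hf.2 V r _))]
      simp only [smul_smul, ← sgn_add]
      congr 1
      refine sgn_congr ?_
      obtain rfl : n' = -n := by linarith
      subst h1
      obtain ⟨c, hc⟩ := Int.even_mul_succ_self n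
      exact ⟨c + (a + b) * n, by linear_combination hc⟩
    · rw [F.xi_eq_zero i (hf.2 V r _) h2]
      simp
  · rw [F.xi_eq_zero j (hg.2 V l _) h1]
    simp

lemma deRham_xi_app (hE : IsLocallyFree E p q) {D : EndE E} (hD : IsConnection10 D) {V : Opens X}
    (F : EFrame E V) {a b : ℕ} {r : ℤ} {s : ESec E V} (hs : s ∈ eBi E V a b r)
    (l : ℤ) (i : Fin (F.rk l)) :
    F.xi l i (D.app V s) = (if l ∈ Finset.Icc p q then deRham V (F.xi l i s) else 0) +
      ∑ k ∈ Finset.Icc p q, ∑ j, sgn (a + b) •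
        (F.xi k j s * F.xi l i (D.app V (F.e k j))) := by
  conv_lhs => rw [F.expand hE s]
  simp only [map_sum, hD.app_eMul hE, map_add, Finset.sum_add_distrib, F.xi_eMul]
  congr 1
  · have h : ∀ k (j : Fin (F.rk k)), k ≠ l → F.xi l i (F.e k j) = 0 := fun k j hk =>
      F.xi_eq_zero i (eTmul_one_mem _) hk.symm
    split_ifs with hl
    · rw [Finset.sum_eq_single l]
      · simp [F.xi_e]
      · intro k _ hk
        exact Finset.sum_eq_zero fun j _ => by rw [h k j hk, mul_zero]
      · exact fun h => absurd hl h
    · refine Finset.sum_eq_zero fun k hk => Finset.sum_eq_zero fun j _ => ?_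
      rw [h k j (fun h => hl (h ▸ hk)), mul_zero]
  · refine Finset.sum_congr rfl fun k _ => Finset.sum_congr rfl fun j _ => ?_
    rw [formInvol_of_mem (F.xi_mem k j hs), smul_mul_assoc]

lemma EFrame.trace_comm_conn {V : Opens X} (F : EFrame E V) (hE : IsLocallyFree E p q)
    {D : EndE E} (hD : IsConnection10 D) {a b : ℕ} {n : ℤ} {f : EndE E} (hf : f ∈ AHom E a b n) :
    F.trace p q (D * f - sgn (a + b + n) • (f * D)) = deRham V (F.trace p q f) := by
  have h0 : ∑ l ∈ Finset.Icc p q, sgn l • ∑ i, ∑ k ∈ Finset.Icc p q, ∑ j, sgn (a + b) •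
        (F.xi k j (f.app V (F.e l i)) * F.xi l i (D.app V (F.e k j))) =
      ∑ l ∈ Finset.Icc p q, sgn l • ∑ i, ∑ k ∈ Finset.Icc p q, ∑ j,
        F.xi k j (D.app V (F.e l i)) * F.xi l i (f.app V (F.e k j)) := by
    simp only [Finset.smul_sum]
    conv_rhs =>
      enter [2, l]
      rw [Finset.sum_comm]
      enter [2, k]
      rw [Finset.sum_comm]
    conv_lhs => enter [2, l]; rw [Finset.sum_comm]
    rw [Finset.sum_comm]
    refine Finset.sum_congr rfl fun r _ => Finset.sum_congr rfl fun l _ => ?_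
    refine Finset.sum_congr rfl fun i _ => Finset.sum_congr rfl fun j _ => ?_
    by_cases h : l = r
    · subst h
      rw [formsType_mul_comm (F.xi_mem l j (hf.2 V l _)) (F.xi_mem l i (hD.type10 V l _)),
        smul_smul, smul_smul]
      congr 1
      have e : ((a : ℤ) + b) * ((1 : ℕ) + (0 : ℕ)) = a + b := by push_cast; ring
      rw [e, mul_assoc, sgn_mul_self, mul_one]
    · rw [F.xi_eq_zero i (hD.type10 V r _) h]
      simp
  have h1 : F.trace p q (D * f) = deRham V (F.trace p q f) +
      ∑ l ∈ Finset.Icc p q, sgn l • ∑ i, ∑ k ∈ Finset.Icc p q, ∑ j, sgn (a + b) •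
        (F.xi k j (f.app V (F.e l i)) * F.xi l i (D.app V (F.e k j))) := by
    simp only [EFrame.trace_apply, EndE.mul_app, deRham_xi_app hE hD F (hf.2 V _ _),
      Finset.sum_add_distrib, smul_add, map_sum, map_smul]
    congr 1
    refine Finset.sum_congr rfl fun l hl => ?_
    simp only [if_pos hl]
  have h2 : sgn (a + b + n) • F.trace p q (f * D) =
      ∑ l ∈ Finset.Icc p q, sgn l • ∑ i, ∑ k ∈ Finset.Icc p q, ∑ j,
        F.xi k j (D.app V (F.e l i)) * F.xi l i (f.app V (F.e k j)) := by
    simp only [EFrame.trace_apply, EndE.mul_app, F.xi_app hE hf (hD.type10 V _ _), Finset.smul_sum]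
    refine Finset.sum_congr rfl fun l _ => Finset.sum_congr rfl fun i _ => ?_
    refine Finset.sum_congr rfl fun k _ => Finset.sum_congr rfl fun j _ => ?_
    have e : ((a : ℤ) + b + n) * ((1 : ℕ) + (0 : ℕ)) = a + b + n := by push_cast; ring
    rw [e, smul_smul, smul_smul, mul_right_comm, sgn_mul_self, one_mul]
  rw [map_sub, map_smul, h1, h2, h0, add_sub_cancel_right]

variable {T : EndE E →ₗ[ℂ] GForms H X}

lemma IsTraceMap.mul_comm (hT : IsTraceMap p q T) (hE : IsLocallyFree E p q)
    {a b a' b' : ℕ} {n n' : ℤ} {f g : EndE E} (hf : f ∈ AHom E a b n) (hg : g ∈ AHom E a' b' n') :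
    T (f * g) = sgn ((a + b + n) * (a' + b' + n')) • T (g * f) := by
  refine gForms_ext hE fun V F => ?_
  rw [map_smul, hT _ (AHom_le_linEnd _ _ _ (AHom.mul_mem hf hg)),
    hT _ (AHom_le_linEnd _ _ _ (AHom.mul_mem hg hf)), F.trace_mul_comm hE hf hg]

lemma IsTraceMap.deRham (hT : IsTraceMap p q T) (hE : IsLocallyFree E p q) {D : EndE E}
    (hD : IsConnection10 D) {a b : ℕ} {n : ℤ} {f : EndE E} (hf : f ∈ AHom E a b n) :
    deRham ⊤ (T f) = T (D * f - sgn (a + b + n) • (f * D)) := by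
  refine gForms_ext hE fun V F => ?_
  have hmem : D * f - sgn (a + b + n) • (f * D) ∈ linEnd E := by
    have h1 := AHom_le_linEnd _ _ _ ((hD.isPartialConn hE).comm_mem hf)
    have h2 := AHom_le_linEnd _ _ _ (AHom.delbar_comm_mem hf)
    have h3 := Submodule.add_mem _ h1 h2
    have e : (D - eDelbar) * f - sgn (a + b + n) • (f * (D - eDelbar)) +
        (eDelbar * f - sgn (a + b + n) • (f * eDelbar)) =
        D * f - sgn (a + b + n) • (f * D) := by
      rw [sub_mul, mul_sub, smul_sub]
      abel
    rwa [e] at h3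
  have hd : formRes (le_top : V ≤ ⊤) (Semireg.deRham ⊤ (T f)) =
      Semireg.deRham V (formRes le_top (T f)) := by
    change formRes _ (del ⊤ _ + delbar ⊤ _) = _
    rw [map_add]
    exact congrArg₂ (· + ·) (formRes_formD _ _ _) (formRes_formD _ _ _)
  rw [hd, hT _ (AHom_le_linEnd _ _ _ hf), hT _ hmem, F.trace_comm_conn hE hD hf]

lemma IsTraceMap.mem (hT : IsTraceMap p q T) (hE : IsLocallyFree E p q)
    {a b : ℕ} {n : ℤ} {f : EndE E} (hf : f ∈ AHom E a b n) : T f ∈ formsType H ⊤ a b := by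
  intro x
  obtain ⟨V, hV, ⟨F⟩⟩ := exists_eFrame hE x.1
  have h1 := hT _ (AHom_le_linEnd _ _ _ hf) V F
  have h2 : F.trace p q f ∈ formsType H V a b := Submodule.sum_mem _ fun l _ =>
    Submodule.smul_mem _ _ (Submodule.sum_mem _ fun i _ => F.xi_mem l i (hf.2 V l _))
  rw [← h1] at h2
  exact h2 ⟨x.1, hV⟩

lemma IsTraceMap.eq_zero (hT : IsTraceMap p q T) (hE : IsLocallyFree E p q)
    {a b : ℕ} {n : ℤ} (hn : n ≠ 0) {f : EndE E} (hf : f ∈ AHom E a b n) : T f = 0 := by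
  refine gForms_ext hE fun V F => ?_
  rw [hT _ (AHom_le_linEnd _ _ _ hf) V F, map_zero, EFrame.trace_apply]
  refine Finset.sum_eq_zero fun l _ => ?_
  rw [Finset.sum_eq_zero fun i _ => F.xi_eq_zero i (hf.2 V l _) (by omega), smul_zero]

end TraceProps

lemma sgn_cases (i : ℤ) : (sgn i = 1 ∧ (∀ j, sgn (i * j) = 1) ∧ ∀ j, sgn (j * i) = 1) ∨
    (sgn i = -1 ∧ (∀ j, sgn (i * j) = sgn j) ∧ ∀ j, sgn (j * i) = sgn j) := by
  rcases Int.even_or_odd i with h | h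
  · exact Or.inl ⟨h.neg_one_zpow, fun j => (h.mul_right j).neg_one_zpow,
      fun j => (h.mul_left j).neg_one_zpow⟩
  · refine Or.inr ⟨h.neg_one_zpow, fun j => ?_, fun j => ?_⟩
    · obtain ⟨c, rfl⟩ := h
      exact sgn_congr ⟨c * j, by ring⟩
    · obtain ⟨c, rfl⟩ := h
      exact sgn_congr ⟨c * j, by ring⟩

lemma sgn_two : sgn 2 = 1 := by norm_num [sgn]

section Calc
variable {A L : Type} [Ring A] [Module ℂ A] [IsScalarTower ℂ A A] [SMulCommClass ℂ A A]
  [AddCommGroup L] [Module ℂ L]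

/-- The graded commutator of an element `x` of odd degree with an element `f` of degree `i`. -/
def gcomm (x : A) (i : ℤ) (f : A) : A := x * f - sgn i • (f * x)

/-- The graded commutator with an odd element as a linear map. -/
def gcommLin (x : A) (i : ℤ) : A →ₗ[ℂ] A :=
  LinearMap.mulLeft ℂ x - sgn i • LinearMap.mulRight ℂ x

lemma gcomm_mul (x : A) (i j : ℤ) (f g : A) :
    gcomm x (i + j) (f * g) = gcomm x i f * g + sgn i • (f * gcomm x j g) := by
  unfold gcomm
  simp only [sub_mul, mul_sub, smul_sub, smul_mul_assoc, mul_smul_comm, mul_assoc, sgn_add,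
    smul_smul]
  abel

lemma gcomm_sub_smul (x : A) (i : ℤ) (c : ℂ) (f g : A) :
    gcomm x i (f - c • g) = gcomm x i f - c • gcomm x i g := by
  unfold gcomm
  simp only [sub_mul, mul_sub, smul_sub, smul_mul_assoc, mul_smul_comm]
  rw [smul_comm]
  abel

/-- The formal properties of a trace `t` on a graded algebra with an odd derivation `[D, -]`
raising the first grading and a differential `[Δ, -]`. -/
structure TraceCalculus (Gr : ℕ → ℤ → Submodule ℂ A) (D Δ : A) (t : A →ₗ[ℂ] L)
    (d : L →ₗ[ℂ] L) : Prop where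
  mul_mem : ∀ {a b : ℕ} {i j : ℤ} {f g : A}, f ∈ Gr a i → g ∈ Gr b j → f * g ∈ Gr (a + b) (i + j)
  comm_mem : ∀ {a : ℕ} {i : ℤ} {f : A}, f ∈ Gr a i → gcomm D i f ∈ Gr (a + 1) (i + 1)
  diff_mem : ∀ {a : ℕ} {i : ℤ} {f : A}, f ∈ Gr a i → gcomm Δ i f ∈ Gr a (i + 1)
  diff_sq : Δ * Δ = 0
  curv_mem : D * Δ + Δ * D ∈ Gr 1 2
  tr_comm : ∀ {a b : ℕ} {i j : ℤ} {f g : A}, f ∈ Gr a i → g ∈ Gr b j →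
    t (f * g) = sgn (i * j) • t (g * f)
  d_tr : ∀ {a : ℕ} {i : ℤ} {f : A}, f ∈ Gr a i → d (t f) = t (gcomm D i f) + t (gcomm Δ i f)
  tr_zero : ∀ {a : ℕ} {i : ℤ} {f : A}, 2 ≤ a → f ∈ Gr a i → t f = 0

namespace TraceCalculus
variable {Gr : ℕ → ℤ → Submodule ℂ A} {D Δ : A} {t : A →ₗ[ℂ] L} {d : L →ₗ[ℂ] L}

lemma rot (C : TraceCalculus Gr D Δ t d)
    {a b c : ℕ} {i j k : ℤ} {f g h : A} (hf : f ∈ Gr a i) (hg : g ∈ Gr b j)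
    (hh : h ∈ Gr c k) : t (f * (g * h)) = sgn (i * (j + k)) • t (g * (h * f)) := by
  rw [C.tr_comm hf (C.mul_mem hg hh), mul_assoc]

lemma rot' (C : TraceCalculus Gr D Δ t d)
    {a b c : ℕ} {i j k : ℤ} {f g h : A} (hf : f ∈ Gr a i) (hg : g ∈ Gr b j)
    (hh : h ∈ Gr c k) : t (f * (g * h)) = sgn ((i + j) * k) • t (h * (f * g)) := by
  rw [← mul_assoc, C.tr_comm (C.mul_mem hf hg) hh]

lemma d_curv (C : TraceCalculus Gr D Δ t d)
    {i : ℤ} {f : A} (hf : f ∈ Gr 0 i) :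
    d (t ((D * Δ + Δ * D) * f)) = t ((D * Δ + Δ * D) * gcomm Δ i f) := by
  have hm := C.mul_mem C.curv_mem hf
  have h2 : sgn (2 + i) = sgn i := by rw [sgn_add, sgn_two, one_mul]
  rw [C.d_tr hm, C.tr_zero (by norm_num) (C.comm_mem hm), zero_add]
  congr 1
  unfold gcomm
  rw [h2]
  simp only [add_mul, mul_add, mul_sub, smul_add, mul_smul_comm, mul_assoc]
  simp only [← mul_assoc Δ Δ, C.diff_sq, zero_mul, mul_zero, add_zero]
  abel

end TraceCalculus

/-- The pairing `Tr([D,f] g - (-1)^{ij} [D,g] f)`. -/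
def trPair (t : A →ₗ[ℂ] L) (D : A) (i j : ℤ) (f g : A) : L :=
  t (gcomm D i f * g - sgn (i * j) • (gcomm D j g * f))

/-- The graded commutator. -/
def gbr (i j : ℤ) (f g : A) : A := f * g - sgn (i * j) • (g * f)

namespace TraceCalculus
variable {Gr : ℕ → ℤ → Submodule ℂ A} {D Δ : A} {t : A →ₗ[ℂ] L} {d : L →ₗ[ℂ] L}

lemma d_comm_mul (C : TraceCalculus Gr D Δ t d)
    {i j : ℤ} {f g : A} (hf : f ∈ Gr 0 i) (hg : g ∈ Gr 0 j) :
    d (t (gcomm D i f * g)) = t ((D * Δ + Δ * D) * (f * g)) -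
      t (f * ((D * Δ + Δ * D) * g)) -
      t (gcomm D (i + 1) (gcomm Δ i f) * g) - sgn i • t (gcomm D i f * gcomm Δ j g) := by
  have hm := C.mul_mem (C.comm_mem hf) hg
  rw [C.d_tr hm, C.tr_zero (by norm_num) (C.comm_mem hm), zero_add, ← map_smul, ← map_sub,
    ← map_sub, ← map_sub]
  congr 1
  unfold gcomm
  simp only [add_mul, mul_add, mul_sub, sub_mul, smul_sub, smul_mul_assoc, mul_smul_comm, mul_assoc,
    sgn_add, sgn_one]
  rcases sgn_cases i with hi | hi <;> rw [hi.1] <;> module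

lemma d_trPair (C : TraceCalculus Gr D Δ t d)
    {i j : ℤ} {f g : A} (hf : f ∈ Gr 0 i) (hg : g ∈ Gr 0 j) :
    d (trPair t D i j f g) = (2 : ℂ) • t ((D * Δ + Δ * D) * gbr i j f g) -
      trPair t D (i + 1) j (gcomm Δ i f) g + sgn (i * j) • trPair t D (j + 1) i (gcomm Δ j g) f := by
  unfold trPair gbr
  rw [map_sub, map_sub, map_smul, map_smul, C.d_comm_mul hf hg, C.d_comm_mul hg hf,
    C.rot hf C.curv_mem hg, C.rot hg C.curv_mem hf, mul_sub]
  simp only [map_sub, map_smul, mul_smul_comm, sgn_add, mul_add, add_mul, one_mul]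
  rcases sgn_cases i with hi | hi <;> rcases sgn_cases j with hj | hj <;>
    simp only [hi.1, hi.2.1, hi.2.2, hj.1, hj.2.1, hj.2.2, sgn_two] <;> module

lemma d_tr_mul_gbr (C : TraceCalculus Gr D Δ t d)
    {i j k : ℤ} {f g h : A} (hf : f ∈ Gr 0 i) (hg : g ∈ Gr 0 j)
    (hh : h ∈ Gr 0 k) :
    d (t (f * gbr j k g h)) = t (gcomm Δ i f * gbr j k g h) -
      sgn (i * j) • t (gcomm Δ j g * gbr i k f h) +
      (sgn (i * k) * sgn (j * k)) • t (gcomm Δ k h * gbr i j f g) +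
      trPair t D (i + j) k (gbr i j f g) h -
      sgn (j * k) • trPair t D (i + k) j (gbr i k f h) g +
      (sgn (i * j) * sgn (i * k)) • trPair t D (j + k) i (gbr j k g h) f := by
  have hb : gbr j k g h ∈ Gr 0 (j + k) := by
    refine Submodule.sub_mem _ (C.mul_mem hg hh) (Submodule.smul_mem _ _ ?_)
    have := C.mul_mem hh hg
    rwa [add_comm k j] at this
  have hm := C.mul_mem hf hb
  have hbr : ∀ (x : A) (i j : ℤ) (f g : A), gcomm x (i + j) (gbr i j f g) =
      gcomm x i f * g + sgn i • (f * gcomm x j g) -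
        sgn (i * j) • (gcomm x j g * f + sgn j • (g * gcomm x i f)) := by
    intro x i j f g
    rw [← gcomm_mul, ← gcomm_mul, add_comm j i]
    exact gcomm_sub_smul _ _ _ _ _
  rw [C.d_tr hm, gcomm_mul, gcomm_mul]
  unfold trPair
  simp only [hbr]
  have kf := C.comm_mem hf
  have kg := C.comm_mem hg
  have kh := C.comm_mem hh
  have lg := C.diff_mem hg
  have lh := C.diff_mem hh
  generalize gcomm Δ i f = df at *
  generalize gcomm Δ j g = dg at *
  generalize gcomm Δ k h = dh at *
  generalize gcomm D i f = nf at *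
  generalize gcomm D j g = ng at *
  generalize gcomm D k h = nh at *
  unfold gbr
  simp only [mul_add, add_mul, mul_sub, sub_mul, smul_add, smul_sub, smul_mul_assoc, mul_smul_comm,
    smul_smul, mul_assoc, map_add, map_sub, map_smul,
    C.rot hf lg hh, C.rot' hf hh lg, C.rot hf lh hg, C.rot' hf hg lh,
    C.rot hf kg hh, C.rot' hf hh kg, C.rot hf kh hg, C.rot' hf hg kh,
    C.rot hg kf hh, C.rot hh kf hg,
    C.rot hg kh hf, C.rot hh kg hf, sgn_add, mul_one]
  rcases sgn_cases i with hi | hi <;> rcases sgn_cases j with hj | hj <;>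
    rcases sgn_cases k with hk | hk <;>
    simp only [hi.1, hi.2.1, hi.2.2, hj.1, hj.2.1, hj.2.2, hk.1, hk.2.1, hk.2.2, sgn_one] <;>
    module

lemma rot4 (C : TraceCalculus Gr D Δ t d)
    {a b c e : ℕ} {i j k l : ℤ} {f g h m : A} (hf : f ∈ Gr a i) (hg : g ∈ Gr b j)
    (hh : h ∈ Gr c k) (hm : m ∈ Gr e l) :
    t (g * (f * (h * m))) = sgn (j * (i + k + l)) • t (f * (h * (m * g))) ∧
    t (g * (h * (f * m))) = sgn ((j + k) * (i + l)) • t (f * (m * (g * h))) ∧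
    t (g * (h * (m * f))) = sgn ((j + k + l) * i) • t (f * (g * (h * m))) := by
  refine ⟨?_, ?_, ?_⟩
  · have := C.tr_comm hg (C.mul_mem (C.mul_mem hf hh) hm)
    simpa only [mul_assoc] using this
  · have := C.tr_comm (C.mul_mem hg hh) (C.mul_mem hf hm)
    simpa only [mul_assoc] using this
  · have := C.tr_comm (C.mul_mem (C.mul_mem hg hh) hm) hf
    simpa only [mul_assoc] using this

lemma tr_gbr_mul_gbr (C : TraceCalculus Gr D Δ t d)
    {i j k l : ℤ} {f g h m : A} (hf : f ∈ Gr 0 i) (hg : g ∈ Gr 0 j)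
    (hh : h ∈ Gr 0 k) (hm : m ∈ Gr 0 l) :
    t (gbr i j f g * gbr k l h m) - sgn (j * k) • t (gbr i k f h * gbr j l g m) +
      (sgn (j * l) * sgn (k * l)) • t (gbr i l f m * gbr j k g h) +
      (sgn (i * j) * sgn (i * k)) • t (gbr j k g h * gbr i l f m) -
      (sgn (i * j) * sgn (i * l) * sgn (k * l)) • t (gbr j l g m * gbr i k f h) +
      (sgn (i * k) * sgn (j * k) * sgn (i * l) * sgn (j * l)) •
        t (gbr k l h m * gbr i j f g) = 0 := by
  have e1 := C.rot4 hf hg hh hm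
  have e2 := C.rot4 hf hg hm hh
  have e3 := C.rot4 hf hh hg hm
  have e4 := C.rot4 hf hh hm hg
  have e5 := C.rot4 hf hm hg hh
  have e6 := C.rot4 hf hm hh hg
  unfold gbr
  simp only [mul_sub, sub_mul, smul_sub, smul_mul_assoc, mul_smul_comm, smul_smul, mul_assoc,
    map_sub, map_smul, e1, e2, e3, e4, e5, e6, add_mul, mul_add, sgn_add]
  rcases sgn_cases i with hi | hi <;> rcases sgn_cases j with hj | hj <;>
    rcases sgn_cases k with hk | hk <;> rcases sgn_cases l with hl | hl <;>
    simp only [hi.1, hi.2.1, hi.2.2, hj.1, hj.2.1, hj.2.2, hk.1, hk.2.1, hk.2.2, hl.1, hl.2.1,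
      hl.2.2] <;>
    module

lemma tr_swap_left (C : TraceCalculus Gr D Δ t d)
    {i j k : ℤ} {f g h : A} (hf : f ∈ Gr 0 i) (hg : g ∈ Gr 0 j)
    (hh : h ∈ Gr 0 k) :
    t (g * gbr i k f h) = -sgn (i * j) • t (f * gbr j k g h) := by
  unfold gbr
  simp only [mul_sub, mul_smul_comm, map_sub, map_smul, C.rot hg hf hh, C.rot' hg hh hf, mul_add,
    add_mul, sgn_add]
  rcases sgn_cases i with hi | hi <;> rcases sgn_cases j with hj | hj <;>
    rcases sgn_cases k with hk | hk <;>
    simp only [hi.1, hi.2.1, hi.2.2, hj.1, hj.2.1, hj.2.2, hk.1, hk.2.1, hk.2.2] <;>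
    module

lemma tr_swap_right {j k : ℤ} {f g h : A} :
    t (f * gbr k j h g) = -sgn (j * k) • t (f * gbr j k g h) := by
  unfold gbr
  simp only [mul_sub, mul_smul_comm, map_sub, map_smul]
  rcases sgn_cases j with hj | hj <;> rcases sgn_cases k with hk | hk <;>
    simp only [hj.1, hj.2.1, hj.2.2, hk.1, hk.2.1, hk.2.2] <;>
    module

end TraceCalculus

lemma trPair_swap (t : A →ₗ[ℂ] L) (D : A) (i j : ℤ) (f g : A) :
    trPair t D j i g f = -sgn (i * j) • trPair t D i j f g := by
  unfold trPair
  rw [map_sub, map_sub, map_smul, map_smul, mul_comm j i]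
  rcases sgn_cases i with hi | hi <;> rcases sgn_cases j with hj | hj <;>
    simp only [hi.2.1, hj.1] <;> module

lemma gcomm_gcomm {x : A} (h : x * x = 0) (i : ℤ) (f : A) :
    gcomm x (i + 1) (gcomm x i f) = 0 := by
  have h' : ∀ y, x * (x * y) = 0 := fun y => by rw [← mul_assoc, h, zero_mul]
  unfold gcomm
  simp only [mul_sub, sub_mul, smul_sub, mul_smul_comm, smul_mul_assoc, mul_assoc, h, h', mul_zero,
    smul_zero, sgn_add, sgn_one]
  module

lemma gbr_skew (i j : ℤ) (f g : A) : gbr i j f g + sgn (i * j) • gbr j i g f = 0 := by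
  unfold gbr
  rcases sgn_cases i with hi | hi <;> rcases sgn_cases j with hj | hj <;>
    simp only [hi.1, hi.2.1, hi.2.2, hj.1, hj.2.1, hj.2.2] <;> module

lemma gbr_jacobi (i j k : ℤ) (f g h : A) :
    gbr i (j + k) f (gbr j k g h) = gbr (i + j) k (gbr i j f g) h +
      sgn (i * j) • gbr j (i + k) g (gbr i k f h) := by
  unfold gbr
  simp only [mul_sub, sub_mul, smul_sub, mul_smul_comm, smul_mul_assoc, mul_assoc, smul_smul,
    mul_add, add_mul, sgn_add]
  rcases sgn_cases i with hi | hi <;> rcases sgn_cases j with hj | hj <;>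
    rcases sgn_cases k with hk | hk <;>
    simp only [hi.1, hi.2.1, hi.2.2, hj.1, hj.2.1, hj.2.2, hk.1, hk.2.1, hk.2.2] <;> module

lemma gcomm_gbr (x : A) (i j : ℤ) (f g : A) :
    gcomm x (i + j) (gbr i j f g) = gbr (i + 1) j (gcomm x i f) g +
      sgn i • gbr i (j + 1) f (gcomm x j g) := by
  unfold gbr gcomm
  simp only [mul_sub, sub_mul, smul_sub, mul_smul_comm, smul_mul_assoc, mul_assoc, smul_smul,
    mul_add, add_mul, sgn_add, mul_one, one_mul]
  rcases sgn_cases i with hi | hi <;> rcases sgn_cases j with hj | hj <;>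
    simp only [hi.1, hi.2.1, hi.2.2, hj.1, hj.2.1, hj.2.2] <;> module

end Calc

section Total
variable {H : Type} [NormedAddCommGroup H] [NormedSpace ℂ H] [FiniteDimensional ℂ H]
  {X : Type} [TopologicalSpace X] [ChartedSpace H X] [IsManifold 𝓘(ℂ, H) ω X]
  {E : CochainComplex (HolMod H X) ℤ} {p q : ℤ}

variable (E) in
/-- The endomorphisms of total degree `i` in `A^{a,*}_X(Hom^*(E^*, E^*))`. -/
def THom (a : ℕ) (i : ℤ) : Submodule ℂ (EndE E) := ⨆ b : ℕ, AHom E a b (i - a - b)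

lemma AHom_le_THom {a b : ℕ} {n i : ℤ} (h : (a : ℤ) + b + n = i) : AHom E a b n ≤ THom E a i := by
  obtain rfl : n = i - a - b := by linarith
  exact le_iSup (fun b : ℕ => AHom E a b (i - a - b)) b

lemma THom_le {a : ℕ} {i : ℤ} {S : Submodule ℂ (EndE E)}
    (h : ∀ (b : ℕ) (n : ℤ), (a : ℤ) + b + n = i → AHom E a b n ≤ S) : THom E a i ≤ S :=
  iSup_le fun b => h b _ (by ring)

lemma AHom0_le_THom (i : ℤ) : AHom0 E i ≤ THom E 0 i :=
  iSup_le fun _ => AHom_le_THom (by push_cast; ring)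

lemma THom_bilin {W : Type*} [AddCommGroup W] [Module ℂ W] {a a' : ℕ} {i j : ℤ}
    (B : EndE E →ₗ[ℂ] EndE E →ₗ[ℂ] W) (S : Submodule ℂ W)
    (h : ∀ (b : ℕ) (n : ℤ), (a : ℤ) + b + n = i → ∀ (b' : ℕ) (n' : ℤ), (a' : ℤ) + b' + n' = j →
      ∀ f ∈ AHom E a b n, ∀ g ∈ AHom E a' b' n', B f g ∈ S) {f g : EndE E} (hf : f ∈ THom E a i)
    (hg : g ∈ THom E a' j) : B f g ∈ S := by
  have h1 : THom E a i ≤ S.comap (B.flip g) := THom_le fun b n hn f hf => by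
    have h2 : THom E a' j ≤ S.comap (B f) := THom_le fun b' n' hn' g hg =>
      h b n hn b' n' hn' f hf g hg
    exact h2 hg
  exact h1 hf

lemma THom_le_linEnd (a : ℕ) (i : ℤ) : THom E a i ≤ linEnd E :=
  iSup_le fun _ => AHom_le_linEnd _ _ _

lemma THom_mul_mem {a a' : ℕ} {i j : ℤ} {f g : EndE E} (hf : f ∈ THom E a i)
    (hg : g ∈ THom E a' j) : f * g ∈ THom E (a + a') (i + j) := by
  refine THom_bilin (LinearMap.mul ℂ (EndE E)) _ ?_ hf hg
  intro b n hn b' n' hn' f hf g hg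
  have h := AHom_le_THom (i := i + j) (by push_cast; linarith) (AHom.mul_mem hf hg)
  rwa [add_comm a' a] at h

lemma diff_diff : (eDelta + eDelbar : EndE E) * (eDelta + eDelbar) = 0 := by
  rw [add_mul, mul_add, mul_add, eDelta_eDelta, eDelbar_eDelbar, zero_add, add_zero, add_comm,
    eDelbar_eDelta]

lemma atiyah_eq (D : EndE E) : atiyah D =
    (D - eDelbar) * (eDelta + eDelbar) + (eDelta + eDelbar) * (D - eDelbar) := by
  have h1 := eDelbar_eDelta (E := E)
  have h2 := eDelbar_eDelbar (E := E)
  have h3 : (D - eDelbar) * (eDelta + eDelbar) + (eDelta + eDelbar) * (D - eDelbar) =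
      atiyah D - ((eDelbar * eDelta + eDelta * eDelbar) +
        (eDelbar * eDelbar + eDelbar * eDelbar)) := by
    unfold atiyah
    noncomm_ring
  rw [h3, h1, h2]
  simp

lemma IsTraceMap.traceCalculus {T : EndE E →ₗ[ℂ] GForms H X} (hT : IsTraceMap p q T)
    (hE : IsLocallyFree E p q) {D : EndE E} (hD : IsConnection10 D) :
    TraceCalculus (THom E) (D - eDelbar) (eDelta + eDelbar) ((formsF2 H X).mkQ ∘ₗ T)
      (drD H X) where
  mul_mem := THom_mul_mem
  comm_mem {a i f} hf := by
    have h : THom E a i ≤ (THom E (a + 1) (i + 1)).comap (gcommLin (D - eDelbar) i) :=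
      THom_le fun b n hn f hf => by
        have h := (hD.isPartialConn hE).comm_mem hf
        rw [hn] at h
        exact AHom_le_THom (by push_cast; linarith) h
    exact h hf
  diff_mem {a i f} hf := by
    have h : THom E a i ≤ (THom E a (i + 1)).comap (gcommLin (eDelta + eDelbar) i) :=
      THom_le fun b n hn f hf => by
        have h1 := AHom.delta_comm_mem hf
        have h2 := AHom.delbar_comm_mem hf
        rw [hn] at h1 h2
        have h3 := Submodule.add_mem _ (AHom_le_THom (i := i + 1) (by linarith) h1)
          (AHom_le_THom (i := i + 1) (by push_cast; linarith) h2)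
        rwa [← homDiff_eq] at h3
    exact h hf
  diff_sq := diff_diff
  curv_mem := by
    have h1 := (hD.isPartialConn hE).delta_mem
    have h2 := (hD.isPartialConn hE).delbar_mem
    have h3 := Submodule.add_mem _ (AHom_le_THom (i := 2) (by norm_num) h1)
      (AHom_le_THom (i := 2) (by norm_num) h2)
    rw [mul_add, add_mul, add_add_add_comm]
    exact h3
  tr_comm {a b i j f g} hf hg := by
    have h := THom_bilin ((LinearMap.mul ℂ (EndE E)).compr₂ T -
      sgn (i * j) • (LinearMap.mul ℂ (EndE E)).flip.compr₂ T) ⊥ (by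
        intro b n hn b' n' hn' f hf g hg
        have h := hT.mul_comm hE hf hg
        rw [hn, hn'] at h
        exact sub_eq_zero.mpr h) hf hg
    have h' : T (f * g) = sgn (i * j) • T (g * f) := sub_eq_zero.mp h
    rw [LinearMap.comp_apply, LinearMap.comp_apply, h', map_smul]
  d_tr {a i f} hf := by
    have h : THom E a i ≤ LinearMap.eqLocus (Semireg.deRham ⊤ ∘ₗ T)
        (T ∘ₗ gcommLin (D - eDelbar) i + T ∘ₗ gcommLin (eDelta + eDelbar) i) :=
      THom_le fun b n hn f hf => by
        change Semireg.deRham ⊤ (T f) = T (gcomm (D - eDelbar) i f) + T (gcomm (eDelta + eDelbar) i f)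
        have h1 := hT.deRham hE hD hf
        have h2 := hT.mul_comm hE eDelta_mem_AHom hf
        have e : (((0 : ℕ) : ℤ) + (0 : ℕ) + 1) * (a + b + n) = i := by
          rw [hn]; push_cast; ring
        rw [e] at h2
        rw [hn] at h1
        have h3 : T (gcomm eDelta i f) = 0 := by
          unfold gcomm
          rw [map_sub, map_smul, h2, sub_self]
        rw [h1, ← map_add, ← sub_eq_zero, ← map_sub]
        rw [← neg_eq_zero, ← map_neg, ← h3]
        congr 1
        unfold gcomm
        simp only [sub_mul, mul_sub, add_mul, mul_add, smul_sub, smul_add]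
        abel
    have h' : Semireg.deRham ⊤ (T f) = T (gcomm (D - eDelbar) i f) +
      T (gcomm (eDelta + eDelbar) i f) := h hf
    change (formsF2 H X).mkQ (Semireg.deRham ⊤ (T f)) = _
    rw [h', map_add]
    rfl
  tr_zero {a i f} ha hf := by
    have h : THom E a i ≤ (formsF2 H X).comap T := THom_le fun b n hn f hf =>
      Submodule.mem_iSup_of_mem a (Submodule.mem_iSup_of_mem ha
        (Submodule.mem_iSup_of_mem b (hT.mem hE hf)))
    exact (Submodule.Quotient.mk_eq_zero _).mpr (h hf)

lemma IsTraceMap.mem_formsRow {T : EndE E →ₗ[ℂ] GForms H X} (hT : IsTraceMap p q T)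
    (hE : IsLocallyFree E p q) {a : ℕ} {i : ℤ} {f : EndE E} (hf : f ∈ THom E a i) :
    T f ∈ formsRow H X a := by
  have h : THom E a i ≤ (formsRow H X a).comap T := THom_le fun b n hn f hf =>
    Submodule.mem_iSup_of_mem b (hT.mem hE hf)
  exact h hf

lemma IsTraceMap.mem_formsDeg {T : EndE E →ₗ[ℂ] GForms H X} (hT : IsTraceMap p q T)
    (hE : IsLocallyFree E p q) {a : ℕ} {i : ℤ} {f : EndE E} (hf : f ∈ THom E a i) :
    T f ∈ formsDeg H X i := by
  have h : THom E a i ≤ (formsDeg H X i).comap T := THom_le fun b n hn f hf => by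
    by_cases h0 : n = 0
    · subst h0
      rw [add_zero] at hn
      exact Submodule.mem_iSup_of_mem a (Submodule.mem_iSup_of_mem b
        (Submodule.mem_iSup_of_mem hn (hT.mem hE hf)))
    · rw [Submodule.mem_comap, hT.eq_zero hE h0 hf]
      exact Submodule.zero_mem _
  exact h hf

end Total

section Shuffles
variable {L : Type} [AddCommGroup L] [Module ℂ L]

/-- The permutation of `Fin n` with given values. -/
abbrev permOf {n : ℕ} (f g : Fin n → Fin n) (h : ∀ i, g (f i) = i) (h' : ∀ i, f (g i) = i) :
    Equiv.Perm (Fin n) := ⟨f, g, h, h'⟩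

lemma koszul_one {n : ℕ} (k : Fin n → ℤ) : koszul k 1 = 1 := by
  unfold koszul
  refine Finset.prod_eq_one fun i _ => Finset.prod_eq_one fun j _ => if_neg ?_
  rintro ⟨h1, h2⟩
  exact absurd h1 (not_lt.mpr (le_of_lt h2))

lemma perm_two (σ : Equiv.Perm (Fin 2)) :
    σ = 1 ∨ σ = permOf ![1, 0] ![1, 0] (by decide) (by decide) := by
  revert σ; decide

lemma koszul_10 (k : Fin 2 → ℤ) :
    koszul k (permOf ![1, 0] ![1, 0] (by decide) (by decide)) = -sgn (k 0 * k 1) := by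
  simp [koszul, Fin.prod_univ_two, mul_comm]

lemma shuffles_2_1 : shuffles 2 1 = {1, permOf ![1, 0] ![1, 0] (by decide) (by decide)} := by
  ext σ
  simp only [shuffles, Finset.mem_filter, Finset.mem_univ, true_and]
  revert σ; decide

lemma shuffles_2_2 : shuffles 2 2 = {1} := by
  ext σ
  simp only [shuffles, Finset.mem_filter, Finset.mem_univ, true_and, Finset.mem_singleton]
  revert σ; decide

lemma sum_shuffles_2_1 (k : Fin 2 → ℤ) (G : Fin 2 → Fin 2 → L) :
    ∑ σ ∈ shuffles 2 1, koszul k σ • G (σ 0) (σ 1) = G 0 1 - sgn (k 0 * k 1) • G 1 0 := by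
  rw [shuffles_2_1, Finset.sum_pair (by decide), koszul_one, koszul_10, one_smul, neg_smul,
    ← sub_eq_add_neg]
  rfl

lemma shuffles_3_1 : shuffles 3 1 = {1, permOf ![1, 0, 2] ![1, 0, 2] (by decide) (by decide),
    permOf ![2, 0, 1] ![1, 2, 0] (by decide) (by decide)} := by
  ext σ
  simp only [shuffles, Finset.mem_filter, Finset.mem_univ, true_and]
  revert σ; decide

lemma shuffles_3_2 : shuffles 3 2 = {1, permOf ![0, 2, 1] ![0, 2, 1] (by decide) (by decide),
    permOf ![1, 2, 0] ![2, 0, 1] (by decide) (by decide)} := by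
  ext σ
  simp only [shuffles, Finset.mem_filter, Finset.mem_univ, true_and]
  revert σ; decide

lemma koszul_102 (k : Fin 3 → ℤ) :
    koszul k (permOf ![1, 0, 2] ![1, 0, 2] (by decide) (by decide)) = -sgn (k 0 * k 1) := by
  simp [koszul, Fin.prod_univ_three, mul_comm]

lemma koszul_021 (k : Fin 3 → ℤ) :
    koszul k (permOf ![0, 2, 1] ![0, 2, 1] (by decide) (by decide)) = -sgn (k 1 * k 2) := by
  simp [koszul, Fin.prod_univ_three, mul_comm]

lemma koszul_201 (k : Fin 3 → ℤ) :
    koszul k (permOf ![2, 0, 1] ![1, 2, 0] (by decide) (by decide)) =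
      sgn (k 0 * k 2) * sgn (k 1 * k 2) := by
  simp [koszul, Fin.prod_univ_three, mul_comm]

lemma koszul_120 (k : Fin 3 → ℤ) :
    koszul k (permOf ![1, 2, 0] ![2, 0, 1] (by decide) (by decide)) =
      sgn (k 0 * k 1) * sgn (k 0 * k 2) := by
  simp [koszul, Fin.prod_univ_three, mul_comm]

lemma koszul_210 (k : Fin 3 → ℤ) :
    koszul k (permOf ![2, 1, 0] ![2, 1, 0] (by decide) (by decide)) =
      -(sgn (k 0 * k 1) * sgn (k 0 * k 2) * sgn (k 1 * k 2)) := by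
  simp only [koszul, Fin.prod_univ_three]
  simp
  rw [mul_comm (k 2) (k 1), mul_comm (k 2) (k 0), mul_comm (k 1) (k 0)]
  ring

lemma perm_three (σ : Equiv.Perm (Fin 3)) :
    σ = 1 ∨ σ = permOf ![1, 0, 2] ![1, 0, 2] (by decide) (by decide) ∨
    σ = permOf ![0, 2, 1] ![0, 2, 1] (by decide) (by decide) ∨
    σ = permOf ![2, 0, 1] ![1, 2, 0] (by decide) (by decide) ∨
    σ = permOf ![1, 2, 0] ![2, 0, 1] (by decide) (by decide) ∨
    σ = permOf ![2, 1, 0] ![2, 1, 0] (by decide) (by decide) := by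
  revert σ; decide

lemma sum_shuffles_3_1 (k : Fin 3 → ℤ) (G : Fin 3 → Fin 3 → Fin 3 → L) :
    ∑ σ ∈ shuffles 3 1, koszul k σ • G (σ 0) (σ 1) (σ 2) =
      G 0 1 2 - sgn (k 0 * k 1) • G 1 0 2 + (sgn (k 0 * k 2) * sgn (k 1 * k 2)) • G 2 0 1 := by
  rw [shuffles_3_1, Finset.sum_insert (by decide), Finset.sum_pair (by decide), koszul_one,
    koszul_102, koszul_201, one_smul, neg_smul, ← add_assoc, ← sub_eq_add_neg]
  rfl

lemma sum_shuffles_3_2 (k : Fin 3 → ℤ) (G : Fin 3 → Fin 3 → Fin 3 → L) :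
    ∑ σ ∈ shuffles 3 2, koszul k σ • G (σ 0) (σ 1) (σ 2) =
      G 0 1 2 - sgn (k 1 * k 2) • G 0 2 1 + (sgn (k 0 * k 1) * sgn (k 0 * k 2)) • G 1 2 0 := by
  rw [shuffles_3_2, Finset.sum_insert (by decide), Finset.sum_pair (by decide), koszul_one,
    koszul_021, koszul_120, one_smul, neg_smul, ← add_assoc, ← sub_eq_add_neg]
  rfl

set_option maxRecDepth 4000 in
lemma shuffles_4_2 : shuffles 4 2 = {1,
    permOf ![0, 2, 1, 3] ![0, 2, 1, 3] (by decide) (by decide),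
    permOf ![0, 3, 1, 2] ![0, 2, 3, 1] (by decide) (by decide),
    permOf ![1, 2, 0, 3] ![2, 0, 1, 3] (by decide) (by decide),
    permOf ![1, 3, 0, 2] ![2, 0, 3, 1] (by decide) (by decide),
    permOf ![2, 3, 0, 1] ![2, 3, 0, 1] (by decide) (by decide)} := by
  ext σ
  simp only [shuffles, Finset.mem_filter, Finset.mem_univ, true_and]
  revert σ; decide

lemma koszul_0213 (k : Fin 4 → ℤ) :
    koszul k (permOf ![0, 2, 1, 3] ![0, 2, 1, 3] (by decide) (by decide)) =
      -sgn (k 1 * k 2) := by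
  simp only [koszul, Fin.prod_univ_four]
  simp
  rw [mul_comm (k 2) (k 1)]

lemma koszul_0312 (k : Fin 4 → ℤ) :
    koszul k (permOf ![0, 3, 1, 2] ![0, 2, 3, 1] (by decide) (by decide)) =
      sgn (k 1 * k 3) * sgn (k 2 * k 3) := by
  simp only [koszul, Fin.prod_univ_four]
  simp
  rw [mul_comm (k 3) (k 1), mul_comm (k 3) (k 2)]

lemma koszul_1203 (k : Fin 4 → ℤ) :
    koszul k (permOf ![1, 2, 0, 3] ![2, 0, 1, 3] (by decide) (by decide)) =
      sgn (k 0 * k 1) * sgn (k 0 * k 2) := by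
  simp only [koszul, Fin.prod_univ_four]
  simp
  rw [mul_comm (k 1) (k 0), mul_comm (k 2) (k 0)]

lemma koszul_1302 (k : Fin 4 → ℤ) :
    koszul k (permOf ![1, 3, 0, 2] ![2, 0, 3, 1] (by decide) (by decide)) =
      -(sgn (k 0 * k 1) * sgn (k 0 * k 3) * sgn (k 2 * k 3)) := by
  simp only [koszul, Fin.prod_univ_four]
  simp
  rw [mul_comm (k 1) (k 0), mul_comm (k 3) (k 0), mul_comm (k 3) (k 2)]
  ring

lemma koszul_2301 (k : Fin 4 → ℤ) :
    koszul k (permOf ![2, 3, 0, 1] ![2, 3, 0, 1] (by decide) (by decide)) =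
      sgn (k 0 * k 2) * sgn (k 1 * k 2) * sgn (k 0 * k 3) * sgn (k 1 * k 3) := by
  simp only [koszul, Fin.prod_univ_four]
  simp
  rw [mul_comm (k 2) (k 0), mul_comm (k 2) (k 1), mul_comm (k 3) (k 0), mul_comm (k 3) (k 1)]
  ring

lemma sum_shuffles_4_2 (k : Fin 4 → ℤ) (G : Fin 4 → Fin 4 → Fin 4 → Fin 4 → L) :
    ∑ σ ∈ shuffles 4 2, koszul k σ • G (σ 0) (σ 1) (σ 2) (σ 3) =
      G 0 1 2 3 - sgn (k 1 * k 2) • G 0 2 1 3 +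
        (sgn (k 1 * k 3) * sgn (k 2 * k 3)) • G 0 3 1 2 +
        (sgn (k 0 * k 1) * sgn (k 0 * k 2)) • G 1 2 0 3 -
        (sgn (k 0 * k 1) * sgn (k 0 * k 3) * sgn (k 2 * k 3)) • G 1 3 0 2 +
        (sgn (k 0 * k 2) * sgn (k 1 * k 2) * sgn (k 0 * k 3) * sgn (k 1 * k 3)) • G 2 3 0 1 := by
  rw [shuffles_4_2, Finset.sum_insert (by decide), Finset.sum_insert (by decide),
    Finset.sum_insert (by decide), Finset.sum_insert (by decide), Finset.sum_pair (by decide),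
    koszul_one, koszul_0213, koszul_0312, koszul_1203,
    koszul_1302, koszul_2301, one_smul, neg_smul, neg_smul]
  simp only [← add_assoc, ← sub_eq_add_neg]
  rw [← add_sub_assoc]
  rfl

end Shuffles

lemma isInternal_range_lof (M : ℤ → Type) [∀ i, AddCommMonoid (M i)] [∀ i, Module ℂ (M i)] :
    DirectSum.IsInternal fun i => LinearMap.range (DirectSum.lof ℂ ℤ M i) := by
  let ψ : DirectSum ℤ M →ₗ[ℂ] DirectSum ℤ fun i => LinearMap.range (DirectSum.lof ℂ ℤ M i) :=
    DirectSum.toModule ℂ ℤ _ fun i => DirectSum.lof ℂ ℤ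
      (fun i => LinearMap.range (DirectSum.lof ℂ ℤ M i)) i ∘ₗ (DirectSum.lof ℂ ℤ M i).rangeRestrict
  have h1 : ∀ x, DirectSum.coeLinearMap (fun i => LinearMap.range (DirectSum.lof ℂ ℤ M i)) (ψ x) =
      x := by
    intro x
    induction x using DirectSum.induction_on with
    | zero => rw [map_zero, map_zero]
    | of i f =>
      change DirectSum.coeLinearMap _ (ψ (DirectSum.lof ℂ ℤ M i f)) = DirectSum.lof ℂ ℤ M i f
      simp only [ψ, DirectSum.toModule_lof, LinearMap.comp_apply, DirectSum.coeLinearMap_lof]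
      rfl
    | add x y hx hy => rw [map_add, map_add, hx, hy]
  have h2 : ∀ x, ψ (DirectSum.coeLinearMap (fun i => LinearMap.range (DirectSum.lof ℂ ℤ M i)) x) =
      x := by
    intro x
    induction x using DirectSum.induction_on with
    | zero => rw [map_zero, map_zero]
    | of i f =>
      obtain ⟨_, f, rfl⟩ := f
      change ψ (DirectSum.coeLinearMap _ (DirectSum.lof ℂ ℤ
        (fun i => LinearMap.range (DirectSum.lof ℂ ℤ M i)) i _)) = DirectSum.lof ℂ ℤ _ i _
      rw [DirectSum.coeLinearMap_lof]
      simp only [ψ, DirectSum.toModule_lof, LinearMap.comp_apply]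
      rfl
    | add x y hx hy => rw [map_add, map_add, hx, hy]
  exact ⟨fun x y h => (h2 x).symm.trans ((congrArg ψ h).trans (h2 y)), fun x => ⟨ψ x, h1 x⟩⟩

section DGModel
variable {A L : Type} [Ring A] [Module ℂ A] [IsScalarTower ℂ A A] [SMulCommClass ℂ A A]
  [AddCommGroup L] [Module ℂ L] {S : ℤ → Submodule ℂ A}

variable (S) in
/-- The inclusion of the component of degree `i`. -/
abbrev incl (i : ℤ) : S i →ₗ[ℂ] DirectSum ℤ (fun i => S i) := DirectSum.lof ℂ ℤ (fun i => S i) i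

lemma directSum_induction {P : DirectSum ℤ (fun i => S i) → Prop} (h0 : P 0)
    (h1 : ∀ i f, P (incl S i f)) (h2 : ∀ x y, P x → P y → P (x + y))
    (x : DirectSum ℤ (fun i => S i)) : P x := by
  induction x using DirectSum.induction_on with
  | zero => exact h0
  | of i f => exact h1 i f
  | add x y hx hy => exact h2 x y hx hy

lemma incl_eq_add {i j k : ℤ} (hj : i = j) (hk : i = k) {f : S i} {g : S j} {h : S k} {c : ℂ}
    (e : f.1 = g.1 + c • h.1) : incl S i f = incl S j g + c • incl S k h := by
  subst hj hk
  rw [← map_smul, ← map_add]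
  congr 1
  exact Subtype.ext e

lemma isInternal_range_incl : DirectSum.IsInternal fun i => LinearMap.range (incl S i) :=
  isInternal_range_lof _

/-- The bilinear map on a direct sum with given components. -/
def bilinSum {W : Type} [AddCommMonoid W] [Module ℂ W] (B : ∀ i j, S i →ₗ[ℂ] S j →ₗ[ℂ] W) :
    DirectSum ℤ (fun i => S i) →ₗ[ℂ] DirectSum ℤ (fun i => S i) →ₗ[ℂ] W :=
  DirectSum.toModule ℂ ℤ (DirectSum ℤ (fun i => S i) →ₗ[ℂ] W) fun i => LinearMap.flip
    (DirectSum.toModule ℂ ℤ (S i →ₗ[ℂ] W) fun j => LinearMap.flip (B i j))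

lemma bilinSum_incl {W : Type} [AddCommMonoid W] [Module ℂ W]
    (B : ∀ i j, S i →ₗ[ℂ] S j →ₗ[ℂ] W) {i j : ℤ} (f : S i) (g : S j) :
    bilinSum B (incl S i f) (incl S j g) = B i j f g := by
  unfold bilinSum
  rw [DirectSum.toModule_lof, LinearMap.flip_apply, DirectSum.toModule_lof]
  rfl

/-- `δ` and `br` are the operations `[Δ, -]` and `[-, -]` on the graded module `S` of elements
of `A`, for an element `Δ` of odd degree and square zero. -/
structure IsDGModel (S : ℤ → Submodule ℂ A) (Δ : A)
    (δ : DirectSum ℤ (fun i => S i) →ₗ[ℂ] DirectSum ℤ (fun i => S i))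
    (br : DirectSum ℤ (fun i => S i) →ₗ[ℂ] DirectSum ℤ (fun i => S i) →ₗ[ℂ]
      DirectSum ℤ (fun i => S i)) : Prop where
  sq : Δ * Δ = 0
  diff_mem : ∀ {i : ℤ} {f : A}, f ∈ S i → gcomm Δ i f ∈ S (i + 1)
  gbr_mem : ∀ {i j : ℤ} {f g : A}, f ∈ S i → g ∈ S j → gbr i j f g ∈ S (i + j)
  d_incl : ∀ (i : ℤ) (f : S i), δ (incl S i f) = incl S (i + 1) ⟨gcomm Δ i f.1, diff_mem f.2⟩
  br_incl : ∀ (i j : ℤ) (f : S i) (g : S j),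
    br (incl S i f) (incl S j g) = incl S (i + j) ⟨gbr i j f.1 g.1, gbr_mem f.2 g.2⟩

namespace IsDGModel
variable {Δ : A} {δ : DirectSum ℤ (fun i => S i) →ₗ[ℂ] DirectSum ℤ (fun i => S i)}
  {br : DirectSum ℤ (fun i => S i) →ₗ[ℂ] DirectSum ℤ (fun i => S i) →ₗ[ℂ]
    DirectSum ℤ (fun i => S i)}

lemma isDGLie (M : IsDGModel S Δ δ br) :
    IsDGLie (fun i => LinearMap.range (incl S i)) δ br where
  internal := isInternal_range_incl
  d_mem := by
    rintro i _ ⟨f, rfl⟩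
    exact ⟨_, (M.d_incl i f).symm⟩
  br_mem := by
    rintro i j _ ⟨f, rfl⟩ _ ⟨g, rfl⟩
    exact ⟨_, (M.br_incl i j f g).symm⟩
  d_d := by
    intro x
    induction x using directSum_induction with
    | h0 => rw [map_zero, map_zero]
    | h1 i f =>
      rw [M.d_incl, M.d_incl, ← map_zero (incl S (i + 1 + 1))]
      congr 1
      exact Subtype.ext (gcomm_gcomm M.sq i f.1)
    | h2 x y hx hy => rw [map_add, map_add, hx, hy, add_zero]
  skew := by
    rintro i j _ ⟨f, rfl⟩ _ ⟨g, rfl⟩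
    rw [M.br_incl, M.br_incl]
    refine (incl_eq_add rfl (add_comm i j) (f := 0) ?_).symm.trans (map_zero _)
    exact (gbr_skew i j f.1 g.1).symm
  jacobi := by
    rintro i j _ ⟨f, rfl⟩ _ ⟨g, rfl⟩ z
    induction z using directSum_induction with
    | h0 => simp only [map_zero, smul_zero, add_zero]
    | h1 k h =>
      simp only [M.br_incl]
      exact incl_eq_add (by ring) (by ring) (gbr_jacobi i j k f.1 g.1 h.1)
    | h2 x y hx hy =>
      simp only [map_add, smul_add, hx, hy]
      abel
  leibniz := by
    rintro i _ ⟨f, rfl⟩ z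
    induction z using directSum_induction with
    | h0 => simp only [map_zero, smul_zero, add_zero]
    | h1 j g =>
      simp only [M.br_incl, M.d_incl]
      exact incl_eq_add (by ring) (by ring) (gcomm_gbr Δ i j f.1 g.1)
    | h2 x y hx hy =>
      simp only [map_add, smul_add, hx, hy]
      abel

end IsDGModel

/-- A linear map as a multilinear map. -/
def multOne {V : Type} [AddCommMonoid V] [Module ℂ V] (B : V →ₗ[ℂ] L) :
    MultilinearMap ℂ (fun _ : Fin 1 => V) L :=
  MultilinearMap.mk' (fun v => B (v 0))
    (fun v i x y => by fin_cases i; simp) (fun v i c x => by fin_cases i; simp)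

/-- A bilinear map as a multilinear map. -/
def multTwo {V : Type} [AddCommMonoid V] [Module ℂ V] (B : V →ₗ[ℂ] V →ₗ[ℂ] L) :
    MultilinearMap ℂ (fun _ : Fin 2 => V) L :=
  MultilinearMap.mk' (fun v => B (v 0) (v 1))
    (fun v i x y => by fin_cases i <;> simp) (fun v i c x => by fin_cases i <;> simp)

/-- A trilinear map as a multilinear map. -/
def multThree {V : Type} [AddCommMonoid V] [Module ℂ V] (B : V →ₗ[ℂ] V →ₗ[ℂ] V →ₗ[ℂ] L) :
    MultilinearMap ℂ (fun _ : Fin 3 => V) L :=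
  MultilinearMap.mk' (fun v => B (v 0) (v 1) (v 2))
    (fun v i x y => by fin_cases i <;> simp) (fun v i c x => by fin_cases i <;> simp)

/-- A sequence of multilinear maps whose only components are in arities one, two and three. -/
def multSeq {V : Type} [AddCommMonoid V] [Module ℂ V] (B₁ : V →ₗ[ℂ] L) (B₂ : V →ₗ[ℂ] V →ₗ[ℂ] L)
    (B₃ : V →ₗ[ℂ] V →ₗ[ℂ] V →ₗ[ℂ] L) : ∀ n : ℕ, MultilinearMap ℂ (fun _ : Fin n => V) L
  | 1 => multOne B₁
  | 2 => multTwo B₂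
  | 3 => multThree B₃
  | _ => 0

variable (S) in
/-- The inclusion of the graded module in the algebra. -/
def inclAlg : DirectSum ℤ (fun i => S i) →ₗ[ℂ] A :=
  DirectSum.toModule ℂ ℤ A fun i => (S i).subtype

lemma inclAlg_incl (i : ℤ) (f : S i) : inclAlg S (incl S i f) = f.1 := by
  unfold inclAlg
  rw [DirectSum.toModule_lof]
  rfl

/-- `trPair` as a bilinear map. -/
def trPairLin (t : A →ₗ[ℂ] L) (D : A) (i j : ℤ) : A →ₗ[ℂ] A →ₗ[ℂ] L :=
  (LinearMap.mul ℂ A ∘ₗ gcommLin D i).compr₂ t -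
    sgn (i * j) • ((LinearMap.mul ℂ A ∘ₗ gcommLin D j).compr₂ t).flip

lemma trPairLin_apply (t : A →ₗ[ℂ] L) (D : A) (i j : ℤ) (f g : A) :
    trPairLin t D i j f g = trPair t D i j f g := by
  unfold trPair
  rw [map_sub, map_smul]
  rfl

variable (S) in
/-- The component `-Tr(u f)`. -/
def compOne (t : A →ₗ[ℂ] L) (u : A) : DirectSum ℤ (fun i => S i) →ₗ[ℂ] L :=
  -(t ∘ₗ LinearMap.mulLeft ℂ u ∘ₗ inclAlg S)

lemma compOne_incl (t : A →ₗ[ℂ] L) (u : A) (i : ℤ) (f : S i) :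
    compOne S t u (incl S i f) = -t (u * f.1) := by
  unfold compOne
  rw [LinearMap.neg_apply, LinearMap.comp_apply, LinearMap.comp_apply, inclAlg_incl]
  rfl

variable (S) in
/-- The component `-1/2 Tr(∇(f) g - (-1)^{ij} ∇(g) f)`. -/
def compTwo (t : A →ₗ[ℂ] L) (D : A) :
    DirectSum ℤ (fun i => S i) →ₗ[ℂ] DirectSum ℤ (fun i => S i) →ₗ[ℂ] L :=
  bilinSum fun i j => (-(1 / 2 : ℂ)) • (trPairLin t D i j).domRestrict₁₂ (S i) (S j)

lemma compTwo_incl (t : A →ₗ[ℂ] L) (D : A) (i j : ℤ) (f : S i) (g : S j) :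
    compTwo S t D (incl S i f) (incl S j g) = (-(1 / 2 : ℂ)) • trPair t D i j f.1 g.1 := by
  unfold compTwo
  rw [bilinSum_incl, ← trPairLin_apply]
  rfl

/-- The component `1/2 Tr(f [g, h])`. -/
def compThree (t : A →ₗ[ℂ] L) (br : DirectSum ℤ (fun i => S i) →ₗ[ℂ]
      DirectSum ℤ (fun i => S i) →ₗ[ℂ] DirectSum ℤ (fun i => S i)) :
    DirectSum ℤ (fun i => S i) →ₗ[ℂ] DirectSum ℤ (fun i => S i) →ₗ[ℂ]
      DirectSum ℤ (fun i => S i) →ₗ[ℂ] L :=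
  LinearMap.mk₂ ℂ (fun x y => (1 / 2 : ℂ) •
      (t ∘ₗ LinearMap.mulLeft ℂ (inclAlg S x) ∘ₗ inclAlg S ∘ₗ br y))
    (fun x x' y => LinearMap.ext fun z => by
      simp only [map_add, LinearMap.smul_apply, LinearMap.add_apply, LinearMap.comp_apply,
        LinearMap.mulLeft_apply, add_mul, smul_add])
    (fun c x y => LinearMap.ext fun z => by
      simp only [map_smul, LinearMap.smul_apply, LinearMap.comp_apply,
        LinearMap.mulLeft_apply, smul_mul_assoc]
      exact smul_comm _ _ _)
    (fun x y y' => LinearMap.ext fun z => by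
      simp only [map_add, LinearMap.smul_apply, LinearMap.add_apply, LinearMap.comp_apply,
        smul_add])
    (fun c x y => LinearMap.ext fun z => by
      simp only [map_smul, LinearMap.smul_apply, LinearMap.comp_apply]
      exact smul_comm _ _ _)

lemma IsDGModel.compThree_incl {Δ : A}
    {δ : DirectSum ℤ (fun i => S i) →ₗ[ℂ] DirectSum ℤ (fun i => S i)}
    {br : DirectSum ℤ (fun i => S i) →ₗ[ℂ] DirectSum ℤ (fun i => S i) →ₗ[ℂ]
      DirectSum ℤ (fun i => S i)} (M : IsDGModel S Δ δ br) (t : A →ₗ[ℂ] L) (i j k : ℤ) (f : S i)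
    (g : S j) (h : S k) : compThree t br (incl S i f) (incl S j g) (incl S k h) =
      (1 / 2 : ℂ) • t (f.1 * gbr j k g.1 h.1) := by
  change (1 / 2 : ℂ) • t (inclAlg S (incl S i f) * inclAlg S (br (incl S j g) (incl S k h))) = _
  rw [M.br_incl, inclAlg_incl, inclAlg_incl]

end DGModel

section LInfty
variable {A L : Type} [Ring A] [Module ℂ A] [IsScalarTower ℂ A A] [SMulCommClass ℂ A A]
  [AddCommGroup L] [Module ℂ L] {S : ℤ → Submodule ℂ A}
  {Δ : A} {δ : DirectSum ℤ (fun i => S i) →ₗ[ℂ] DirectSum ℤ (fun i => S i)}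
  {br : DirectSum ℤ (fun i => S i) →ₗ[ℂ] DirectSum ℤ (fun i => S i) →ₗ[ℂ]
    DirectSum ℤ (fun i => S i)}
  {Gr : ℕ → ℤ → Submodule ℂ A} {D : A} {t : A →ₗ[ℂ] L} {d : L →ₗ[ℂ] L}

variable (S) in
/-- The components of the `L_∞` morphism attached to a trace. -/
def traceSeq (t : A →ₗ[ℂ] L) (D u : A) (br : DirectSum ℤ (fun i => S i) →ₗ[ℂ]
      DirectSum ℤ (fun i => S i) →ₗ[ℂ] DirectSum ℤ (fun i => S i)) (n : ℕ) :
    MultilinearMap ℂ (fun _ : Fin n => DirectSum ℤ (fun i => S i)) L :=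
  multSeq (compOne S t u) (compTwo S t D) (compThree t br) n

lemma TraceCalculus.gbr_mem (C : TraceCalculus Gr D Δ t d) {i j : ℤ} {f g : A}
    (hf : f ∈ Gr 0 i) (hg : g ∈ Gr 0 j) : gbr i j f g ∈ Gr 0 (i + j) := by
  refine Submodule.sub_mem _ (C.mul_mem hf hg) (Submodule.smul_mem _ _ ?_)
  have := C.mul_mem hg hf
  rwa [add_comm j i] at this

lemma TraceCalculus.trPair_mem (C : TraceCalculus Gr D Δ t d) {degL : ℤ → Submodule ℂ L}
    (hdeg : ∀ (a : ℕ) (i : ℤ) (f : A), f ∈ Gr a i → t f ∈ degL (i - 2)) {i j : ℤ} {f g : A}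
    (hf : f ∈ Gr 0 i) (hg : g ∈ Gr 0 j) : trPair t D i j f g ∈ degL (i + j - 1) := by
  have h1 := hdeg _ _ _ (C.mul_mem (C.comm_mem hf) hg)
  have h2 := hdeg _ _ _ (C.mul_mem (C.comm_mem hg) hf)
  have e1 : i + 1 + j - 2 = i + j - 1 := by ring
  have e2 : j + 1 + i - 2 = i + j - 1 := by ring
  rw [e1] at h1
  rw [e2] at h2
  unfold trPair
  rw [map_sub, map_smul]
  exact Submodule.sub_mem _ h1 (Submodule.smul_mem _ _ h2)

lemma traceSeq_degree (M : IsDGModel S Δ δ br) (C : TraceCalculus Gr D Δ t d)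
    (hS : ∀ i, S i ≤ Gr 0 i) {degL : ℤ → Submodule ℂ L}
    (hdeg : ∀ (a : ℕ) (i : ℤ) (f : A), f ∈ Gr a i → t f ∈ degL (i - 2)) (n : ℕ) (k : Fin n → ℤ)
    (f : ∀ i, S (k i)) : traceSeq S t D (D * Δ + Δ * D) br n (fun i => incl S (k i) (f i)) ∈
      degL ((∑ i, k i) + 1 - n) := by
  match n, k, f with
  | 1, k, f =>
    have h := hdeg _ _ _ (C.mul_mem C.curv_mem (hS _ (f 0).2))
    have e : 2 + k 0 - 2 = (∑ i, k i) + 1 - (1 : ℕ) := by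
      rw [Fin.sum_univ_one]; push_cast; ring
    rw [e] at h
    change compOne S t _ (incl S (k 0) (f 0)) ∈ degL _
    rw [compOne_incl]
    exact Submodule.neg_mem _ h
  | 2, k, f =>
    have h := C.trPair_mem hdeg (hS _ (f 0).2) (hS _ (f 1).2)
    have e : k 0 + k 1 - 1 = (∑ i, k i) + 1 - (2 : ℕ) := by
      rw [Fin.sum_univ_two]; push_cast; ring
    rw [e] at h
    change compTwo S t D (incl S (k 0) (f 0)) (incl S (k 1) (f 1)) ∈ degL _
    rw [compTwo_incl]
    exact Submodule.smul_mem _ _ h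
  | 3, k, f =>
    have h := hdeg _ _ _ (C.mul_mem (hS _ (f 0).2) (C.gbr_mem (hS _ (f 1).2) (hS _ (f 2).2)))
    have e : k 0 + (k 1 + k 2) - 2 = (∑ i, k i) + 1 - (3 : ℕ) := by
      rw [Fin.sum_univ_three]; push_cast; ring
    rw [e] at h
    change compThree t br (incl S (k 0) (f 0)) (incl S (k 1) (f 1)) (incl S (k 2) (f 2)) ∈ degL _
    rw [M.compThree_incl]
    exact Submodule.smul_mem _ _ h
  | 0, k, f => exact Submodule.zero_mem _
  | n + 4, k, f => exact Submodule.zero_mem _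

lemma traceSeq_skew (M : IsDGModel S Δ δ br) (C : TraceCalculus Gr D Δ t d)
    (hS : ∀ i, S i ≤ Gr 0 i) (n : ℕ) (k : Fin n → ℤ) (f : ∀ i, S (k i))
    (σ : Equiv.Perm (Fin n)) :
    traceSeq S t D (D * Δ + Δ * D) br n (fun i => incl S (k (σ i)) (f (σ i))) =
      koszul k σ • traceSeq S t D (D * Δ + Δ * D) br n (fun i => incl S (k i) (f i)) := by
  match n, k, f, σ with
  | 1, k, f, σ =>
    obtain rfl : σ = 1 := Subsingleton.elim _ _
    rw [koszul_one, one_smul]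
    rfl
  | 2, k, f, σ =>
    change compTwo S t D (incl S (k (σ 0)) (f (σ 0))) (incl S (k (σ 1)) (f (σ 1))) =
      koszul k σ • compTwo S t D (incl S (k 0) (f 0)) (incl S (k 1) (f 1))
    rw [compTwo_incl, compTwo_incl]
    rcases perm_two σ with rfl | rfl
    · rw [koszul_one, one_smul]
      rfl
    · rw [koszul_10, smul_comm, ← trPair_swap]
      rfl
  | 3, k, f, σ =>
    change compThree t br (incl S (k (σ 0)) (f (σ 0))) (incl S (k (σ 1)) (f (σ 1)))
      (incl S (k (σ 2)) (f (σ 2))) =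
      koszul k σ • compThree t br (incl S (k 0) (f 0)) (incl S (k 1) (f 1)) (incl S (k 2) (f 2))
    rw [M.compThree_incl, M.compThree_incl, smul_comm]
    congr 1
    have h0 := hS _ (f 0).2
    have h1 := hS _ (f 1).2
    have h2 := hS _ (f 2).2
    rcases perm_three σ with rfl | rfl | rfl | rfl | rfl | rfl
    · rw [koszul_one, one_smul]
      rfl
    · rw [koszul_102, ← C.tr_swap_left h0 h1 h2]
      rfl
    · rw [koszul_021, ← TraceCalculus.tr_swap_right]
      rfl
    · have e : (sgn (k 0 * k 2) * sgn (k 1 * k 2)) • t ((f 0).1 * gbr (k 1) (k 2) (f 1).1 (f 2).1) =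
          t ((f 2).1 * gbr (k 0) (k 1) (f 0).1 (f 1).1) := by
        rw [C.tr_swap_left h0 h2 h1, TraceCalculus.tr_swap_right (j := k 1) (k := k 2), smul_smul,
          neg_mul_neg]
      rw [koszul_201, e]
      rfl
    · have e : (sgn (k 0 * k 1) * sgn (k 0 * k 2)) • t ((f 0).1 * gbr (k 1) (k 2) (f 1).1 (f 2).1) =
          t ((f 1).1 * gbr (k 2) (k 0) (f 2).1 (f 0).1) := by
        rw [TraceCalculus.tr_swap_right (j := k 0) (k := k 2), C.tr_swap_left h0 h1 h2, smul_smul,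
          neg_mul_neg, mul_comm]
      rw [koszul_120, e]
      rfl
    · have e : (-(sgn (k 0 * k 1) * sgn (k 0 * k 2) * sgn (k 1 * k 2))) •
          t ((f 0).1 * gbr (k 1) (k 2) (f 1).1 (f 2).1) =
          t ((f 2).1 * gbr (k 1) (k 0) (f 1).1 (f 0).1) := by
        rw [TraceCalculus.tr_swap_right (j := k 0) (k := k 1), C.tr_swap_left h0 h2 h1,
          TraceCalculus.tr_swap_right (j := k 1) (k := k 2), smul_smul, smul_smul]
        congr 1
        ring
      rw [koszul_210, e]
      rfl
  | 0, k, f, σ => exact (smul_zero _).symm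
  | n + 4, k, f, σ => exact (smul_zero _).symm

lemma traceSeq_morphism (M : IsDGModel S Δ δ br) (C : TraceCalculus Gr D Δ t d)
    (hS : ∀ i, S i ≤ Gr 0 i) (v : DirectSum ℤ (fun i => S i)) :
    traceSeq S t D (D * Δ + Δ * D) br 1 ![δ v] =
      d (traceSeq S t D (D * Δ + Δ * D) br 1 ![v]) := by
  change compOne S t _ (δ v) = d (compOne S t _ v)
  induction v using directSum_induction with
  | h0 => rw [map_zero, map_zero, map_zero]
  | h1 i f => rw [M.d_incl, compOne_incl, compOne_incl, map_neg, C.d_curv (hS _ f.2)]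
  | h2 x y hx hy => rw [map_add, map_add, map_add, map_add, hx, hy]

lemma traceSeq_relation_two (M : IsDGModel S Δ δ br) (C : TraceCalculus Gr D Δ t d)
    (hS : ∀ i, S i ≤ Gr 0 i) {i j : ℤ} (f : S i) (g : S j) :
    d (compTwo S t D (incl S i f) (incl S j g)) =
      (-1 : ℂ) • (compTwo S t D (δ (incl S i f)) (incl S j g) -
        sgn (i * j) • compTwo S t D (δ (incl S j g)) (incl S i f)) +
      (1 : ℂ) • compOne S t (D * Δ + Δ * D) (br (incl S i f) (incl S j g)) := by
  rw [M.d_incl, M.d_incl, M.br_incl, compTwo_incl, compTwo_incl, compTwo_incl, compOne_incl,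
    map_smul, C.d_trPair (hS _ f.2) (hS _ g.2)]
  module

lemma traceSeq_relation_three (M : IsDGModel S Δ δ br) (C : TraceCalculus Gr D Δ t d)
    (hS : ∀ i, S i ≤ Gr 0 i) {i j k : ℤ} (f : S i) (g : S j) (h : S k) :
    d (compThree t br (incl S i f) (incl S j g) (incl S k h)) =
      (1 : ℂ) • (compThree t br (δ (incl S i f)) (incl S j g) (incl S k h) -
        sgn (i * j) • compThree t br (δ (incl S j g)) (incl S i f) (incl S k h) +
        (sgn (i * k) * sgn (j * k)) •
          compThree t br (δ (incl S k h)) (incl S i f) (incl S j g)) +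
      (-1 : ℂ) • (compTwo S t D (br (incl S i f) (incl S j g)) (incl S k h) -
        sgn (j * k) • compTwo S t D (br (incl S i f) (incl S k h)) (incl S j g) +
        (sgn (i * j) * sgn (i * k)) •
          compTwo S t D (br (incl S j g) (incl S k h)) (incl S i f)) := by
  simp only [M.d_incl, M.br_incl, compTwo_incl, M.compThree_incl, map_smul,
    C.d_tr_mul_gbr (hS _ f.2) (hS _ g.2) (hS _ h.2)]
  module

lemma traceSeq_relation_four (M : IsDGModel S Δ δ br) (C : TraceCalculus Gr D Δ t d)
    (hS : ∀ i, S i ≤ Gr 0 i) {i j k l : ℤ} (f : S i) (g : S j) (h : S k) (m : S l) :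
    compThree t br (br (incl S i f) (incl S j g)) (incl S k h) (incl S l m) -
      sgn (j * k) • compThree t br (br (incl S i f) (incl S k h)) (incl S j g) (incl S l m) +
      (sgn (j * l) * sgn (k * l)) •
        compThree t br (br (incl S i f) (incl S l m)) (incl S j g) (incl S k h) +
      (sgn (i * j) * sgn (i * k)) •
        compThree t br (br (incl S j g) (incl S k h)) (incl S i f) (incl S l m) -
      (sgn (i * j) * sgn (i * l) * sgn (k * l)) •
        compThree t br (br (incl S j g) (incl S l m)) (incl S i f) (incl S k h) +
      (sgn (i * k) * sgn (j * k) * sgn (i * l) * sgn (j * l)) •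
        compThree t br (br (incl S k h) (incl S l m)) (incl S i f) (incl S j g) = 0 := by
  have e := congrArg (fun x => (1 / 2 : ℂ) • x)
    (C.tr_gbr_mul_gbr (hS _ f.2) (hS _ g.2) (hS _ h.2) (hS _ m.2))
  simp only [M.br_incl, M.compThree_incl]
  simp only [smul_zero] at e
  rw [← e]
  module

lemma traceSeq_relation (M : IsDGModel S Δ δ br) (C : TraceCalculus Gr D Δ t d)
    (hS : ∀ i, S i ≤ Gr 0 i) (m : ℕ) (k : Fin (m + 2) → ℤ)
    (v : Fin (m + 2) → DirectSum ℤ (fun i => S i)) (f : ∀ i, S (k i))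
    (hv : ∀ i, incl S (k i) (f i) = v i) :
    d (traceSeq S t D (D * Δ + Δ * D) br (m + 2) v) =
      sgn (m + 1) • (∑ σ ∈ shuffles (m + 2) 1, koszul k σ •
        traceSeq S t D (D * Δ + Δ * D) br (m + 2)
          (Fin.cons (δ (v (σ 0))) fun i : Fin (m + 1) => v (σ i.succ))) +
      sgn m • (∑ σ ∈ shuffles (m + 2) 2, koszul k σ •
        traceSeq S t D (D * Δ + Δ * D) br (m + 1)
          (Fin.cons (br (v (σ 0)) (v (σ 1))) fun i : Fin m => v (σ i.succ.succ))) := by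
  match m, k, v, f, hv with
  | 0, k, v, f, hv =>
    have h1 := sum_shuffles_2_1 k fun a b => compTwo S t D (δ (v a)) (v b)
    have h2 : ∑ σ ∈ shuffles 2 2, koszul k σ • compOne S t (D * Δ + Δ * D)
        (br (v (σ 0)) (v (σ 1))) = compOne S t (D * Δ + Δ * D) (br (v 0) (v 1)) := by
      rw [shuffles_2_2, Finset.sum_singleton, koszul_one, one_smul]
      rfl
    have h3 := traceSeq_relation_two M C hS (f 0) (f 1)
    rw [hv 0, hv 1, ← h1, ← h2] at h3
    have s1 : sgn (((0 : ℕ) : ℤ) + 1) = -1 := by norm_num [sgn]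
    have s2 : sgn ((0 : ℕ) : ℤ) = 1 := by norm_num [sgn]
    rw [s1, s2]
    exact h3
  | 1, k, v, f, hv =>
    have h1 := sum_shuffles_3_1 k fun a b c => compThree t br (δ (v a)) (v b) (v c)
    have h2 := sum_shuffles_3_2 k fun a b c => compTwo S t D (br (v a) (v b)) (v c)
    have h3 := traceSeq_relation_three M C hS (f 0) (f 1) (f 2)
    rw [hv 0, hv 1, hv 2, ← h1, ← h2] at h3
    have s1 : sgn (((1 : ℕ) : ℤ) + 1) = 1 := by norm_num [sgn]
    have s2 : sgn ((1 : ℕ) : ℤ) = -1 := by norm_num [sgn]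
    rw [s1, s2]
    exact h3
  | 2, k, v, f, hv =>
    have h2 := sum_shuffles_4_2 k fun a b c e => compThree t br (br (v a) (v b)) (v c) (v e)
    have h3 := traceSeq_relation_four M C hS (f 0) (f 1) (f 2) (f 3)
    rw [hv 0, hv 1, hv 2, hv 3, ← h2] at h3
    have h4 : ∀ w, traceSeq S t D (D * Δ + Δ * D) br (2 + 2) w = 0 := fun w => rfl
    simp only [h4, map_zero, smul_zero, Finset.sum_const_zero, zero_add]
    exact ((congrArg (fun x => sgn (2 : ℕ) • x) h3).trans (smul_zero _)).symm
  | m + 3, k, v, f, hv =>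
    have h4 : ∀ w, traceSeq S t D (D * Δ + Δ * D) br (m + 3 + 2) w = 0 := fun w => rfl
    have h5 : ∀ w, traceSeq S t D (D * Δ + Δ * D) br (m + 3 + 1) w = 0 := fun w => rfl
    simp only [h4, h5, map_zero, smul_zero, Finset.sum_const_zero, zero_add]

lemma traceSeq_isLInfty (M : IsDGModel S Δ δ br) (C : TraceCalculus Gr D Δ t d)
    (hS : ∀ i, S i ≤ Gr 0 i) {degL : ℤ → Submodule ℂ L}
    (hdeg : ∀ (a : ℕ) (i : ℤ) (f : A), f ∈ Gr a i → t f ∈ degL (i - 2)) :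
    IsLInfty (fun i => LinearMap.range (incl S i)) δ br degL d 0
      (traceSeq S t D (D * Δ + Δ * D) br) where
  degree n _ k v hv := by
    choose f hf using hv
    obtain rfl : (fun i => incl S (k i) (f i)) = v := funext hf
    exact traceSeq_degree M C hS hdeg n k f
  skew n _ k v hv σ := by
    choose f hf using hv
    obtain rfl : (fun i => incl S (k i) (f i)) = v := funext hf
    exact traceSeq_skew M C hS n k f σ
  morphism := traceSeq_morphism M C hS
  relation m k v hv := by
    choose f hf using hv
    simp only [LinearMap.zero_apply, smul_zero, Finset.sum_const_zero, zero_add]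
    exact traceSeq_relation M C hS m k v f hf

end LInfty

section Source
variable {H : Type} [NormedAddCommGroup H] [NormedSpace ℂ H] [FiniteDimensional ℂ H]
  {X : Type} [TopologicalSpace X] [ChartedSpace H X] [IsManifold 𝓘(ℂ, H) ω X]
  {E : CochainComplex (HolMod H X) ℤ} {p q : ℤ}

lemma homDiff_eq_gcomm (i : ℤ) (f : EndE E) : homDiff E i f = gcomm (eDelta + eDelbar) i f := rfl

lemma homBr_eq_gbr (i j : ℤ) (f g : EndE E) : homBr E i j f g = gbr i j f g := rfl

lemma homD_incl (i : ℤ) (f : AHom0 E i) : homD E (incl (AHom0 E) i f) =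
    incl (AHom0 E) (i + 1) ⟨homDiff E i f.1, homDiff_mem f.2⟩ := by
  unfold homD
  rw [DirectSum.toModule_lof]
  rfl

lemma homBracket_incl (i j : ℤ) (f : AHom0 E i) (g : AHom0 E j) :
    homBracket E (incl (AHom0 E) i f) (incl (AHom0 E) j g) =
      incl (AHom0 E) (i + j) ⟨homBr E i j f.1 g.1, homBr_mem f.2 g.2⟩ := by
  have h := bilinSum_incl (fun i j => (homBrAux E i j).compr₂ (homOf E (i + j))) f g
  exact h

variable (E) in
lemma homDG_isDGModel :
    IsDGModel (AHom0 E) (eDelta + eDelbar : EndE E) (homD E) (homBracket E) where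
  sq := diff_diff
  diff_mem {i f} hf := by
    rw [← homDiff_eq_gcomm]
    exact homDiff_mem hf
  gbr_mem {i j f g} hf hg := by
    rw [← homBr_eq_gbr]
    exact homBr_mem hf hg
  d_incl i f := (homD_incl i f).trans (congrArg _ (Subtype.ext (homDiff_eq_gcomm i f.1)))
  br_incl i j f g := (homBracket_incl i j f g).trans
    (congrArg _ (Subtype.ext (homBr_eq_gbr i j f.1 g.1)))

lemma IsTraceMap.mkQ_mem_drDeg {T : EndE E →ₗ[ℂ] GForms H X} (hT : IsTraceMap p q T)
    (hE : IsLocallyFree E p q) (a : ℕ) (i : ℤ) (f : EndE E) (hf : f ∈ THom E a i) :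
    ((formsF2 H X).mkQ ∘ₗ T) f ∈ drDeg H X (i - 2) := by
  have h := hT.mem_formsDeg hE hf
  rw [← sub_add_cancel i 2] at h
  exact ⟨_, h, rfl⟩

end Source

end Semireg
end

theorem corollary3p6 {H : Type} [NormedAddCommGroup H] [NormedSpace ℂ H] [FiniteDimensional ℂ H]
    {X : Type} [TopologicalSpace X] [ChartedSpace H X] [IsManifold 𝓘(ℂ, H) ω X]
    (E : CochainComplex (HolMod H X) ℤ) (p q : ℤ) (hE : IsLocallyFree E p q)
    (D : EndE E) (hD : IsConnection10 D) :
    IsDGLie (homDeg E) (homD E) (homBracket E) ∧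
    IsDGLie (drDeg H X) (drD H X) 0 ∧
    ∃ g : ∀ n : ℕ, MultilinearMap ℂ (fun _ : Fin n => HomDG E) (DRQuot H X),
      IsLInfty (homDeg E) (homD E) (homBracket E) (drDeg H X) (drD H X) 0 g ∧
      (∀ (i : ℤ) (f : AHom0 E i), ∃ τ ∈ formsRow H X 1,
        IsTrace p q (atiyah D * f.1) τ ∧
        g 1 ![homOf E i f] = (formsF2 H X).mkQ (-τ)) ∧
      (∀ (i j : ℤ) (f : AHom0 E i) (f' : AHom0 E j), ∃ τ ∈ formsRow H X 1,
        IsTrace p q (nabla D i f.1 * f'.1 - sgn (i * j) • (nabla D j f'.1 * f.1)) τ ∧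
        g 2 ![homOf E i f, homOf E j f'] = (formsF2 H X).mkQ (-(1 / 2 : ℂ) • τ)) ∧
      (∀ (i j k : ℤ) (f : AHom0 E i) (f' : AHom0 E j) (f'' : AHom0 E k), ∃ τ ∈ formsRow H X 0,
        IsTrace p q (f.1 * homBr E j k f'.1 f''.1) τ ∧
        g 3 ![homOf E i f, homOf E j f', homOf E k f''] = (formsF2 H X).mkQ ((1 / 2 : ℂ) • τ)) ∧
      ∀ n, 3 < n → g n = 0 := by
  obtain ⟨T, hT⟩ : ∃ T : EndE E →ₗ[ℂ] GForms H X, IsTraceMap p q T := exists_trace hE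
  have C := IsTraceMap.traceCalculus hT hE hD
  have M := homDG_isDGModel E
  have hS : ∀ i, AHom0 E i ≤ THom E 0 i := AHom0_le_THom
  have hu : atiyah D ∈ THom E 1 2 := by
    rw [atiyah_eq]
    exact C.curv_mem
  refine ⟨M.isDGLie, drD_isDGLie, traceSeq (AHom0 E) ((formsF2 H X).mkQ ∘ₗ T) (D - eDelbar)
    ((D - eDelbar) * (eDelta + eDelbar) + (eDelta + eDelbar) * (D - eDelbar)) (homBracket E),
    traceSeq_isLInfty M C hS (hT.mkQ_mem_drDeg hE), fun i f => ?_, fun i j f f' => ?_,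
    fun i j k f f' f'' => ?_, fun n hn => ?_⟩
  · have hm := THom_mul_mem hu (hS i f.2)
    refine ⟨T (atiyah D * f.1), hT.mem_formsRow hE hm, hT.isTrace (THom_le_linEnd _ _ hm), ?_⟩
    rw [LinearMap.map_neg, ← atiyah_eq]
    exact compOne_incl ((formsF2 H X).mkQ ∘ₗ T) (atiyah D) i f
  · have h1 := THom_mul_mem (C.comm_mem (hS i f.2)) (hS j f'.2)
    have h2 := THom_mul_mem (C.comm_mem (hS j f'.2)) (hS i f.2)
    rw [show j + 1 + i = i + 1 + j by ring] at h2
    have hm := Submodule.sub_mem _ h1 (Submodule.smul_mem _ (sgn (i * j)) h2)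
    refine ⟨T _, hT.mem_formsRow hE hm, hT.isTrace (THom_le_linEnd _ _ hm), ?_⟩
    rw [LinearMap.map_smul]
    exact compTwo_incl _ _ i j f f'
  · have hm := THom_mul_mem (hS i f.2) (C.gbr_mem (hS j f'.2) (hS k f''.2))
    refine ⟨T _, hT.mem_formsRow hE hm, hT.isTrace (THom_le_linEnd _ _ hm), ?_⟩
    rw [LinearMap.map_smul]
    exact M.compThree_incl _ i j k f f' f''
  · obtain ⟨m, rfl⟩ := Nat.exists_eq_add_of_lt hn
    rw [show 3 + m + 1 = m + 4 by ring]
    rfl
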